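/- **Setting.** Let $T>0$ and let $(\mathbf X,\mathbf H,\mathbf X')$ be a normal triple of real Hilbert spaces: $\mathbf X$ is continuously, injectively and densely embedded in $\mathbf H$, $\mathbf X'$ is the dual of $\mathbf X$ with the dual norm, and $\mathbf H\subset\mathbf X'$ through $\langle y,v\rangle=(y,v)_{\mathbf H}$ for $y\in\mathbf H$, $v\in\mathbf X$. A *colored noise* on $L_2((0,T))$ with covariance operator $\mathcal R$ (a bounded operator on $L_2((0,T))$) is a collection of zero-mean Gaussian random variables $\mathfrak X(f)$, $f\in L_2((0,T))$, with $\mathbb E(\mathfrak X(f)\mathfrak X(g))=\int_0^T(\mathcal Rf)(s)g(s)\,ds$. A pair $(\mathcal K,W)$ of a bounded operator $\mathcal K$ on $L_2((0,T))$ with $\mathcal K\mathcal K^*=\mathcal R$ and a standard Brownian motion $W$ is a *representation* of $\mathfrak X$ if $\mathfrak X(f)=\int_0^T(\mathcal K^*f)(s)\,dW(s)$ for all $f\in L_2((0,T))$. **Assumptions.** 1. $\mathcal A:\mathbf X\to\mathbf X'$ is bounded, linear and strongly parabolic: for some $\delta_A>0$, $C_A\in\mathbb R$, $$2\langle\mathcal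 Av,v\rangle+\delta_A\|v\|_{\mathbf X}^2\le C_A\|v\|_{\mathbf H}^2,\qquad v\in\mathbf X.$$ 2. $\mathfrak X_\ell$, $\ell\ge1$, are independent colored noises on $L_2((0,T))$ with representations $(\mathcal K_\ell,W_\ell)$, where the Brownian motions $W_\ell$, $\ell\ge 1$, are independent; $\mathfrak K_\ell$ is the operator norm of $\mathcal K_\ell$. 3. The inputs $u_0\in\mathbf H$, $F\in L_2((0,T);\mathbf X')$, $G_\ell\in L_2((0,T);\mathbf H)$ are non-random. 4. $\mathcal B_\ell$, $\ell\ge1$, are bounded linear operators on $\mathbf H$ with operator norms $C_\ell$. 5. $C_B=\sum_{\ell}\mathfrak K_\ell^2C_\ell^2<\infty$ and $$I_0=\|u_0\|_{\mathbf H}^2+\frac2{\delta_A}\int_0^T\|F(t)\|_{\mathbf X'}^2dt+\sum_{\ell}\mathfrak K_\ell^2\int_0^T\|G_\ell(t)\|_{\mathbf H}^2dt<\infty .$$ **Chaos solution.** Let $\{h_k,\ k\ge1\}$ be an orthonormal basis of $L_2((0,T))$, let $\xi_{k\ell}=\int_0^Th_k\,dW_\ell$, and let $\mathcal J$ be the set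 of multi-indices $\alpha=(\alpha_{k\ell})_{k,\ell\ge1}$ of non-negative integers with finite sum. Put $\xi_\alpha=\prod_{k,\ell}H_{\alpha_{k\ell}}(\xi_{k\ell})/\sqrt{\alpha_{k\ell}!}$, with $H_n(t)=(-1)^ne^{t^2/2}\frac{d^n}{dt^n}e^{-t^2/2}$, and let $\epsilon_{k\ell}$ be the multi-index whose only nonzero entry is a $1$ at $(k,\ell)$. A *chaos solution* of $$u(t)=u_0+\int_0^t(\mathcal Au(s)+F(s))\,ds+\sum_{\ell\ge1}\mathfrak X_\ell(\chi_t\mathcal B_\ell u+\chi_tG_\ell),\qquad t\in[0,T],$$ where $\chi_t$ is the characteristic function of $[0,t]$, is a family $\{u_\alpha,\ \alpha\in\mathcal J\}$ of functions $[0,T]\to\mathbf X'$ such that each $u_\alpha$ coincides almost everywhere with an element of $L_2((0,T);\mathbf X)$ and the S-system $$u_\alpha(t)=u_{0,\alpha}+\int_0^t(\mathcal Au_\alpha+F_\alpha)\,ds+\sum_{k,\ell}\sqrt{\alpha_{k\ell}}\int_0^t\bigl(\mathcal B_\ell u_{\alpha-\epsilon_{k\ell}}(s)+G_{\ell,\alpha-\epsilon_{k\ell}}(s)\bigr)(\mathcal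 K_\ell h_k)(s)\,ds$$ holds in $\mathbf X'$ for all $\alpha\in\mathcal J$ and $t\in[0,T]$, where $u_{0,\alpha}=\mathbb E(u_0\xi_\alpha)$, $F_\alpha(t)=\mathbb E(F(t)\xi_\alpha)$, $G_{\ell,\alpha}(t)=\mathbb E(G_\ell(t)\xi_\alpha)$. **Theorem.** Under these assumptions the equation has a unique chaos solution $\{u_\alpha\}$. All $u_\alpha(t)$, $t\in[0,T]$, belong to $\mathbf H$, and the solution is square integrable: $\sup_{t\in[0,T]}\sum_{\alpha\in\mathcal J}\|u_\alpha(t)\|_{\mathbf H}^2<\infty$. For every $t\in[0,T]$ the series $u(t)=\sum_{\alpha\in\mathcal J}u_\alpha(t)\xi_\alpha$ converges unconditionally in $L_2(\Omega;\mathbf H)$, and, if $C_A\ge0$, $$\sup_{t\in[0,T]}\mathbb E\|u(t)\|_{\mathbf H}^2\le C_o\,e^{(C_A+C_B)T}I_0$$ for some constant $1\le C_o\le3$, with $C_o=1$ if $F=G_\ell=0$ (almost everywhere) for all $\ell$. -/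

import Mathlib

open MeasureTheory ProbabilityTheory Filter Topology
open scoped NNReal ENNReal

namespace ColoredChaos

noncomputable section

/-- Lebesgue measure on the interval `(0, T)`. -/
abbrev timeMeasure (T : ℝ) : Measure ℝ := volume.restrict (Set.Ioo 0 T)

/-- The real Hilbert space `L₂((0,T))`. -/
abbrev L2T (T : ℝ) : Type := Lp ℝ 2 (timeMeasure T)

/-! ### Colored noise and its representations -/

/-- A colored noise on `L₂((0,T))` with covariance operator `R`: zero-mean Gaussian random
variables `N f`, `f ∈ L₂((0,T))`, with `E (N f * N g) = ∫₀ᵀ (R f)(s) g(s) ds`. -/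
structure IsColoredNoise {Ω : Type*} [MeasurableSpace Ω] (P : Measure Ω) {T : ℝ}
    (N : L2T T → Ω → ℝ) (R : L2T T →L[ℝ] L2T T) : Prop where
  gaussian : ∀ f, HasGaussianLaw (N f) P
  mean : ∀ f, ∫ ω, N f ω ∂P = 0
  covariance : ∀ f g, ∫ ω, N f ω * N g ω ∂P = ∫ s in Set.Ioo 0 T, R f s * g s

/-- The characteristic function `χ_t` of `[0, t]`, as an element of `L₂((0,T))`. -/
def chi (T t : ℝ) : L2T T :=
  indicatorConstLp 2 (measurableSet_Icc : MeasurableSet (Set.Icc 0 t))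
    (measure_ne_top (timeMeasure T) _) 1

/-- The closure in `L₂((0,T)) × L₂(Ω)` of the set of pairs `(∑ cᵢ χ_{tᵢ}, ∑ cᵢ W_{tᵢ})` with
`tᵢ ∈ [0,T]`. For a standard Brownian motion `W` it is the graph of the Wiener integral, since
`χ_t ↦ W_t` extends to a linear isometry and the step functions are dense. -/
def wienerGraph {Ω : Type*} [MeasurableSpace Ω] (P : Measure Ω) (T : ℝ) (W : ℝ≥0 → Ω → ℝ) :
    Submodule ℝ (L2T T × Lp ℝ 2 P) :=
  (Submodule.span ℝ
    {p : L2T T × Lp ℝ 2 P | ∃ t : ℝ≥0, (t : ℝ) ≤ T ∧ p.1 = chi T t ∧ p.2 =ᵐ[P] W t}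
    ).topologicalClosure

/-- The Wiener integral `∫₀ᵀ f(s) dW(s)` of a deterministic `f ∈ L₂((0,T))`: the mean square limit
of the integrals of step functions that approximate `f` in `L₂((0,T))`. -/
def wienerIntegral {Ω : Type*} [MeasurableSpace Ω] (P : Measure Ω) (T : ℝ) (W : ℝ≥0 → Ω → ℝ)
    (f : L2T T) : Lp ℝ 2 P :=
  Classical.epsilon fun η : Lp ℝ 2 P => (f, η) ∈ wienerGraph P T W

/-- `(K, W)` is a representation of the colored noise `N` with covariance operator `R`:
`K` is a representation operator, `K K* = R`, and `W` is a standard Brownian motion with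
`N f = ∫₀ᵀ (K* f)(s) dW(s)` for all `f ∈ L₂((0,T))`. -/
structure IsRepresentation {Ω : Type*} [MeasurableSpace Ω] (P : Measure Ω) {T : ℝ}
    (N : L2T T → Ω → ℝ) (R K : L2T T →L[ℝ] L2T T) (W : ℝ≥0 → Ω → ℝ) : Prop where
  comp_adjoint : K ∘L ContinuousLinearMap.adjoint K = R
  brownian : IsBrownianReal W P
  integral_eq : ∀ f, N f =ᵐ[P] wienerIntegral P T W (ContinuousLinearMap.adjoint K f)

/-! ### The chaos basis -/

/-- Multi-indices `α = (α_{kℓ})` with finitely many nonzero entries; `(k, ℓ)` is the index of the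
`k`-th basis function and the `ℓ`-th noise, both counted from `0`. -/
abbrev MultiIndex : Type := (ℕ × ℕ) →₀ ℕ

/-- `ξ_α = ∏_{k,ℓ} H_{α_{kℓ}}(ξ_{kℓ}) / √(α_{kℓ}!)`, where `ξ_{kℓ} = ∫₀ᵀ h_k(t) dW_ℓ(t)` and `H_n`
is the `n`-th (probabilists') Hermite polynomial. -/
def xi {Ω : Type*} [MeasurableSpace Ω] (P : Measure Ω) {T : ℝ} (h : ℕ → L2T T)
    (W : ℕ → ℝ≥0 → Ω → ℝ) (α : MultiIndex) (ω : Ω) : ℝ :=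
  α.prod fun kl n =>
    Polynomial.aeval (wienerIntegral P T (W kl.2) (h kl.1) ω) (Polynomial.hermite n) /
      √(n.factorial : ℝ)

/-- The random element `U` is the sum of the chaos series `∑_α a_α ξ_α`, the series being
(unconditionally) convergent in `L₂(Ω; H)`. -/
def IsChaosSum {Ω H : Type*} [MeasurableSpace Ω] [NormedAddCommGroup H] [InnerProductSpace ℝ H]
    (P : Measure Ω) (ξ : MultiIndex → Ω → ℝ) (a : MultiIndex → H) (U : Ω → H) : Prop :=
  MemLp U 2 P ∧
    Tendsto (fun S : Finset MultiIndex => eLpNorm (fun ω => U ω - ∑ α ∈ S, ξ α ω • a α) 2 P)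
      atTop (𝓝 0)

/-! ### Normal triples -/

section NormalTriple

variable {X H : Type*} [NormedAddCommGroup X] [InnerProductSpace ℝ X]
  [NormedAddCommGroup H] [InnerProductSpace ℝ H]

/-- `ι` is the inclusion of `X` into `H` in a normal triple `(X, H, X')`; here `X'` is the dual of
`X`, and `H` is included in `X'` by the inner product of `H` (see `toDual`). -/
structure IsNormalTriple (ι : X →L[ℝ] H) : Prop where
  injective : Function.Injective ι
  denseRange : DenseRange ι

/-- The inclusion of `H` into `X'`: `⟨y, v⟩ = (y, v)_H` for `y ∈ H` and `v ∈ X`. -/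
def toDual (ι : X →L[ℝ] H) : H →L[ℝ] StrongDual ℝ X :=
  ((ContinuousLinearMap.compL ℝ X H ℝ).flip ι) ∘L (innerSL ℝ)

theorem toDual_apply (ι : X →L[ℝ] H) (y : H) (v : X) : toDual ι y v = inner ℝ y (ι v) := rfl

/-! ### Chaos solutions -/

/-- `u = (u_α)` is a chaos solution, that is, a solution of the S-system, for
`u(t) = u₀ + ∫₀ᵗ (A u(s) + F(s)) ds + ∑_ℓ N_ℓ(χ_t B_ℓ u + χ_t G_ℓ)` with (possibly random) inputs
`u₀`, `F`, `G_ℓ`. Each `u_α` is a function on `[0,T]` with values in `X'` that is given, for almost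
all `t`, by an element `w_α` of `L₂((0,T); X)`, and for all `α` and all `t ∈ [0,T]`
`u_α(t) = u_{0,α} + ∫₀ᵗ (A u_α(s) + F_α(s)) ds
  + ∑_{k,ℓ} √α_{kℓ} ∫₀ᵗ (B_ℓ u_{α-ε_{kℓ}}(s) + G_{ℓ,α-ε_{kℓ}}(s)) (K_ℓ h_k)(s) ds` in `X'`,
where the subscript `α` of an input denotes its expectation against `ξ_α`. -/
def IsChaosSolution {Ω : Type*} [MeasurableSpace Ω] (P : Measure Ω) {T : ℝ}
    (ξ : MultiIndex → Ω → ℝ) (h : ℕ → L2T T) (K : ℕ → L2T T →L[ℝ] L2T T)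
    (ι : X →L[ℝ] H) (A : X →L[ℝ] StrongDual ℝ X) (B : ℕ → X →L[ℝ] StrongDual ℝ X)
    (u₀ : Ω → StrongDual ℝ X) (F : Ω → ℝ → StrongDual ℝ X) (G : ℕ → Ω → ℝ → StrongDual ℝ X)
    (u : MultiIndex → Set.Icc 0 T → StrongDual ℝ X) : Prop :=
  ∃ w : MultiIndex → ℝ → X,
    (∀ α, MemLp (w α) 2 (timeMeasure T)) ∧
    (∀ α, ∀ᵐ s ∂(timeMeasure T), ∀ hs : s ∈ Set.Icc 0 T, u α ⟨s, hs⟩ = toDual ι (ι (w α s))) ∧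
    ∀ (α : MultiIndex) (t : Set.Icc 0 T),
      u α t =
        (∫ ω, ξ α ω • u₀ ω ∂P)
        + (∫ s in (0 : ℝ)..t, (A (w α s) + ∫ ω, ξ α ω • F ω s ∂P))
        + α.sum fun kl n =>
            √(n : ℝ) • ∫ s in (0 : ℝ)..t,
              (K kl.2 (h kl.1) s) •
                (B kl.2 (w (α - Finsupp.single kl 1) s)
                  + ∫ ω, ξ (α - Finsupp.single kl 1) ω • G kl.2 ω s ∂P)

/-- Square integrability of a family `(u_α)` with values in `H`:
`sup_t ∑_α ‖u_α(t)‖_H² < ∞`. -/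
def IsSquareIntegrable {T : ℝ} (u : MultiIndex → Set.Icc 0 T → H) : Prop :=
  ⨆ t : Set.Icc 0 T, ∑' α, ‖u α t‖ₑ ^ 2 < ∞

/-- `I₀ = ‖u₀‖_H² + (2/δ) ∫₀ᵀ ‖F(t)‖_{X'}² dt + ∑_ℓ ‖K_ℓ‖² ∫₀ᵀ ‖G_ℓ(t)‖_H² dt`. -/
def inputSize {T : ℝ} (δ : ℝ) (K : ℕ → L2T T →L[ℝ] L2T T) (u₀ : H) (F : ℝ → StrongDual ℝ X)
    (G : ℕ → ℝ → H) : ℝ :=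
  ‖u₀‖ ^ 2 + 2 / δ * (∫ t in Set.Ioo 0 T, ‖F t‖ ^ 2)
    + ∑' ℓ, ‖K ℓ‖ ^ 2 * ∫ t in Set.Ioo 0 T, ‖G ℓ t‖ ^ 2

/-- `C_B = ∑_ℓ ‖K_ℓ‖² ‖B_ℓ‖²`. -/
def operatorSize {T : ℝ} (K : ℕ → L2T T →L[ℝ] L2T T) (B : ℕ → H →L[ℝ] H) : ℝ :=
  ∑' ℓ, ‖K ℓ‖ ^ 2 * ‖B ℓ‖ ^ 2

end NormalTriple

end

end ColoredChaos

/-! The S-system is lower triangular: the equation for u_α contains A u_α and a forcing made of the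
coefficients u_{α-ε}. It can therefore be solved degree by degree, and the whole difficulty is to
bound the sum of ‖u_α(t)‖² over all α. The operators K_ℓ need not respect the order of time, so the
bound is obtained by duality and not from an Itô formula.

Put y_α = u_α/√α! and m_{kℓ} = K_ℓ h_k. Keep finitely many directions p = (k,ℓ) and degrees, and
solve backward from time t the adjoint system φ_α' = -(A*φ_α + ∑_p m_p B*φ_{α+ε_p}) with φ_α(t) = α!
y_α(t). The pairing ∑(y_α, φ_α) changes only through F and G (`isPrimitive_pairing`). At time t it
is the truncated energy ∑‖u_α(t)‖²; at time 0 it is (u₀, φ_0(0)).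

The adjoint solution is measured by the second quantization (`chaosForm`) of the matrix S(r) = I -
∑_ℓ ‖K_ℓ‖⁻² ∫_r^t m mᵀ, where the ℓ-th term acts on the directions of the ℓ-th noise. Bessel's
inequality makes S(r) positive (`isGram_gram`). Differentiating S in degree n+1 produces a square in
degree n (`chaosFormDeriv_succ_eq`). This is exactly the square that Young's inequality spends on
the cross term with B*, at the cost of C_B times the form (`le_chaosForm_dualDrift`). Summed over
the degrees, gains and losses cancel. Gronwall's inequality then bounds ‖φ_0(0)‖², δ_A ∫‖φ_0‖_X² and
the first-order terms paired with G by e^{(C_A+C_B)t} times the energy. Inserting these bounds in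
the pairing and absorbing gives `energy_le`; without free terms the constant is 1.

These computations need bounded operators. They are done in X with the norm (ε‖v‖_X² +
‖v‖_H²)^{1/2}, where A is bounded by Riesz's theorem and no constant of the estimate depends on ε.
Weak limits along an ultrafilter, as ε → 0, give the solution together with its energy bound
(`exists_solution`).

For uniqueness, induction on the degree reduces the difference of two solutions to the homogeneous
parabolic equation (`ae_eq_zero_of_parabolic`).

The probabilistic part is the orthonormality of the ξ_α. The joint characteristic function shows
that the Wiener integrals ξ_{kℓ} are independent standard Gaussians (`iIndepFun_wienerIntegral`),
and Hermite polynomials are orthogonal for the Gaussian measure. The energy bound thus becomes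
convergence of the chaos series in mean square (`exists_isChaosSum`). -/

namespace ColoredChaos

/-! ### Primitives of locally integrable functions -/

section Primitive

variable {E F G : Type*} [NormedAddCommGroup E] [NormedSpace ℝ E]
  [NormedAddCommGroup F] [NormedSpace ℝ F] [NormedAddCommGroup G] [NormedSpace ℝ G]

/-- `y` is a primitive of the locally integrable function `y'`. -/
structure IsPrimitive (y y' : ℝ → E) : Prop where
  intervalIntegrable : ∀ a b, IntervalIntegrable y' volume a b
  sub_eq : ∀ s t, y t - y s = ∫ r in s..t, y' r

theorem isPrimitive_integral {f : ℝ → E} (hf : ∀ a b, IntervalIntegrable f volume a b)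
    (c : E) (t₀ : ℝ) : IsPrimitive (fun t => c + ∫ r in t₀..t, f r) f where
  intervalIntegrable := hf
  sub_eq s t := by
    rw [add_sub_add_left_eq_sub, intervalIntegral.integral_interval_sub_left (hf _ _) (hf _ _)]

namespace IsPrimitive

theorem continuous {y y' : ℝ → E} (h : IsPrimitive y y') : Continuous y := by
  have h1 : y = fun t => y 0 + ∫ r in (0 : ℝ)..t, y' r := by
    ext t; rw [← h.sub_eq]; abel
  rw [h1]
  exact continuous_const.add (intervalIntegral.continuous_primitive h.intervalIntegrable 0)

theorem const (c : E) : IsPrimitive (fun _ => c) (fun _ => (0 : E)) :=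
  ⟨fun _ _ => intervalIntegrable_const, fun _ _ => by simp⟩

theorem add {y y' z z' : ℝ → E} (hy : IsPrimitive y y') (hz : IsPrimitive z z') :
    IsPrimitive (fun t => y t + z t) (fun t => y' t + z' t) :=
  ⟨fun a b => (hy.intervalIntegrable a b).add (hz.intervalIntegrable a b), fun s t => by
    rw [intervalIntegral.integral_add (hy.intervalIntegrable s t) (hz.intervalIntegrable s t),
      ← hy.sub_eq, ← hz.sub_eq]; abel⟩

theorem clm_comp (L : E →L[ℝ] F) [CompleteSpace E] [CompleteSpace F] {y y' : ℝ → E}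
    (h : IsPrimitive y y') : IsPrimitive (fun t => L (y t)) (fun t => L (y' t)) where
  intervalIntegrable a b := by
    have := h.intervalIntegrable a b
    exact ⟨L.integrable_comp this.1, L.integrable_comp this.2⟩
  sub_eq s t := by
    rw [ContinuousLinearMap.intervalIntegral_comp_comm L (h.intervalIntegrable s t), ← h.sub_eq,
      map_sub]

theorem const_smul (c : ℝ) {y y' : ℝ → E} (h : IsPrimitive y y') :
    IsPrimitive (fun t => c • y t) (fun t => c • y' t) where
  intervalIntegrable a b := (h.intervalIntegrable a b).smul c
  sub_eq s t := by rw [intervalIntegral.integral_smul, ← h.sub_eq, smul_sub]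

theorem sum {κ : Type*} (s : Finset κ) {y y' : κ → ℝ → E}
    (h : ∀ i ∈ s, IsPrimitive (y i) (y' i)) :
    IsPrimitive (fun t => ∑ i ∈ s, y i t) (fun t => ∑ i ∈ s, y' i t) := by
  classical
  induction s using Finset.induction_on with
  | empty => simpa using const (0 : E)
  | insert i s hi ih =>
    simp only [Finset.sum_insert hi]
    exact (h i (Finset.mem_insert_self _ _)).add
      (ih fun k hk => h k (Finset.mem_insert_of_mem hk))

theorem mono {y y' : ℝ → ℝ} (h : IsPrimitive y y') {s t : ℝ} (hst : s ≤ t)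
    {g : ℝ → ℝ} (hg : IntervalIntegrable g volume s t) (hle : ∀ r ∈ Set.Icc s t, g r ≤ y' r) :
    y s + ∫ r in s..t, g r ≤ y t := by
  have := intervalIntegral.integral_mono_on hst hg (h.intervalIntegrable s t) hle
  rw [← h.sub_eq] at this
  linarith

theorem intervalIntegrable_bilin (β : E →L[ℝ] F →L[ℝ] G) {f : ℝ → E} {z : ℝ → F} {a b : ℝ}
    (hf : IntervalIntegrable f volume a b) (hz : Continuous z) :
    IntervalIntegrable (fun t => β (f t) (z t)) volume a b := by
  have h1 : IntervalIntegrable (fun t => ‖β‖ * (‖f t‖ * ‖z t‖)) volume a b :=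
    (hf.norm.mul_continuousOn hz.norm.continuousOn).const_mul _
  refine h1.mono_fun ?_ ?_
  · exact β.aestronglyMeasurable_comp₂ hf.def'.aestronglyMeasurable hz.aestronglyMeasurable
  · refine Eventually.of_forall fun t => ?_
    change ‖β (f t) (z t)‖ ≤ ‖‖β‖ * (‖f t‖ * ‖z t‖)‖
    rw [Real.norm_of_nonneg (by positivity), ← mul_assoc]
    exact β.le_opNorm₂ _ _

/-- Fubini on the square: the integrals of β(f(r), g(q)) over the triangle q ≤ r and over its
complement add up to the product of the integrals. This is integration by parts for functions that
are merely integrable. -/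
theorem integral_bilin_swap [CompleteSpace E] [CompleteSpace F] [CompleteSpace G]
    (β : E →L[ℝ] F →L[ℝ] G)
    {f : ℝ → E} {g : ℝ → F} {s t : ℝ} (hst : s ≤ t)
    (hf : IntervalIntegrable f volume s t) (hg : IntervalIntegrable g volume s t) :
    (∫ r in s..t, β (f r) (∫ q in s..r, g q)) + (∫ q in s..t, β (∫ r in s..q, f r) (g q))
      = β (∫ r in s..t, f r) (∫ q in s..t, g q) := by
  set μ : Measure ℝ := volume.restrict (Set.Ioc s t) with hμ
  have hf' : Integrable f μ := (intervalIntegrable_iff_integrableOn_Ioc_of_le hst).1 hf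
  have hg' : Integrable g μ := (intervalIntegrable_iff_integrableOn_Ioc_of_le hst).1 hg
  have hprod : Integrable (fun p : ℝ × ℝ => β (f p.1) (g p.2)) (μ.prod μ) := by
    have h0 := (hf'.norm.mul_prod hg'.norm).const_mul ‖β‖
    refine h0.mono' ?_ ?_
    · exact β.aestronglyMeasurable_comp₂ hf'.aestronglyMeasurable.comp_fst
        hg'.aestronglyMeasurable.comp_snd
    · refine Eventually.of_forall fun p => ?_
      rw [← mul_assoc]
      exact β.le_opNorm₂ _ _
  let S : Set (ℝ × ℝ) := {p | p.2 ≤ p.1}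
  have hS : MeasurableSet S := measurableSet_le measurable_snd measurable_fst
  have h1 : ∫ p in S, β (f p.1) (g p.2) ∂(μ.prod μ)
      = ∫ r in s..t, β (f r) (∫ q in s..r, g q) := by
    rw [← integral_indicator hS, integral_prod _ (hprod.indicator hS),
      intervalIntegral.integral_of_le hst]
    refine setIntegral_congr_fun measurableSet_Ioc fun r hr => ?_
    have : (fun q => S.indicator (fun p : ℝ × ℝ => β (f p.1) (g p.2)) (r, q))
        = (Set.Iic r).indicator fun q => β (f r) (g q) := by
      ext q; simp [S, Set.indicator_apply]
    simp only [this]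
    rw [integral_indicator measurableSet_Iic, hμ, Measure.restrict_restrict measurableSet_Iic,
      Set.inter_comm, Set.Ioc_inter_Iic, min_eq_right hr.2,
      ContinuousLinearMap.integral_comp_comm, intervalIntegral.integral_of_le hr.1.le]
    exact hg'.mono_measure (by
      rw [hμ]; exact Measure.restrict_mono (Set.Ioc_subset_Ioc_right hr.2) le_rfl)
  have h2 : ∫ p in Sᶜ, β (f p.1) (g p.2) ∂(μ.prod μ)
      = ∫ q in s..t, β (∫ r in s..q, f r) (g q) := by
    rw [← integral_indicator hS.compl, integral_prod_symm _ (hprod.indicator hS.compl),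
      intervalIntegral.integral_of_le hst]
    refine setIntegral_congr_fun measurableSet_Ioc fun q hq => ?_
    have : (fun r => Sᶜ.indicator (fun p : ℝ × ℝ => β (f p.1) (g p.2)) (r, q))
        = (Set.Iio q).indicator fun r => β.flip (g q) (f r) := by
      ext r; simp [S, Set.indicator_apply]
    simp only [this]
    rw [integral_indicator measurableSet_Iio, hμ, Measure.restrict_restrict measurableSet_Iio,
      Set.inter_comm]
    have h3 : (Set.Ioc s t ∩ Set.Iio q : Set ℝ) = Set.Ioo s q := by
      ext x; simp only [Set.mem_inter_iff, Set.mem_Ioc, Set.mem_Iio, Set.mem_Ioo]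
      exact ⟨fun h => ⟨h.1.1, h.2⟩, fun h => ⟨⟨h.1, h.2.le.trans hq.2⟩, h.2⟩⟩
    rw [h3, ← integral_Ioc_eq_integral_Ioo,
      ContinuousLinearMap.integral_comp_comm, intervalIntegral.integral_of_le hq.1.le]
    · rfl
    exact hf'.mono_measure (by
      rw [hμ]; exact Measure.restrict_mono (Set.Ioc_subset_Ioc_right hq.2) le_rfl)
  rw [← h1, ← h2, integral_add_compl hS hprod, integral_prod _ hprod,
    intervalIntegral.integral_of_le hst, intervalIntegral.integral_of_le hst]
  simp only [ContinuousLinearMap.integral_comp_comm _ hg']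
  exact ContinuousLinearMap.integral_comp_comm (β.flip (∫ q, g q ∂μ)) hf'

/-- The product rule for a continuous bilinear map. -/
theorem bilin [CompleteSpace E] [CompleteSpace F] [CompleteSpace G] (β : E →L[ℝ] F →L[ℝ] G)
    {y y' : ℝ → E} {z z' : ℝ → F} (hy : IsPrimitive y y') (hz : IsPrimitive z z') :
    IsPrimitive (fun t => β (y t) (z t)) (fun t => β (y' t) (z t) + β (y t) (z' t)) := by
  have i1 : ∀ a b, IntervalIntegrable (fun t => β (y' t) (z t)) volume a b := fun a b =>
    intervalIntegrable_bilin β (hy.intervalIntegrable a b) hz.continuous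
  have i2 : ∀ a b, IntervalIntegrable (fun t => β (y t) (z' t)) volume a b := fun a b =>
    intervalIntegrable_bilin β.flip (hz.intervalIntegrable a b) hy.continuous
  have key : ∀ s t, s ≤ t → β (y t) (z t) - β (y s) (z s)
      = ∫ r in s..t, (β (y' r) (z r) + β (y r) (z' r)) := by
    intro s t hst
    have e1 : ∀ r, z r = z s + ∫ q in s..r, z' q := fun r => by rw [← hz.sub_eq]; abel
    have e2 : ∀ r, y r = y s + ∫ q in s..r, y' q := fun r => by rw [← hy.sub_eq]; abel
    have hsw := integral_bilin_swap β hst (hy.intervalIntegrable s t) (hz.intervalIntegrable s t)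
    have j1 : ∫ r in s..t, β (y' r) (z r)
        = β (y t - y s) (z s) + ∫ r in s..t, β (y' r) (∫ q in s..r, z' q) := by
      rw [hy.sub_eq, ← β.flip_apply, ← ContinuousLinearMap.intervalIntegral_comp_comm _
        (hy.intervalIntegrable s t), ← intervalIntegral.integral_add]
      · refine intervalIntegral.integral_congr fun r _ => ?_
        simp only [β.flip_apply]
        rw [← map_add, ← e1]
      · exact intervalIntegrable_bilin β (hy.intervalIntegrable s t) continuous_const
      · exact intervalIntegrable_bilin β (hy.intervalIntegrable s t)
          (intervalIntegral.continuous_primitive hz.intervalIntegrable s)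
    have j2 : ∫ r in s..t, β (y r) (z' r)
        = β (y s) (z t - z s) + ∫ r in s..t, β (∫ q in s..r, y' q) (z' r) := by
      rw [hz.sub_eq, ← ContinuousLinearMap.intervalIntegral_comp_comm _
        (hz.intervalIntegrable s t), ← intervalIntegral.integral_add]
      · refine intervalIntegral.integral_congr fun r _ => ?_
        rw [← add_apply, ← map_add, ← e2]
      · exact intervalIntegrable_bilin β.flip (hz.intervalIntegrable s t) continuous_const
      · exact intervalIntegrable_bilin β.flip (hz.intervalIntegrable s t)
          (intervalIntegral.continuous_primitive hy.intervalIntegrable s)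
    rw [intervalIntegral.integral_add (i1 s t) (i2 s t), j1, j2]
    -- The first two terms come from freezing one factor at time s; the product of the two
    -- increments is what the Fubini identity `hsw` accounts for.
    have : β (y t) (z t) - β (y s) (z s) = β (y t - y s) (z s) + β (y s) (z t - z s)
        + β (y t - y s) (z t - z s) := by
      simp only [map_sub, sub_apply]; abel
    rw [this, hy.sub_eq s t, hz.sub_eq s t, ← hsw]
    abel
  refine ⟨fun a b => (i1 a b).add (i2 a b), fun s t => ?_⟩
  rcases le_total s t with h | h
  · exact key s t h
  · rw [intervalIntegral.integral_symm, ← key t s h]; abel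

theorem mul {c c' y y' : ℝ → ℝ} (hc : IsPrimitive c c') (hy : IsPrimitive y y') :
    IsPrimitive (fun t => c t * y t) (fun t => c' t * y t + c t * y' t) :=
  bilin (ContinuousLinearMap.mul ℝ ℝ) hc hy

theorem of_hasDerivAt [CompleteSpace E] {y y' : ℝ → E} (h : ∀ t, HasDerivAt y (y' t) t)
    (hc : Continuous y') : IsPrimitive y y' :=
  ⟨fun a b => hc.intervalIntegrable a b, fun s t =>
    (intervalIntegral.integral_eq_sub_of_hasDerivAt (fun r _ => h r)
      (hc.intervalIntegrable s t)).symm⟩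

theorem congr {y y' z' : ℝ → E} (h : IsPrimitive y y') (he : ∀ t, y' t = z' t) :
    IsPrimitive y z' := (funext he : y' = z') ▸ h

end IsPrimitive

theorem isPrimitive_exp_mul (c : ℝ) :
    IsPrimitive (fun t => Real.exp (c * t)) (fun t => c * Real.exp (c * t)) := by
  refine IsPrimitive.of_hasDerivAt (fun t => ?_) (by fun_prop)
  have := ((hasDerivAt_id t).const_mul c).exp
  simpa [mul_comm] using this

/-- The linear equation `y' = a y + f` with a bounded operator `a` has a solution with a prescribed
value at a given point. -/
theorem exists_isPrimitive_linear [CompleteSpace E] (a : E →L[ℝ] E) {f : ℝ → E}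
    (hf : ∀ p q, IntervalIntegrable f volume p q) (t₀ : ℝ) (x : E) :
    ∃ y : ℝ → E, y t₀ = x ∧ IsPrimitive y (fun t => a (y t) + f t) := by
  -- With y = v + z the equation becomes v' = a v + a z. Its forcing is continuous, so variation of
  -- constants gives a differentiable v although f is only locally integrable.
  let z : ℝ → E := fun t => 0 + ∫ r in t₀..t, f r
  have hz : IsPrimitive z f := isPrimitive_integral hf 0 t₀
  have hz0 : z t₀ = 0 := by simp [z]
  let e : ℝ → (E →L[ℝ] E) := fun t => NormedSpace.exp (t • a)
  have he : ∀ t, HasDerivAt e (a * e t) t := fun t => hasDerivAt_exp_smul_const' a t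
  have hec : Continuous e := continuous_iff_continuousAt.2 fun t => (he t).continuousAt
  have hee : ∀ t, e t * e (-t) = 1 := fun t => by
    have hcomm : Commute (t • a) ((-t) • a) := ((Commute.refl a).smul_left t).smul_right (-t)
    let _ : NormedAlgebra ℚ (E →L[ℝ] E) := NormedAlgebra.restrictScalars ℚ ℝ (E →L[ℝ] E)
    have := NormedSpace.exp_add_of_commute hcomm
    rw [← add_smul, add_neg_cancel, zero_smul, NormedSpace.exp_zero] at this
    exact this.symm
  let g : ℝ → E := fun s => e (-s) (a (z s))
  have hgc : Continuous g := by
    have := hz.continuous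
    exact (hec.comp continuous_neg).clm_apply (by fun_prop)
  let k : ℝ → E := fun t => e (-t₀) x + ∫ s in t₀..t, g s
  have hk : ∀ t, HasDerivAt k (g t) t := fun t =>
    (intervalIntegral.integral_hasDerivAt_right (hgc.intervalIntegrable _ _)
      (hgc.stronglyMeasurableAtFilter _ _) hgc.continuousAt).const_add _
  let v : ℝ → E := fun t => e t (k t)
  have hv : ∀ t, HasDerivAt v (a (v t) + a (z t)) t := fun t => by
    have h1 := (he t).clm_apply (hk t)
    have h2 : e t (g t) = a (z t) := by
      change (e t * e (-t)) (a (z t)) = _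
      rw [hee]; rfl
    rw [h2] at h1
    exact h1
  have hvc : Continuous v := continuous_iff_continuousAt.2 fun t => (hv t).continuousAt
  have hvp := IsPrimitive.of_hasDerivAt hv (by have := hz.continuous; fun_prop)
  refine ⟨fun t => v t + z t, ?_, (hvp.add hz).congr fun t => by
    change a (v t) + a (z t) + f t = a (v t + z t) + f t
    rw [map_add a (v t) (z t)]⟩
  simp only [hz0, add_zero, v, k, intervalIntegral.integral_same]
  change (e t₀ * e (-t₀)) x = x
  rw [hee]; rfl

end Primitive

end ColoredChaos

namespace ColoredChaos

/-! ### Sums over multi-indices -/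

section MultiIndexSums

variable {κ : Type*}

/-- The factorial `α! = ∏ α_p!` of a multi-index. -/
noncomputable def multiFactorial (α : κ →₀ ℕ) : ℝ := α.prod fun _ n => (n.factorial : ℝ)

theorem multiFactorial_pos (α : κ →₀ ℕ) : 0 < multiFactorial α :=
  Finset.prod_pos fun _ _ => by positivity

@[simp] theorem multiFactorial_zero : multiFactorial (0 : κ →₀ ℕ) = 1 := Finsupp.prod_zero_index

theorem multiFactorial_add_single (α : κ →₀ ℕ) (p : κ) :
    multiFactorial (α + Finsupp.single p 1) = (α p + 1) * multiFactorial α := by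
  have h : ∀ γ : κ →₀ ℕ, multiFactorial γ
      = ((γ p).factorial : ℝ) * (γ.erase p).prod fun _ n => (n.factorial : ℝ) := fun γ =>
    (Finsupp.mul_prod_erase' γ p _ fun _ => by simp).symm
  rw [h (α + _), h α]
  simp only [Finsupp.coe_add, Pi.add_apply, Finsupp.single_eq_same, Finsupp.erase_add,
    Finsupp.erase_single, add_zero, Nat.factorial_succ]
  push_cast; ring

theorem sub_single_add_single {α : κ →₀ ℕ} {p : κ} (hp : p ∈ α.support) :
    α - Finsupp.single p 1 + Finsupp.single p 1 = α :=
  tsub_add_cancel_of_le (by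
    rw [Finsupp.single_le_iff]
    exact Nat.one_le_iff_ne_zero.2 (Finsupp.mem_support_iff.1 hp))

theorem multiFactorial_sub_single {α : κ →₀ ℕ} {p : κ} (hp : p ∈ α.support) :
    multiFactorial α = α p * multiFactorial (α - Finsupp.single p 1) := by
  have h := multiFactorial_add_single (α - Finsupp.single p 1) p
  rw [sub_single_add_single hp] at h
  rw [h]
  have h2 := DFunLike.congr_fun (sub_single_add_single hp) p
  rw [Finsupp.add_apply, Finsupp.single_eq_same] at h2
  rw [← h2]; push_cast; rfl

theorem add_single_mem_finsuppAntidiag [DecidableEq κ] {s : Finset κ} {n : ℕ} {β : κ →₀ ℕ} {p : κ} (hp : p ∈ s) :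
    β + Finsupp.single p 1 ∈ s.finsuppAntidiag (n + 1) ↔ β ∈ s.finsuppAntidiag n := by
  simp only [Finset.mem_finsuppAntidiag]
  have h1 : s.sum (β + Finsupp.single p 1 : κ →₀ ℕ) = s.sum β + 1 := by
    simp only [Finsupp.coe_add, Pi.add_apply, Finset.sum_add_distrib]
    rw [← Finset.sum_subset (f := fun x => Finsupp.single p 1 x) (Finset.singleton_subset_iff.2 hp)]
    · simp
    · intro x _ hx
      exact Finsupp.single_eq_of_ne (by simpa using hx)
  rw [h1, add_left_inj]
  refine and_congr_right fun _ => ⟨fun h x hx => h ?_, fun h => ?_⟩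
  · simp only [Finsupp.mem_support_iff, Finsupp.coe_add, Pi.add_apply] at hx ⊢
    omega
  · exact Finsupp.support_add.trans (Finset.union_subset h
      (Finsupp.support_single_subset.trans (Finset.singleton_subset_iff.2 hp)))

/-- The bijection (α, p) ↔ (α - ε_p, p) between degrees n+1 and n. It expresses the duality between
lowering and raising an index, on which both the pairing with the adjoint system and `chaosForm_one`
rest. -/
theorem sum_finsuppAntidiag_succ [DecidableEq κ] {M : Type*} [AddCommMonoid M] (s : Finset κ) (n : ℕ)
    (f : κ → (κ →₀ ℕ) → (κ →₀ ℕ) → M) :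
    ∑ α ∈ s.finsuppAntidiag (n + 1), ∑ p ∈ α.support, f p (α - Finsupp.single p 1) α
      = ∑ β ∈ s.finsuppAntidiag n, ∑ p ∈ s, f p β (β + Finsupp.single p 1) := by
  rw [Finset.sum_sigma', Finset.sum_sigma']
  refine Finset.sum_bij' (fun x _ => ⟨x.1 - Finsupp.single x.2 1, x.2⟩)
    (fun x _ => ⟨x.1 + Finsupp.single x.2 1, x.2⟩) ?_ ?_ ?_ ?_ ?_
  · rintro ⟨α, p⟩ h
    simp only [Finset.mem_sigma] at h ⊢
    have hp : p ∈ s := (Finset.mem_finsuppAntidiag.1 h.1).2 h.2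
    exact ⟨(add_single_mem_finsuppAntidiag hp).1 (by rw [sub_single_add_single h.2]; exact h.1),
      hp⟩
  · rintro ⟨β, p⟩ h
    simp only [Finset.mem_sigma] at h ⊢
    exact ⟨(add_single_mem_finsuppAntidiag h.2).2 h.1, by simp⟩
  · rintro ⟨α, p⟩ h
    simp only [Finset.mem_sigma] at h
    simp only [sub_single_add_single h.2]
  · rintro ⟨β, p⟩ h
    simp
  · rintro ⟨α, p⟩ h
    simp only [Finset.mem_sigma] at h
    simp only [sub_single_add_single h.2]

end MultiIndexSums

/-! ### Quadratic forms on the symmetric Fock space -/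

section ChaosForm

variable {κ : Type*} {Y Z : Type*} [NormedAddCommGroup Y] [InnerProductSpace ℝ Y]
  [NormedAddCommGroup Z] [InnerProductSpace ℝ Z]

/-- The derivative `∂_p` in the direction of the basis element `p`, acting on the (unnormalized)
coefficients of a chaos expansion. -/
noncomputable def shift (p : κ) : ((κ →₀ ℕ) → Y) →ₗ[ℝ] ((κ →₀ ℕ) → Y) :=
  LinearMap.funLeft ℝ Y fun α => α + Finsupp.single p 1

@[simp] theorem shift_apply (p : κ) (φ : (κ →₀ ℕ) → Y) (α : κ →₀ ℕ) :
    shift p φ α = φ (α + Finsupp.single p 1) := rfl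

theorem shift_comm (p q : κ) (φ : (κ →₀ ℕ) → Y) : shift p (shift q φ) = shift q (shift p φ) := by
  ext α
  simp only [shift_apply]
  rw [add_right_comm]

/-- The restriction to the `n`-th chaos of the second quantization of the bilinear form `S`,
tensored with the bilinear form `β`. -/
noncomputable def chaosForm (β : Y →L[ℝ] Y →L[ℝ] ℝ) (s : Finset κ) (S : κ → κ → ℝ) :
    ℕ → ((κ →₀ ℕ) → Y) →ₗ[ℝ] ((κ →₀ ℕ) → Y) →ₗ[ℝ] ℝ
  | 0 => β.toLinearMap₁₂.compl₁₂ (LinearMap.proj (R := ℝ) (φ := fun _ : κ →₀ ℕ => Y) 0)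
      (LinearMap.proj (R := ℝ) (φ := fun _ : κ →₀ ℕ => Y) 0)
  -- Unfolded, this is (1/n!) ∑ S(p₁,q₁)⋯S(pₙ,qₙ) β(φ(ε_{p₁}+⋯+ε_{pₙ}), ψ(ε_{q₁}+⋯+ε_{qₙ})). The
  -- recursion replaces tensor powers and makes every property an induction on the degree.
  | n + 1 => ((n : ℝ) + 1)⁻¹ • ∑ p ∈ s, ∑ q ∈ s,
      S p q • (chaosForm β s S n).compl₁₂ (shift p) (shift q)

variable {β : Y →L[ℝ] Y →L[ℝ] ℝ} {s : Finset κ} {S : κ → κ → ℝ}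

theorem chaosForm_zero (φ ψ : (κ →₀ ℕ) → Y) : chaosForm β s S 0 φ ψ = β (φ 0) (ψ 0) := rfl

theorem chaosForm_succ (n : ℕ) (φ ψ : (κ →₀ ℕ) → Y) :
    chaosForm β s S (n + 1) φ ψ = ((n : ℝ) + 1)⁻¹ * ∑ p ∈ s, ∑ q ∈ s,
      S p q * chaosForm β s S n (shift p φ) (shift q ψ) := by
  simp [chaosForm, LinearMap.sum_apply]

theorem chaosForm_comp (T R : Y →L[ℝ] Y) (n : ℕ) (φ ψ : (κ →₀ ℕ) → Y) :
    chaosForm β s S n (fun α => T (φ α)) (fun α => R (ψ α))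
      = chaosForm (β.bilinearComp T R) s S n φ ψ := by
  induction n generalizing φ ψ with
  | zero => rfl
  | succ n ih =>
    rw [chaosForm_succ, chaosForm_succ]
    simp only [← ih]
    rfl

theorem chaosForm_add (β γ : Y →L[ℝ] Y →L[ℝ] ℝ) (n : ℕ) (φ ψ : (κ →₀ ℕ) → Y) :
    chaosForm (β + γ) s S n φ ψ = chaosForm β s S n φ ψ + chaosForm γ s S n φ ψ := by
  induction n generalizing φ ψ with
  | zero => rfl
  | succ n ih =>
    simp only [chaosForm_succ, ih, mul_add, Finset.sum_add_distrib]

theorem chaosForm_smul (c : ℝ) (β : Y →L[ℝ] Y →L[ℝ] ℝ) (n : ℕ) (φ ψ : (κ →₀ ℕ) → Y) :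
    chaosForm (c • β) s S n φ ψ = c * chaosForm β s S n φ ψ := by
  induction n generalizing φ ψ with
  | zero => rfl
  | succ n ih =>
    simp only [chaosForm_succ, ih]
    rw [mul_left_comm c, Finset.mul_sum s _ c]
    congr 1
    refine Finset.sum_congr rfl fun p _ => ?_
    rw [Finset.mul_sum s _ c]
    refine Finset.sum_congr rfl fun q _ => ?_
    ring

theorem chaosForm_comm (hβ : ∀ y z, β y z = β z y) (hS : ∀ p q, S p q = S q p) (n : ℕ)
    (φ ψ : (κ →₀ ℕ) → Y) : chaosForm β s S n φ ψ = chaosForm β s S n ψ φ := by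
  induction n generalizing φ ψ with
  | zero => exact hβ _ _
  | succ n ih =>
    rw [chaosForm_succ, chaosForm_succ, Finset.sum_comm]
    congr 1
    refine Finset.sum_congr rfl fun p _ => Finset.sum_congr rfl fun q _ => ?_
    rw [ih, hS]

/-- `S` is positive semidefinite on `s`, being a Gram matrix. -/
def IsGram (s : Finset κ) (S : κ → κ → ℝ) : Prop :=
  ∃ (d : Finset κ) (l : κ → κ → ℝ), ∀ p ∈ s, ∀ q ∈ s, S p q = ∑ r ∈ d, l r p * l r q

open scoped MatrixOrder Matrix.Norms.L2Operator in
theorem isGram_of_nonneg [DecidableEq κ] (hsymm : ∀ p q, S p q = S q p)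
    (h : ∀ c : κ → ℝ, 0 ≤ ∑ p ∈ s, ∑ q ∈ s, c p * c q * S p q) : IsGram s S := by
  let M : Matrix s s ℝ := fun p q => S p q
  have hM : M.PosSemidef := by
    refine Matrix.PosSemidef.of_dotProduct_mulVec_nonneg ?_ fun x => ?_
    · ext p q; exact hsymm _ _
    · let c : κ → ℝ := fun p => if hp : p ∈ s then x ⟨p, hp⟩ else 0
      have hc : ∀ p : s, c p = x p := fun p => by simp [c]
      have := h c
      have h2 : ∑ p ∈ s, ∑ q ∈ s, c p * c q * S p q
          = ∑ p : s, ∑ q : s, x p * x q * S p q := by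
        rw [← Finset.sum_coe_sort]
        refine Finset.sum_congr rfl fun p _ => ?_
        rw [← Finset.sum_coe_sort]
        refine Finset.sum_congr rfl fun q _ => ?_
        rw [hc, hc]
      rw [h2] at this
      simp only [dotProduct, Matrix.mulVec, star_trivial, Finset.mul_sum]
      refine this.trans_eq (Finset.sum_congr rfl fun p _ => Finset.sum_congr rfl fun q _ => ?_)
      change _ = x p * (S p q * x q)
      ring
  obtain ⟨B, hB⟩ := CStarAlgebra.nonneg_iff_eq_star_mul_self.mp hM.nonneg
  rw [Matrix.star_eq_conjTranspose] at hB
  refine ⟨s, fun r p => if hr : r ∈ s then if hp : p ∈ s then B ⟨r, hr⟩ ⟨p, hp⟩ else 0 else 0,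
    fun p hp q hq => ?_⟩
  have := congrFun (congrFun hB ⟨p, hp⟩) ⟨q, hq⟩
  rw [Matrix.mul_apply] at this
  rw [← Finset.sum_coe_sort]
  simpa [M, hp, hq] using this

/-- A factorization S = lᵀl turns the double sum into a sum over r of diagonal values, one degree
lower, at the vectors ∑_p l_{rp} ∂_pφ. Since β need not be symmetric, any quadratic inequality on Y
passes to every chaos by applying this to the difference of its two sides. -/
theorem chaosForm_nonneg (hS : IsGram s S) (hβ : ∀ y, 0 ≤ β y y) (n : ℕ) (φ : (κ →₀ ℕ) → Y) :
    0 ≤ chaosForm β s S n φ φ := by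
  obtain ⟨d, l, hl⟩ := hS
  induction n generalizing φ with
  | zero => exact hβ _
  | succ n ih =>
    rw [chaosForm_succ]
    refine mul_nonneg (by positivity) ?_
    have : ∑ p ∈ s, ∑ q ∈ s, S p q * chaosForm β s S n (shift p φ) (shift q φ)
        = ∑ r ∈ d, chaosForm β s S n (∑ p ∈ s, l r p • shift p φ) (∑ q ∈ s, l r q • shift q φ) := by
      simp only [map_sum, map_smul, LinearMap.sum_apply, LinearMap.smul_apply, smul_eq_mul]
      symm
      rw [Finset.sum_comm, Finset.sum_comm (s := s) (t := s)]
      refine Finset.sum_congr rfl fun q hq => ?_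
      simp only [Finset.mul_sum]
      rw [Finset.sum_comm]
      refine Finset.sum_congr rfl fun p hp => ?_
      rw [hl p hp q hq, Finset.sum_mul]
      exact Finset.sum_congr rfl fun r _ => by ring
    rw [this]
    exact Finset.sum_nonneg fun r _ => ih _

theorem chaosForm_eq_zero [DecidableEq κ] (n : ℕ) {φ : (κ →₀ ℕ) → Y}
    (hφ : ∀ α ∈ s.finsuppAntidiag n, φ α = 0) (ψ : (κ →₀ ℕ) → Y) :
    chaosForm β s S n φ ψ = 0 := by
  induction n generalizing φ ψ with
  | zero => rw [chaosForm_zero, hφ 0 (by simp)]; simp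
  | succ n ih =>
    rw [chaosForm_succ, Finset.sum_eq_zero, mul_zero]
    refine fun p hp => Finset.sum_eq_zero fun q _ => ?_
    rw [ih (φ := shift p φ) fun α hα => hφ _ ((add_single_mem_finsuppAntidiag hp).2 hα), mul_zero]

/-- The weights 1/α! satisfy the recursion because 1/(α-ε_p)! = α_p/α! and the α_p add up to n+1.
This evaluates the form at the terminal time, where the weight matrix is the identity. -/
theorem chaosForm_one [DecidableEq κ] (hS : ∀ p ∈ s, ∀ q ∈ s, S p q = if p = q then 1 else 0)
    (n : ℕ) (φ ψ : (κ →₀ ℕ) → Y) :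
    chaosForm β s S n φ ψ = ∑ α ∈ s.finsuppAntidiag n, (multiFactorial α)⁻¹ * β (φ α) (ψ α) := by
  induction n generalizing φ ψ with
  | zero => simp [chaosForm_zero]
  | succ n ih =>
    rw [chaosForm_succ]
    have h1 : ∑ p ∈ s, ∑ q ∈ s, S p q * chaosForm β s S n (shift p φ) (shift q ψ)
        = ∑ γ ∈ s.finsuppAntidiag n, ∑ p ∈ s, (multiFactorial γ)⁻¹ *
          β (φ (γ + Finsupp.single p 1)) (ψ (γ + Finsupp.single p 1)) := by
      rw [Finset.sum_comm (s := s.finsuppAntidiag n)]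
      refine Finset.sum_congr rfl fun p hp => ?_
      rw [Finset.sum_eq_single_of_mem p hp fun q hq hpq => by
        rw [hS p hp q hq, if_neg hpq.symm, zero_mul], hS p hp p hp, if_pos rfl, one_mul, ih]
      rfl
    rw [h1, ← sum_finsuppAntidiag_succ s n
      (fun _ γ α => (multiFactorial γ)⁻¹ * β (φ α) (ψ α)), Finset.mul_sum]
    refine Finset.sum_congr rfl fun α hα => ?_
    rw [← Finset.sum_mul, ← mul_assoc]
    congr 1
    have h2 : ∑ p ∈ α.support, (multiFactorial (α - Finsupp.single p 1))⁻¹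
        = ∑ p ∈ α.support, (α p : ℝ) * (multiFactorial α)⁻¹ := by
      refine Finset.sum_congr rfl fun p hp => ?_
      have hpos := multiFactorial_pos (α - Finsupp.single p 1)
      have h0 : (α p : ℝ) ≠ 0 := Nat.cast_ne_zero.2 (Finsupp.mem_support_iff.1 hp)
      rw [multiFactorial_sub_single hp, mul_inv, ← mul_assoc, mul_inv_cancel₀ h0, one_mul]
    have h3 : ∑ p ∈ α.support, (α p : ℝ) = n + 1 := by
      have h4 := (Finset.mem_finsuppAntidiag.1 hα)
      rw [← Finset.sum_subset h4.2 (fun x _ hx => Finsupp.notMem_support_iff.1 hx)] at h4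
      have := congrArg (Nat.cast : ℕ → ℝ) h4.1
      push_cast at this
      exact this
    rw [h2, ← Finset.sum_mul, h3, ← mul_assoc, inv_mul_cancel₀ (by positivity), one_mul]

/-- The contribution of the derivative `S'` of `S` to the derivative of `chaosForm β s S n`. -/
noncomputable def chaosFormDeriv (β : Y →L[ℝ] Y →L[ℝ] ℝ) (s : Finset κ) (S S' : κ → κ → ℝ) :
    ℕ → ((κ →₀ ℕ) → Y) → ((κ →₀ ℕ) → Y) → ℝ
  | 0, _, _ => 0
  -- The prefactor 1/(n+1) is used up by the n+1 equal terms that arise from differentiating the n+1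
  -- factors S.
  | n + 1, φ, ψ => ∑ p ∈ s, ∑ q ∈ s, S' p q * chaosForm β s S n (shift p φ) (shift q ψ)

/-- It does not matter which of the factors S is differentiated, because the derivatives ∂_p
commute. On the left the factor S' sits inside, on the right outside. -/
theorem sum_mul_chaosFormDeriv (S' : κ → κ → ℝ) (n : ℕ) (φ ψ : (κ →₀ ℕ) → Y) :
    ∑ p ∈ s, ∑ q ∈ s, S p q * chaosFormDeriv β s S S' n (shift p φ) (shift q ψ)
      = n * ∑ p ∈ s, ∑ q ∈ s, S' p q * chaosForm β s S n (shift p φ) (shift q ψ) := by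
  cases n with
  | zero => simp [chaosFormDeriv]
  | succ n =>
    have hn : ((n : ℝ) + 1) ≠ 0 := by positivity
    have h1 : ∑ p ∈ s, ∑ q ∈ s, S p q * chaosFormDeriv β s S S' (n + 1) (shift p φ) (shift q ψ)
        = ∑ u ∈ s ×ˢ s, ∑ v ∈ s ×ˢ s, S u.1 u.2 * (S' v.1 v.2 *
          chaosForm β s S n (shift v.1 (shift u.1 φ)) (shift v.2 (shift u.2 ψ))) := by
      simp only [chaosFormDeriv, Finset.mul_sum, Finset.sum_product]
    have h2 : (n + 1 : ℕ) * ∑ p ∈ s, ∑ q ∈ s,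
          S' p q * chaosForm β s S (n + 1) (shift p φ) (shift q ψ)
        = ∑ v ∈ s ×ˢ s, ∑ u ∈ s ×ˢ s, S u.1 u.2 * (S' v.1 v.2 *
          chaosForm β s S n (shift u.1 (shift v.1 φ)) (shift u.2 (shift v.2 ψ))) := by
      simp only [chaosForm_succ, Finset.mul_sum, Finset.sum_product]
      refine Finset.sum_congr rfl fun p _ => Finset.sum_congr rfl fun q _ =>
        Finset.sum_congr rfl fun r _ => Finset.sum_congr rfl fun x _ => ?_
      push_cast
      field_simp
    rw [h1, h2, Finset.sum_comm]
    refine Finset.sum_congr rfl fun v _ => Finset.sum_congr rfl fun u _ => ?_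
    rw [shift_comm v.1 u.1, shift_comm v.2 u.2]

/-- Leibniz rule by induction on n. The outer factor contributes one copy of the sum with S' and the
inner factors n copies; the prefactor 1/(n+1) reduces these to a single one. -/
theorem isPrimitive_chaosForm [CompleteSpace Y] {S S' : ℝ → κ → κ → ℝ}
    (hS : ∀ p ∈ s, ∀ q ∈ s, IsPrimitive (fun t => S t p q) (fun t => S' t p q))
    {φ φ' ψ ψ' : ℝ → (κ →₀ ℕ) → Y} (hφ : ∀ α, IsPrimitive (fun t => φ t α) (fun t => φ' t α))
    (hψ : ∀ α, IsPrimitive (fun t => ψ t α) (fun t => ψ' t α)) (n : ℕ) :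
    IsPrimitive (fun t => chaosForm β s (S t) n (φ t) (ψ t))
      (fun t => chaosFormDeriv β s (S t) (S' t) n (φ t) (ψ t)
        + (chaosForm β s (S t) n (φ' t) (ψ t) + chaosForm β s (S t) n (φ t) (ψ' t))) := by
  induction n generalizing φ φ' ψ ψ' with
  | zero =>
    simp only [chaosForm_zero, chaosFormDeriv, zero_add]
    exact (hφ 0).bilin β (hψ 0)
  | succ n ih =>
    have h := IsPrimitive.const_smul ((n : ℝ) + 1)⁻¹ (IsPrimitive.sum s fun p hp =>
      IsPrimitive.sum s fun q hq => (hS p hp q hq).mul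
        (ih (φ := fun t => shift p (φ t)) (φ' := fun t => shift p (φ' t))
          (ψ := fun t => shift q (ψ t)) (ψ' := fun t => shift q (ψ' t))
          (fun α => hφ _) (fun α => hψ _)))
    simp only [chaosForm_succ]
    refine h.congr fun t => ?_
    have hn : ((n : ℝ) + 1) ≠ 0 := by positivity
    simp only [smul_eq_mul, mul_add, Finset.sum_add_distrib]
    rw [sum_mul_chaosFormDeriv, chaosFormDeriv]
    field_simp
    ring

end ChaosForm

end ColoredChaos

namespace ColoredChaos

/-! ### Evolution equations with bounded operators -/

theorem _root_.MeasureTheory.MemLp.intervalIntegrable_two {E : Type*} [NormedAddCommGroup E]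
    {f : ℝ → E} (hf : MemLp f 2 volume) (p q : ℝ) : IntervalIntegrable f volume p q :=
  ((hf.locallyIntegrable one_le_two).integrableOn_isCompact
    isCompact_uIcc).intervalIntegrable

theorem intervalIntegrable_smul_continuous {E : Type*} [NormedAddCommGroup E] [NormedSpace ℝ E]
    {m : ℝ → ℝ} {y : ℝ → E} (hm : ∀ p q, IntervalIntegrable m volume p q) (hy : Continuous y)
    (p q : ℝ) : IntervalIntegrable (fun r => m r • y r) volume p q :=
  (hm p q).smul_continuousOn hy.continuousOn

theorem intervalIntegrable_smul_memLp {E : Type*} [NormedAddCommGroup E] [NormedSpace ℝ E]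
    {m : ℝ → ℝ} {g : ℝ → E} (hm : MemLp m 2 volume) (hg : MemLp g 2 volume)
    (p q : ℝ) : IntervalIntegrable (fun r => m r • g r) volume p q :=
  (memLp_one_iff_integrable.1 (hg.smul (r := 1) hm)).intervalIntegrable

theorem intervalIntegrable_finset_sum {E κ : Type*} [NormedAddCommGroup E] {s : Finset κ}
    {f : κ → ℝ → E} {a b : ℝ} (h : ∀ i ∈ s, IntervalIntegrable (f i) volume a b) :
    IntervalIntegrable (fun r => ∑ i ∈ s, f i r) volume a b := by
  have := IntervalIntegrable.sum s h
  rwa [Finset.sum_fn] at this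

open Classical in
/-- The solution of `y' = a y + f`, `y t₀ = x`, with a bounded operator `a`. -/
noncomputable def linSolve {E : Type*} [NormedAddCommGroup E] [NormedSpace ℝ E]
    (a : E →L[ℝ] E) (t₀ : ℝ) (x : E) (f : ℝ → E) : ℝ → E :=
  if h : ∃ y : ℝ → E, y t₀ = x ∧ IsPrimitive y (fun t => a (y t) + f t) then h.choose else 0

theorem linSolve_spec {E : Type*} [NormedAddCommGroup E] [NormedSpace ℝ E] [CompleteSpace E]
    (a : E →L[ℝ] E) (t₀ : ℝ) (x : E) {f : ℝ → E} (hf : ∀ p q, IntervalIntegrable f volume p q) :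
    linSolve a t₀ x f t₀ = x ∧
      IsPrimitive (linSolve a t₀ x f) (fun t => a (linSolve a t₀ x f t) + f t) := by
  have h := exists_isPrimitive_linear a hf t₀ x
  rw [linSolve, dif_pos h]
  exact h.choose_spec

/-- A linear evolution equation with bounded operators in the Hilbert space `Y`, driven by a
colored noise whose representation operators take the basis functions to the functions `m p`. -/
structure EvolutionData (X Y : Type*) [NormedAddCommGroup X] [InnerProductSpace ℝ X]
    [NormedAddCommGroup Y] [InnerProductSpace ℝ Y] where
  /-- the drift operator -/
  a : Y →L[ℝ] Y
  /-- the diffusion operators -/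
  b : ℕ → Y →L[ℝ] Y
  /-- the smoothing map -/
  j : Y →L[ℝ] X
  /-- the initial value -/
  x₀ : Y
  /-- the free term of the drift -/
  f : ℝ → Y
  /-- a bound for the free term of the drift -/
  fBound : ℝ → ℝ
  /-- the free terms of the diffusion -/
  g : ℕ → ℝ → Y
  /-- the images of the basis functions -/
  m : ℕ × ℕ → ℝ → ℝ
  /-- the norms of the representation operators -/
  k : ℕ → ℝ
  /-- the ellipticity constant -/
  δ : ℝ
  /-- the constant in the parabolicity condition -/
  cA : ℝ
  /-- a bound for the diffusion operators -/
  cB : ℝ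
  δ_pos : 0 < δ
  cA_nonneg : 0 ≤ cA
  parabolic : ∀ y, 2 * inner ℝ (a y) y + δ * ‖j y‖ ^ 2 ≤ cA * ‖y‖ ^ 2
  sum_b_le : ∀ Λ : Finset ℕ, ∑ ℓ ∈ Λ, k ℓ ^ 2 * ‖b ℓ‖ ^ 2 ≤ cB
  memLp_f : MemLp f 2 volume
  memLp_fBound : MemLp fBound 2 volume
  -- The free term is measured against the smoothed vector, so that the dissipation δ ‖j y‖² can
  -- absorb it. The norm of f r in Y would not stay bounded under the regularization used later.
  inner_f_le : ∀ r y, inner ℝ (f r) y ≤ fBound r * ‖j y‖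
  memLp_g : ∀ ℓ, MemLp (g ℓ) 2 volume
  memLp_m : ∀ p, MemLp (m p) 2 volume
  -- The estimates divide by k ℓ; noises with k ℓ = 0 have to drop out at every time for the
  -- convention 0⁻¹ = 0 to be harmless.
  m_eq_zero : ∀ p r, k p.2 = 0 → m p r = 0
  -- Boundedness of the ℓ-th representation operator, tested on finite combinations of orthonormal
  -- functions. The positivity of `gram` rests on it.
  bessel : ∀ (s : Finset (ℕ × ℕ)) (c : ℕ × ℕ → ℝ) (ℓ : ℕ),
    ∫ r, (∑ p ∈ s with p.2 = ℓ, c p * m p r) ^ 2 ≤ k ℓ ^ 2 * ∑ p ∈ s with p.2 = ℓ, c p ^ 2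

namespace EvolutionData

variable {X Y : Type*} [NormedAddCommGroup X] [InnerProductSpace ℝ X]
  [NormedAddCommGroup Y] [InnerProductSpace ℝ Y] (D : EvolutionData X Y)

theorem intervalIntegrable_m (p : ℕ × ℕ) (a b : ℝ) : IntervalIntegrable (D.m p) volume a b :=
  (D.memLp_m p).intervalIntegrable_two a b

/-- The solution of the S-system, normalized by the factor `1 / √α!`. -/
noncomputable def coeff (α : MultiIndex) : ℝ → Y :=
  -- Division of the S-system by √α! removes the factors √α_p, since α! = α_p (α-ε_p)!. Non-random
  -- inputs have a component only at the index 0.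
  linSolve D.a 0 (if α = 0 then D.x₀ else 0) fun r =>
    (if α = 0 then D.f r else 0) + ∑ p ∈ α.support.attach, D.m p.1 r •
      (D.b p.1.2 (coeff (α - Finsupp.single p.1 1) r)
        + if α - Finsupp.single p.1 1 = 0 then D.g p.1.2 r else 0)
termination_by α.degree
decreasing_by
  have h := congrArg Finsupp.degree (sub_single_add_single p.2)
  rw [map_add, Finsupp.degree_single] at h
  omega

/-- The forcing term in the equation for `coeff α`. -/
noncomputable def forcing (α : MultiIndex) (r : ℝ) : Y :=
  (if α = 0 then D.f r else 0) + ∑ p ∈ α.support, D.m p r •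
      (D.b p.2 (D.coeff (α - Finsupp.single p 1) r)
        + if α - Finsupp.single p 1 = 0 then D.g p.2 r else 0)

theorem coeff_eq (α : MultiIndex) :
    D.coeff α = linSolve D.a 0 (if α = 0 then D.x₀ else 0) (D.forcing α) := by
  rw [coeff]
  congr 1
  ext r
  rw [forcing, ← Finset.sum_attach α.support]

theorem intervalIntegrable_forcing {α : MultiIndex}
    (h : ∀ p ∈ α.support, Continuous (D.coeff (α - Finsupp.single p 1))) (a b : ℝ) :
    IntervalIntegrable (D.forcing α) volume a b := by
  refine IntervalIntegrable.add ?_ (intervalIntegrable_finset_sum fun p hp => ?_)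
  · split_ifs
    · exact D.memLp_f.intervalIntegrable_two a b
    · exact intervalIntegrable_const
  · simp only [smul_add]
    refine (intervalIntegrable_smul_continuous (D.intervalIntegrable_m p)
      (by have := h p hp; fun_prop) a b).add ?_
    split_ifs
    · exact intervalIntegrable_smul_memLp (D.memLp_m p) (D.memLp_g p.2) a b
    · simp

variable [CompleteSpace Y]

theorem coeff_spec (α : MultiIndex) : D.coeff α 0 = (if α = 0 then D.x₀ else 0) ∧
    IsPrimitive (D.coeff α) (fun t => D.a (D.coeff α t) + D.forcing α t) := by
  induction hn : α.degree using Nat.strong_induction_on generalizing α with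
  | _ n ih =>
    rw [coeff_eq]
    refine linSolve_spec _ _ _ (D.intervalIntegrable_forcing fun p hp => ?_)
    have h := congrArg Finsupp.degree (sub_single_add_single hp)
    rw [map_add, Finsupp.degree_single] at h
    exact (ih _ (by omega) _ rfl).2.continuous

theorem continuous_coeff (α : MultiIndex) : Continuous (D.coeff α) :=
  (D.coeff_spec α).2.continuous

theorem isPrimitive_coeff (α : MultiIndex) :
    IsPrimitive (D.coeff α) (fun t => D.a (D.coeff α t) + D.forcing α t) :=
  (D.coeff_spec α).2

/-- The solution of the adjoint system on the multi-indices of degree at most `N`, with the value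
`Φ` at the time `t₁`. -/
noncomputable def dual (s : Finset (ℕ × ℕ)) (N : ℕ) (t₁ : ℝ) (Φ : MultiIndex → Y)
    (α : MultiIndex) : ℝ → Y :=
  if h : α.degree ≤ N then
    linSolve (-D.a.adjoint) t₁ (Φ α) fun r =>
      -∑ p ∈ s, D.m p r • (D.b p.2).adjoint (dual s N t₁ Φ (α + Finsupp.single p 1) r)
  -- The equation for φ_α refers to indices one degree higher. Setting these to zero above degree N
  -- closes the system, which is then solved from the top degree downward.
  else 0
termination_by N + 1 - α.degree
decreasing_by
  rw [map_add, Finsupp.degree_single]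
  omega

variable {s : Finset (ℕ × ℕ)} {N : ℕ} {t₁ : ℝ} {Φ : MultiIndex → Y}

theorem dual_of_lt {α : MultiIndex} (h : N < α.degree) : D.dual s N t₁ Φ α = 0 := by
  rw [dual, dif_neg (by omega)]

theorem dual_spec (α : MultiIndex) : (α.degree ≤ N → D.dual s N t₁ Φ α t₁ = Φ α) ∧
    IsPrimitive (D.dual s N t₁ Φ α) (fun r => -(D.a.adjoint (D.dual s N t₁ Φ α r)
      + ∑ p ∈ s, D.m p r • (D.b p.2).adjoint
          (D.dual s N t₁ Φ (α + Finsupp.single p 1) r))) := by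
  induction hn : N + 1 - α.degree using Nat.strong_induction_on generalizing α with
  | _ n ih =>
    by_cases h : α.degree ≤ N
    · have hint : ∀ a b, IntervalIntegrable (fun r => -∑ p ∈ s, D.m p r • (D.b p.2).adjoint
          (D.dual s N t₁ Φ (α + Finsupp.single p 1) r)) volume a b := fun a b =>
        (intervalIntegrable_finset_sum fun p hp => intervalIntegrable_smul_continuous
          (D.intervalIntegrable_m p) (by
            have := (ih _ (by rw [map_add, Finsupp.degree_single]; omega)
              (α + Finsupp.single p 1) rfl).2.continuous
            exact (D.b p.2).adjoint.continuous.comp this) a b).neg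
      have h1 := linSolve_spec (-D.a.adjoint) t₁ (Φ α) hint
      have h2 : D.dual s N t₁ Φ α = linSolve (-D.a.adjoint) t₁ (Φ α) fun r =>
          -∑ p ∈ s, D.m p r • (D.b p.2).adjoint
            (D.dual s N t₁ Φ (α + Finsupp.single p 1) r) := by
        rw [dual, dif_pos h]
      rw [← h2] at h1
      refine ⟨fun _ => h1.1, h1.2.congr fun r => ?_⟩
      rw [neg_add]; rfl
    · refine ⟨fun h' => absurd h' h, ?_⟩
      rw [D.dual_of_lt (by omega)]
      refine (IsPrimitive.const (0 : Y)).congr fun r => ?_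
      rw [Finset.sum_eq_zero fun p _ => ?_]
      · simp
      · rw [D.dual_of_lt (by rw [map_add, Finsupp.degree_single]; omega)]
        simp

theorem continuous_dual (α : MultiIndex) : Continuous (D.dual s N t₁ Φ α) :=
  (D.dual_spec α).2.continuous

end EvolutionData

end ColoredChaos

/-! ### Duality between the S-system and the adjoint system. -/

namespace ColoredChaos

/-- The inner product as a continuous bilinear form. -/
noncomputable abbrev innerForm (Y : Type*) [NormedAddCommGroup Y] [InnerProductSpace ℝ Y] :
    Y →L[ℝ] Y →L[ℝ] ℝ := innerSL ℝ

theorem innerForm_apply {Y : Type*} [NormedAddCommGroup Y] [InnerProductSpace ℝ Y] (y z : Y) :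
    innerForm Y y z = inner ℝ y z := rfl

theorem degree_of_mem_finsuppAntidiag {κ : Type*} [DecidableEq κ] {s : Finset κ} {n : ℕ}
    {α : κ →₀ ℕ} (h : α ∈ s.finsuppAntidiag n) : α.degree = n := by
  rw [Finset.mem_finsuppAntidiag] at h
  rw [← h.1, Finsupp.degree_apply]
  exact Finset.sum_subset h.2 fun x _ hx => Finsupp.notMem_support_iff.1 hx

namespace EvolutionData

variable {X Y : Type*} [NormedAddCommGroup X] [InnerProductSpace ℝ X]
  [NormedAddCommGroup Y] [InnerProductSpace ℝ Y] [CompleteSpace Y] (D : EvolutionData X Y)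
  {s : Finset (ℕ × ℕ)} {N : ℕ} {t₁ : ℝ} {Φ : MultiIndex → Y}

/-- The drifts cancel because one is the adjoint of the other. The diffusion terms cancel after a
shift of index: the forcing in degree n+1 is paired with the same quantity `V n` that the adjoint
equation produces in degree n. Only free terms survive, f in degree zero and g in degree one. -/
theorem isPrimitive_pairing (s : Finset (ℕ × ℕ)) (N : ℕ) (t₁ : ℝ) (Φ : MultiIndex → Y) :
    IsPrimitive
      (fun t => ∑ n ∈ Finset.range (N + 2), ∑ α ∈ s.finsuppAntidiag n,
        inner ℝ (D.coeff α t) (D.dual s (N + 1) t₁ Φ α t))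
      (fun t => inner ℝ (D.f t) (D.dual s (N + 1) t₁ Φ 0 t)
        + ∑ p ∈ s, D.m p t * inner ℝ (D.g p.2 t)
            (D.dual s (N + 1) t₁ Φ (Finsupp.single p 1) t)) := by
  have h1 := IsPrimitive.sum (Finset.range (N + 2)) fun n _ =>
    IsPrimitive.sum (s.finsuppAntidiag n) fun α _ =>
      (D.isPrimitive_coeff α).bilin (innerForm Y) (D.dual_spec (s := s) (N := N + 1)
        (t₁ := t₁) (Φ := Φ) α).2
  refine h1.congr fun t => ?_
  set φ : MultiIndex → Y := fun α => D.dual s (N + 1) t₁ Φ α t with hφ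
  set u : MultiIndex → Y := fun α => D.coeff α t with hu
  let V : ℕ → ℝ := fun n => ∑ γ ∈ s.finsuppAntidiag n, ∑ p ∈ s,
    D.m p t * inner ℝ (D.b p.2 (u γ)) (φ (γ + Finsupp.single p 1))
  let Γ : ℝ := ∑ p ∈ s, D.m p t * inner ℝ (D.g p.2 t) (φ (Finsupp.single p 1))
  have hlevel : ∀ n, ∑ α ∈ s.finsuppAntidiag n,
      (innerForm Y (D.a (D.coeff α t) + D.forcing α t) (φ α)
        + innerForm Y (D.coeff α t) (-(D.a.adjoint (φ α)
          + ∑ p ∈ s, D.m p t • (D.b p.2).adjoint (φ (α + Finsupp.single p 1)))))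
      = ∑ α ∈ s.finsuppAntidiag n, inner ℝ (D.forcing α t) (φ α) - V n := by
    intro n
    rw [← Finset.sum_sub_distrib]
    refine Finset.sum_congr rfl fun α _ => ?_
    simp only [innerForm_apply, inner_add_left, inner_neg_right, inner_add_right, inner_sum,
      inner_smul_right, ContinuousLinearMap.adjoint_inner_right, hu]
    ring
  -- The top degree has no partner in the telescoping sum, but its term involves the adjoint
  -- solution beyond the truncation. The truncation is at N + 1 so that degree one, where g acts, is
  -- always present.
  have hV : V (N + 1) = 0 := by
    refine Finset.sum_eq_zero fun γ hγ => Finset.sum_eq_zero fun p _ => ?_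
    have : φ (γ + Finsupp.single p 1) = 0 := by
      simp only [hφ]
      rw [D.dual_of_lt (by
        rw [map_add, Finsupp.degree_single, degree_of_mem_finsuppAntidiag hγ]; omega)]
      rfl
    rw [this, inner_zero_right, mul_zero]
  have h0 : ∑ α ∈ s.finsuppAntidiag 0, inner ℝ (D.forcing α t) (φ α) = inner ℝ (D.f t) (φ 0) := by
    simp [forcing]
  have hsucc : ∀ n, ∑ α ∈ s.finsuppAntidiag (n + 1), inner ℝ (D.forcing α t) (φ α)
      = V n + if n = 0 then Γ else 0 := by
    intro n
    have e1 : ∀ α ∈ s.finsuppAntidiag (n + 1), inner ℝ (D.forcing α t) (φ α)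
        = ∑ p ∈ α.support, D.m p t * inner ℝ (D.b p.2 (u (α - Finsupp.single p 1))
          + if α - Finsupp.single p 1 = 0 then D.g p.2 t else 0) (φ α) := by
      intro α hα
      have hne : α ≠ 0 := by
        rintro rfl
        have := degree_of_mem_finsuppAntidiag hα
        simp at this
      rw [forcing, if_neg hne, zero_add, sum_inner]
      exact Finset.sum_congr rfl fun p _ => by rw [real_inner_smul_left]
    rw [Finset.sum_congr rfl e1, sum_finsuppAntidiag_succ s n fun p γ α =>
      D.m p t * inner ℝ (D.b p.2 (u γ) + if γ = 0 then D.g p.2 t else 0) (φ α)]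
    simp only [inner_add_left, mul_add, Finset.sum_add_distrib]
    congr 1
    split_ifs with hn
    · subst hn
      simp [Γ]
    · refine Finset.sum_eq_zero fun γ hγ => Finset.sum_eq_zero fun p _ => ?_
      rw [if_neg, inner_zero_left, mul_zero]
      rintro rfl
      have := degree_of_mem_finsuppAntidiag hγ
      simp at this
      omega
  rw [Finset.sum_congr rfl fun n _ => hlevel n, Finset.sum_sub_distrib, Finset.sum_range_succ',
    Finset.sum_range_succ V, hV, h0, Finset.sum_congr rfl fun n _ => hsucc n,
    Finset.sum_add_distrib, Finset.sum_ite_eq' (Finset.range (N + 1)) 0 fun _ => Γ,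
    if_pos (by simp)]
  simp only [hφ, Γ]
  ring

end EvolutionData

end ColoredChaos

/-! ### The weight matrix and the differential inequality on each chaos. -/

namespace ColoredChaos

namespace EvolutionData

variable {X Y : Type*} [NormedAddCommGroup X] [InnerProductSpace ℝ X]
  [NormedAddCommGroup Y] [InnerProductSpace ℝ Y] (D : EvolutionData X Y)
  {s : Finset (ℕ × ℕ)} {N : ℕ} {t₁ : ℝ} {Φ : MultiIndex → Y}

/-- The derivative of the covariance `gram`. -/
noncomputable def gramDeriv (r : ℝ) (p q : ℕ × ℕ) : ℝ :=
  if p.2 = q.2 then (D.k p.2 ^ 2)⁻¹ * (D.m p r * D.m q r) else 0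

/-- The covariance of the part of the noise, up to time `τ`, that is not seen by the basis. -/
noncomputable def gram (t₁ τ : ℝ) (p q : ℕ × ℕ) : ℝ :=
  (if p = q then 1 else 0) + ∫ r in t₁..τ, D.gramDeriv r p q

theorem integrable_m_mul_m (p q : ℕ × ℕ) : Integrable (fun r => D.m p r * D.m q r) volume :=
  (D.memLp_m p).integrable_mul (D.memLp_m q)

theorem integrable_gramDeriv (p q : ℕ × ℕ) :
    Integrable (fun r => D.gramDeriv r p q) volume := by
  unfold gramDeriv
  split_ifs
  · exact (D.integrable_m_mul_m p q).const_mul _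
  · exact integrable_zero _ _ _

theorem isPrimitive_gram (t₁ : ℝ) (p q : ℕ × ℕ) :
    IsPrimitive (fun t => D.gram t₁ t p q) (fun t => D.gramDeriv t p q) :=
  isPrimitive_integral (fun _ _ => (D.integrable_gramDeriv p q).intervalIntegrable) _ _

theorem gram_self (t₁ : ℝ) (p q : ℕ × ℕ) : D.gram t₁ t₁ p q = if p = q then 1 else 0 := by
  simp [gram]

theorem gramDeriv_comm (r : ℝ) (p q : ℕ × ℕ) : D.gramDeriv r p q = D.gramDeriv r q p := by
  unfold gramDeriv
  by_cases h : p.2 = q.2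
  · rw [if_pos h, if_pos h.symm, h, mul_comm (D.m p r)]
  · rw [if_neg h, if_neg (Ne.symm h)]

theorem gram_comm (t₁ τ : ℝ) (p q : ℕ × ℕ) : D.gram t₁ τ p q = D.gram t₁ τ q p := by
  unfold gram
  simp only [D.gramDeriv_comm _ p q, eq_comm]

theorem sum_fiber {M : Type*} [AddCommMonoid M] (s : Finset (ℕ × ℕ)) (F : ℕ × ℕ → M) :
    ∑ p ∈ s, F p = ∑ ℓ ∈ s.image Prod.snd, ∑ p ∈ s with p.2 = ℓ, F p :=
  (Finset.sum_fiberwise_of_maps_to (fun _ hp => Finset.mem_image_of_mem _ hp) F).symm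

theorem sum_gramDeriv (s : Finset (ℕ × ℕ)) (r : ℝ) (F : ℕ × ℕ → ℕ × ℕ → ℝ) :
    ∑ p ∈ s, ∑ q ∈ s, D.gramDeriv r p q * F p q
      = ∑ ℓ ∈ s.image Prod.snd, (D.k ℓ ^ 2)⁻¹ * ∑ p ∈ s with p.2 = ℓ, ∑ q ∈ s with q.2 = ℓ,
        D.m p r * D.m q r * F p q := by
  rw [sum_fiber]
  refine Finset.sum_congr rfl fun ℓ _ => ?_
  rw [Finset.mul_sum]
  refine Finset.sum_congr rfl fun p hp => ?_
  have hp2 : p.2 = ℓ := (Finset.mem_filter.1 hp).2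
  rw [Finset.mul_sum, Finset.sum_filter]
  refine Finset.sum_congr rfl fun q _ => ?_
  rw [gramDeriv, hp2]
  by_cases h : q.2 = ℓ
  · rw [if_pos h, if_pos h.symm]; ring
  · rw [if_neg h, if_neg (Ne.symm h), zero_mul]

/-- The quadratic form of the matrix at c is |c|² - ∑_ℓ k_ℓ⁻² ∫_τ^{t₁} (∑ c_p m_p)², with the inner
sum over the directions of the ℓ-th noise. By `bessel` each integral is at most k_ℓ² times the
corresponding part of |c|². -/
theorem isGram_gram (s : Finset (ℕ × ℕ)) {t₁ τ : ℝ} (h : τ ≤ t₁) : IsGram s (D.gram t₁ τ) := by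
  refine isGram_of_nonneg (D.gram_comm t₁ τ) fun c => ?_
  have hint : ∀ p q, IntervalIntegrable (fun r => D.gramDeriv r p q) volume τ t₁ :=
    fun p q => (D.integrable_gramDeriv p q).intervalIntegrable
  have e1 : ∑ p ∈ s, ∑ q ∈ s, c p * c q * D.gram t₁ τ p q
      = ∑ p ∈ s, c p ^ 2 - ∫ r in τ..t₁, ∑ p ∈ s, ∑ q ∈ s, D.gramDeriv r p q * (c p * c q) := by
    rw [intervalIntegral.integral_finsetSum fun p _ => intervalIntegrable_finset_sum fun q _ =>
      (hint p q).mul_const _, ← Finset.sum_sub_distrib]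
    refine Finset.sum_congr rfl fun p hp => ?_
    rw [intervalIntegral.integral_finsetSum fun q _ => (hint p q).mul_const _]
    have : c p ^ 2 = ∑ q ∈ s, if p = q then c p * c q else 0 := by
      rw [Finset.sum_ite_eq, if_pos hp, sq]
    rw [this, ← Finset.sum_sub_distrib]
    refine Finset.sum_congr rfl fun q _ => ?_
    rw [gram, intervalIntegral.integral_mul_const, intervalIntegral.integral_symm]
    split_ifs <;> ring
  have hsq : ∀ ℓ, Integrable (fun r => (∑ p ∈ s with p.2 = ℓ, c p * D.m p r) ^ 2) volume :=
    fun ℓ => MemLp.integrable_sq (memLp_finsetSum _ fun p _ => (D.memLp_m p).const_mul _)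
  have e2 : ∀ r, ∑ p ∈ s, ∑ q ∈ s, D.gramDeriv r p q * (c p * c q)
      = ∑ ℓ ∈ s.image Prod.snd, (D.k ℓ ^ 2)⁻¹ * (∑ p ∈ s with p.2 = ℓ, c p * D.m p r) ^ 2 := by
    intro r
    rw [sum_gramDeriv]
    refine Finset.sum_congr rfl fun ℓ _ => ?_
    congr 1
    rw [sq, Finset.sum_mul_sum]
    exact Finset.sum_congr rfl fun p _ => Finset.sum_congr rfl fun q _ => by ring
  rw [e1, sub_nonneg]
  simp only [e2]
  rw [intervalIntegral.integral_finsetSum fun ℓ _ => ((hsq ℓ).const_mul _).intervalIntegrable,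
    sum_fiber s]
  refine Finset.sum_le_sum fun ℓ _ => ?_
  rw [intervalIntegral.integral_const_mul, intervalIntegral.integral_of_le h]
  have h1 : ∫ r in Set.Ioc τ t₁, (∑ p ∈ s with p.2 = ℓ, c p * D.m p r) ^ 2
      ≤ D.k ℓ ^ 2 * ∑ p ∈ s with p.2 = ℓ, c p ^ 2 :=
    (setIntegral_le_integral (hsq ℓ) (Eventually.of_forall fun r => by positivity)).trans
      (D.bessel s c ℓ)
  have h2 : 0 ≤ ∑ p ∈ s with p.2 = ℓ, c p ^ 2 := Finset.sum_nonneg fun p _ => by positivity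
  by_cases hk : D.k ℓ = 0
  · simpa [hk] using h2
  · have hk2 : 0 < D.k ℓ ^ 2 := by positivity
    calc _ ≤ (D.k ℓ ^ 2)⁻¹ * (D.k ℓ ^ 2 * ∑ p ∈ s with p.2 = ℓ, c p ^ 2) := by gcongr
      _ = _ := by rw [← mul_assoc, inv_mul_cancel₀ hk2.ne', one_mul]

/-- The derivative in the direction of the `ℓ`-th noise at time `r`. -/
noncomputable def noiseDeriv (s : Finset (ℕ × ℕ)) (r : ℝ) (ℓ : ℕ) (φ : MultiIndex → Y) :
    MultiIndex → Y :=
  ∑ p ∈ s with p.2 = ℓ, D.m p r • shift p φ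

theorem noiseDeriv_apply (r : ℝ) (ℓ : ℕ) (φ : MultiIndex → Y) (α : MultiIndex) :
    D.noiseDeriv s r ℓ φ α = ∑ p ∈ s with p.2 = ℓ, D.m p r • φ (α + Finsupp.single p 1) := by
  simp [noiseDeriv]

/-- The increment of the form on the `n`-th chaos caused by the noise. -/
noncomputable def noiseForm (s : Finset (ℕ × ℕ)) (S : ℕ × ℕ → ℕ × ℕ → ℝ) (r : ℝ) (n : ℕ)
    (φ : MultiIndex → Y) : ℝ :=
  ∑ ℓ ∈ s.image Prod.snd, (D.k ℓ ^ 2)⁻¹ *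
    chaosForm (innerForm Y) s S n (D.noiseDeriv s r ℓ φ) (D.noiseDeriv s r ℓ φ)

/-- The derivative of the weight is block diagonal, with one rank-one block k_ℓ⁻² m mᵀ for each
noise, so the double sum collapses to the form at `noiseDeriv`. The passage from degree n+1 to n is
what allows gains and losses to telescope. -/
theorem chaosFormDeriv_succ_eq (S : ℕ × ℕ → ℕ × ℕ → ℝ) (r : ℝ) (n : ℕ) (φ : MultiIndex → Y) :
    chaosFormDeriv (innerForm Y) s S (D.gramDeriv r) (n + 1) φ φ = D.noiseForm s S r n φ := by
  rw [chaosFormDeriv, sum_gramDeriv, noiseForm]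
  refine Finset.sum_congr rfl fun ℓ _ => ?_
  congr 1
  simp only [noiseDeriv, map_sum, map_smul, LinearMap.sum_apply, LinearMap.smul_apply,
    smul_eq_mul, Finset.mul_sum]
  rw [Finset.sum_comm]
  exact Finset.sum_congr rfl fun p _ => Finset.sum_congr rfl fun q _ => by ring

variable [CompleteSpace Y]

/-- The right-hand side of the adjoint system. -/
noncomputable def dualDrift (s : Finset (ℕ × ℕ)) (r : ℝ) (φ : MultiIndex → Y) (α : MultiIndex) :
    Y :=
  -(D.a.adjoint (φ α) + ∑ p ∈ s, D.m p r • (D.b p.2).adjoint (φ (α + Finsupp.single p 1)))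

theorem dualDrift_eq (r : ℝ) (φ : MultiIndex → Y) :
    D.dualDrift s r φ = -((fun α => D.a.adjoint (φ α))
      + ∑ ℓ ∈ s.image Prod.snd, fun α => (D.b ℓ).adjoint (D.noiseDeriv s r ℓ φ α)) := by
  ext α
  rw [dualDrift, sum_fiber]
  simp only [Pi.neg_apply, Pi.add_apply, Finset.sum_apply, noiseDeriv_apply, map_sum, map_smul]
  congr 2
  refine Finset.sum_congr rfl fun ℓ _ => Finset.sum_congr rfl fun p hp => ?_
  rw [(Finset.mem_filter.1 hp).2]

/-- Parabolicity says that the form cA (y,y) - 2 (a*y,y) - δ (jy,jy) is nonnegative on Y, and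
`chaosForm_nonneg` transfers this to the chaos. -/
theorem chaosForm_drift_le {S : ℕ × ℕ → ℕ × ℕ → ℝ} (hS : IsGram s S) (n : ℕ)
    (φ : MultiIndex → Y) :
    2 * chaosForm (innerForm Y) s S n (fun α => D.a.adjoint (φ α)) φ
        + D.δ * chaosForm ((innerForm X).bilinearComp D.j D.j) s S n φ φ
      ≤ D.cA * chaosForm (innerForm Y) s S n φ φ := by
  have h := chaosForm_nonneg (β := D.cA • innerForm Y
    + ((-2 : ℝ) • (innerForm Y).bilinearComp D.a.adjoint (.id ℝ Y)
      + (-D.δ) • (innerForm X).bilinearComp D.j D.j)) hS (fun y => by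
        have := D.parabolic y
        simp only [add_apply, smul_apply, ContinuousLinearMap.bilinearComp_apply,
          innerForm_apply, smul_eq_mul, ContinuousLinearMap.adjoint_inner_left,
          real_inner_self_eq_norm_sq, ContinuousLinearMap.coe_id', id_eq]
        rw [real_inner_comm] at this
        linarith) n φ
  simp only [chaosForm_add, chaosForm_smul] at h
  rw [← chaosForm_comp] at h
  simp only [ContinuousLinearMap.coe_id', id_eq] at h
  linarith

/-- Young's inequality, obtained from the positivity of the form at k⁻¹ψ - k bφ with ψ the noise
derivative. The weights are such that the k⁻² term matches the gain of `chaosFormDeriv_succ_eq` and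
the constants k²‖b‖² sum to at most cB. -/
theorem chaosForm_noise_le {S : ℕ × ℕ → ℕ × ℕ → ℝ} (hS : IsGram s S)
    (hsymm : ∀ p q, S p q = S q p) (r : ℝ) (ℓ n : ℕ) (φ : MultiIndex → Y) :
    2 * chaosForm (innerForm Y) s S n (fun α => (D.b ℓ).adjoint (D.noiseDeriv s r ℓ φ α)) φ
      ≤ (D.k ℓ ^ 2)⁻¹ * chaosForm (innerForm Y) s S n (D.noiseDeriv s r ℓ φ)
          (D.noiseDeriv s r ℓ φ)
        + D.k ℓ ^ 2 * ‖D.b ℓ‖ ^ 2 * chaosForm (innerForm Y) s S n φ φ := by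
  set ψ := D.noiseDeriv s r ℓ φ with hψ
  by_cases hk : D.k ℓ = 0
  · have hψ0 : ψ = 0 := by
      rw [hψ, noiseDeriv]
      refine Finset.sum_eq_zero fun p hp => ?_
      rw [D.m_eq_zero p r (by rw [(Finset.mem_filter.1 hp).2, hk]), zero_smul]
    have : (fun α => (D.b ℓ).adjoint (ψ α)) = 0 := by
      ext α; simp [hψ0]
    rw [this, hψ0]
    simp [hk]
  · have h1 : chaosForm (innerForm Y) s S n (fun α => (D.b ℓ).adjoint (ψ α)) φ
        = chaosForm (innerForm Y) s S n ψ (fun α => D.b ℓ (φ α)) := by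
      refine (chaosForm_comp (D.b ℓ).adjoint (.id ℝ Y) n ψ φ).trans (Eq.trans ?_
        (chaosForm_comp (.id ℝ Y) (D.b ℓ) n ψ φ).symm)
      congr 3
      ext y z
      simp [innerForm_apply, ContinuousLinearMap.adjoint_inner_left]
    have h2 : chaosForm (innerForm Y) s S n (fun α => D.b ℓ (φ α)) (fun α => D.b ℓ (φ α))
        ≤ ‖D.b ℓ‖ ^ 2 * chaosForm (innerForm Y) s S n φ φ := by
      have h := chaosForm_nonneg (β := ‖D.b ℓ‖ ^ 2 • innerForm Y
        + (-1 : ℝ) • (innerForm Y).bilinearComp (D.b ℓ) (D.b ℓ)) hS (fun y => by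
          have h3 := (D.b ℓ).le_opNorm y
          have h4 := pow_le_pow_left₀ (norm_nonneg _) h3 2
          rw [mul_pow] at h4
          simp only [add_apply, smul_apply, ContinuousLinearMap.bilinearComp_apply,
            innerForm_apply, smul_eq_mul, real_inner_self_eq_norm_sq]
          linarith) n φ
      simp only [chaosForm_add, chaosForm_smul] at h
      rw [← chaosForm_comp] at h
      linarith
    have h3 := chaosForm_nonneg (β := innerForm Y) hS
      (fun y => by rw [innerForm_apply]; exact real_inner_self_nonneg) n
      ((D.k ℓ)⁻¹ • ψ - D.k ℓ • fun α => D.b ℓ (φ α))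
    have hcomm := chaosForm_comm (β := innerForm Y) (s := s)
      (fun y z => by rw [innerForm_apply, innerForm_apply, real_inner_comm]) hsymm n
      (fun α => D.b ℓ (φ α)) ψ
    simp only [map_sub, map_smul, LinearMap.sub_apply, LinearMap.smul_apply, smul_eq_mul,
      hcomm] at h3
    rw [h1]
    have h4 := mul_le_mul_of_nonneg_left h2 (sq_nonneg (D.k ℓ))
    have h5 : (D.k ℓ)⁻¹ * D.k ℓ = 1 := inv_mul_cancel₀ hk
    generalize chaosForm (innerForm Y) s S n ψ ψ = A at *
    generalize chaosForm (innerForm Y) s S n ψ (fun α => D.b ℓ (φ α)) = B at *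
    generalize chaosForm (innerForm Y) s S n (fun α => D.b ℓ (φ α)) (fun α => D.b ℓ (φ α)) = C at *
    have h6 : (D.k ℓ)⁻¹ * ((D.k ℓ)⁻¹ * A - D.k ℓ * B) - D.k ℓ * ((D.k ℓ)⁻¹ * B - D.k ℓ * C)
        = (D.k ℓ ^ 2)⁻¹ * A - 2 * ((D.k ℓ)⁻¹ * D.k ℓ) * B + D.k ℓ ^ 2 * C := by
      rw [← inv_pow]; ring
    have h7 : 0 ≤ (D.k ℓ ^ 2)⁻¹ * A - 2 * ((D.k ℓ)⁻¹ * D.k ℓ) * B + D.k ℓ ^ 2 * C := by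
      rw [← h6]
      exact h3
    rw [h5] at h7
    linarith

/-- The basic differential inequality on the `n`-th chaos. -/
theorem le_chaosForm_dualDrift {S : ℕ × ℕ → ℕ × ℕ → ℝ} (hS : IsGram s S)
    (hsymm : ∀ p q, S p q = S q p) (r : ℝ) (n : ℕ) (φ : MultiIndex → Y) :
    D.δ * chaosForm ((innerForm X).bilinearComp D.j D.j) s S n φ φ - D.noiseForm s S r n φ
        - (D.cA + D.cB) * chaosForm (innerForm Y) s S n φ φ
      ≤ chaosForm (innerForm Y) s S n (D.dualDrift s r φ) φ
        + chaosForm (innerForm Y) s S n φ (D.dualDrift s r φ) := by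
  rw [chaosForm_comm (β := innerForm Y) (fun y z => by
    rw [innerForm_apply, innerForm_apply, real_inner_comm]) hsymm n φ (D.dualDrift s r φ),
    ← two_mul, dualDrift_eq]
  have h1 := D.chaosForm_drift_le hS n φ
  have h2 := Finset.sum_le_sum fun ℓ (_ : ℓ ∈ s.image Prod.snd) =>
    D.chaosForm_noise_le hS hsymm r ℓ n φ
  rw [← Finset.mul_sum, Finset.sum_add_distrib, ← Finset.sum_mul] at h2
  have h3 := mul_le_mul_of_nonneg_right (D.sum_b_le (s.image Prod.snd))
    (chaosForm_nonneg (β := innerForm Y) hS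
      (fun y => by rw [innerForm_apply]; exact real_inner_self_nonneg) n φ)
  simp only [map_neg, map_add, map_sum, LinearMap.neg_apply, LinearMap.add_apply,
    LinearMap.sum_apply]
  rw [noiseForm]
  linarith

end EvolutionData

end ColoredChaos

/-! ### Gronwall estimates for the adjoint system. -/

namespace ColoredChaos

/-- The function e^{cr} y(r) has derivative at least e^{cr} h(r) ≥ h(r). The inequality runs
backward, from the terminal value to the initial one, as the adjoint system does. -/
theorem IsPrimitive.gronwall {y y' h : ℝ → ℝ} (hy : IsPrimitive y y') {c t : ℝ} (hc : 0 ≤ c)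
    (ht : 0 ≤ t) (hint : IntervalIntegrable h volume 0 t) (hh : ∀ r ∈ Set.Icc 0 t, 0 ≤ h r)
    (hle : ∀ r ∈ Set.Icc 0 t, h r - c * y r ≤ y' r) :
    y 0 + ∫ r in (0 : ℝ)..t, h r ≤ Real.exp (c * t) * y t := by
  have h1 := ((isPrimitive_exp_mul c).mul hy).mono ht hint fun r hr => by
    have h2 : 1 ≤ Real.exp (c * r) := Real.one_le_exp (mul_nonneg hc hr.1)
    have h3 := mul_le_mul_of_nonneg_left (hle r hr) (Real.exp_pos (c * r)).le
    have h4 := mul_le_mul_of_nonneg_right h2 (hh r hr)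
    linarith
  simpa using h1

namespace EvolutionData

variable {X Y : Type*} [NormedAddCommGroup X] [InnerProductSpace ℝ X]
  [NormedAddCommGroup Y] [InnerProductSpace ℝ Y] (D : EvolutionData X Y)
  {s : Finset (ℕ × ℕ)} {N : ℕ} {t₁ : ℝ} {Φ : MultiIndex → Y}

theorem cB_nonneg : 0 ≤ D.cB := by simpa using D.sum_b_le ∅

theorem noiseForm_nonneg {S : ℕ × ℕ → ℕ × ℕ → ℝ} (hS : IsGram s S) (r : ℝ) (n : ℕ)
    (φ : MultiIndex → Y) : 0 ≤ D.noiseForm s S r n φ :=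
  Finset.sum_nonneg fun ℓ _ => mul_nonneg (by positivity) (chaosForm_nonneg hS
    (fun y => by rw [innerForm_apply]; exact real_inner_self_nonneg) n _)

theorem noiseForm_zero (S : ℕ × ℕ → ℕ × ℕ → ℝ) (r : ℝ) (φ : MultiIndex → Y) :
    D.noiseForm s S r 0 φ = ∑ ℓ ∈ s.image Prod.snd, (D.k ℓ ^ 2)⁻¹ *
      ‖∑ p ∈ s with p.2 = ℓ, D.m p r • φ (Finsupp.single p 1)‖ ^ 2 := by
  refine Finset.sum_congr rfl fun ℓ _ => ?_
  rw [chaosForm_zero, innerForm_apply, real_inner_self_eq_norm_sq, noiseDeriv_apply]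
  simp

variable [CompleteSpace Y]

/-- The square norm of the `n`-th chaos of the solution of the adjoint system, weighted with the
covariance `gram`. -/
noncomputable def dualEnergy (s : Finset (ℕ × ℕ)) (N : ℕ) (t₁ : ℝ) (Φ : MultiIndex → Y) (n : ℕ)
    (r : ℝ) : ℝ :=
  chaosForm (innerForm Y) s (D.gram t₁ r) n (fun α => D.dual s N t₁ Φ α r)
    (fun α => D.dual s N t₁ Φ α r)

/-- The derivative of `dualEnergy`. -/
noncomputable def dualEnergyDeriv (s : Finset (ℕ × ℕ)) (N : ℕ) (t₁ : ℝ) (Φ : MultiIndex → Y)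
    (n : ℕ) (r : ℝ) : ℝ :=
  chaosFormDeriv (innerForm Y) s (D.gram t₁ r) (D.gramDeriv r) n
      (fun α => D.dual s N t₁ Φ α r) (fun α => D.dual s N t₁ Φ α r)
    + (chaosForm (innerForm Y) s (D.gram t₁ r) n
        (D.dualDrift s r fun α => D.dual s N t₁ Φ α r) (fun α => D.dual s N t₁ Φ α r)
      + chaosForm (innerForm Y) s (D.gram t₁ r) n (fun α => D.dual s N t₁ Φ α r)
        (D.dualDrift s r fun α => D.dual s N t₁ Φ α r))

theorem isPrimitive_dualEnergy (n : ℕ) :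
    IsPrimitive (D.dualEnergy s N t₁ Φ n) (D.dualEnergyDeriv s N t₁ Φ n) :=
  isPrimitive_chaosForm (S' := D.gramDeriv) (fun p _ q _ => D.isPrimitive_gram t₁ p q)
    (φ' := fun r => D.dualDrift s r fun α => D.dual s N t₁ Φ α r)
    (ψ' := fun r => D.dualDrift s r fun α => D.dual s N t₁ Φ α r)
    (fun α => (D.dual_spec α).2) (fun α => (D.dual_spec α).2) n

theorem dualEnergy_nonneg {r : ℝ} (hr : r ≤ t₁) (n : ℕ) : 0 ≤ D.dualEnergy s N t₁ Φ n r :=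
  chaosForm_nonneg (D.isGram_gram s hr)
    (fun y => by rw [innerForm_apply]; exact real_inner_self_nonneg) n _

/-- The noise derivative in degree N evaluates the adjoint solution in degree N+1, where it is zero.
Hence the loss in the top degree needs no gain to compensate it. -/
theorem noiseForm_top {S : ℕ × ℕ → ℕ × ℕ → ℝ} (r q : ℝ) :
    D.noiseForm s S r N (fun α => D.dual s N t₁ Φ α q) = 0 := by
  refine Finset.sum_eq_zero fun ℓ _ => ?_
  rw [chaosForm_eq_zero, mul_zero]
  intro α hα
  rw [noiseDeriv_apply]
  refine Finset.sum_eq_zero fun p _ => ?_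
  rw [D.dual_of_lt (by
    rw [map_add, Finsupp.degree_single, degree_of_mem_finsuppAntidiag hα]; omega)]
  simp

/-- The gain in degree n+1 equals the loss in degree n, so the noise terms cancel in the sum. Of the
dissipation only degree zero is kept, which is what the pairing with f requires. -/
theorem le_sum_dualEnergyDeriv {r : ℝ} (hr : r ≤ t₁) :
    D.δ * ‖D.j (D.dual s N t₁ Φ 0 r)‖ ^ 2
        - (D.cA + D.cB) * ∑ n ∈ Finset.range (N + 1), D.dualEnergy s N t₁ Φ n r
      ≤ ∑ n ∈ Finset.range (N + 1), D.dualEnergyDeriv s N t₁ Φ n r := by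
  set φ : MultiIndex → Y := fun α => D.dual s N t₁ Φ α r with hφ
  have hS := D.isGram_gram s hr
  have h1 := Finset.sum_le_sum fun n (_ : n ∈ Finset.range (N + 1)) =>
    D.le_chaosForm_dualDrift hS (D.gram_comm t₁ r) r n φ
  have h2 : ∑ n ∈ Finset.range (N + 1), chaosFormDeriv (innerForm Y) s (D.gram t₁ r)
      (D.gramDeriv r) n φ φ
      = ∑ n ∈ Finset.range (N + 1), D.noiseForm s (D.gram t₁ r) r n φ := by
    rw [Finset.sum_range_succ', Finset.sum_range_succ, D.noiseForm_top]
    simp only [chaosFormDeriv_succ_eq]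
    rfl
  have h3 : ‖D.j (φ 0)‖ ^ 2 ≤ ∑ n ∈ Finset.range (N + 1),
      chaosForm ((innerForm X).bilinearComp D.j D.j) s (D.gram t₁ r) n φ φ := by
    rw [Finset.sum_range_succ']
    have : chaosForm ((innerForm X).bilinearComp D.j D.j) s (D.gram t₁ r) 0 φ φ
        = ‖D.j (φ 0)‖ ^ 2 := by
      rw [chaosForm_zero, ContinuousLinearMap.bilinearComp_apply, innerForm_apply,
        real_inner_self_eq_norm_sq]
    rw [this, le_add_iff_nonneg_left]
    refine Finset.sum_nonneg fun n _ => chaosForm_nonneg hS (fun y => ?_) _ _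
    rw [ContinuousLinearMap.bilinearComp_apply, innerForm_apply]
    exact real_inner_self_nonneg
  have h4 := mul_le_mul_of_nonneg_left h3 D.δ_pos.le
  simp only [dualEnergyDeriv, dualEnergy, Finset.sum_add_distrib, Finset.sum_sub_distrib,
    ← Finset.mul_sum] at h1 ⊢
  linarith

/-- When degree zero is left out of the sum, the gain made in degree one is not spent. This surplus
controls the first-order coefficients, against which g is paired. -/
theorem le_sum_dualEnergyDeriv' {r : ℝ} (hr : r ≤ t₁) :
    D.noiseForm s (D.gram t₁ r) r 0 (fun α => D.dual s N t₁ Φ α r)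
        - (D.cA + D.cB) * ∑ n ∈ Finset.range N, D.dualEnergy s N t₁ Φ (n + 1) r
      ≤ ∑ n ∈ Finset.range N, D.dualEnergyDeriv s N t₁ Φ (n + 1) r := by
  set φ : MultiIndex → Y := fun α => D.dual s N t₁ Φ α r with hφ
  have hS := D.isGram_gram s hr
  have h1 := Finset.sum_le_sum fun n (_ : n ∈ Finset.range N) =>
    D.le_chaosForm_dualDrift hS (D.gram_comm t₁ r) r (n + 1) φ
  have h2 : ∑ n ∈ Finset.range N, D.noiseForm s (D.gram t₁ r) r (n + 1) φ
      + D.noiseForm s (D.gram t₁ r) r 0 φ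
      = ∑ n ∈ Finset.range N, chaosFormDeriv (innerForm Y) s (D.gram t₁ r)
          (D.gramDeriv r) (n + 1) φ φ := by
    rw [← Finset.sum_range_succ' (fun n => D.noiseForm s (D.gram t₁ r) r n φ),
      Finset.sum_range_succ, D.noiseForm_top, add_zero]
    simp only [chaosFormDeriv_succ_eq]
  have h3 : 0 ≤ ∑ n ∈ Finset.range N,
      chaosForm ((innerForm X).bilinearComp D.j D.j) s (D.gram t₁ r) (n + 1) φ φ := by
    refine Finset.sum_nonneg fun n _ => chaosForm_nonneg hS (fun y => ?_) _ _
    rw [ContinuousLinearMap.bilinearComp_apply, innerForm_apply]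
    exact real_inner_self_nonneg
  have h4 := mul_nonneg D.δ_pos.le h3
  simp only [dualEnergyDeriv, dualEnergy, Finset.sum_add_distrib, Finset.sum_sub_distrib,
    ← Finset.mul_sum] at h1 ⊢
  linarith

theorem norm_dual_zero_sq_add_le (ht : 0 ≤ t₁) :
    ‖D.dual s N t₁ Φ 0 0‖ ^ 2 + D.δ * ∫ r in (0 : ℝ)..t₁, ‖D.j (D.dual s N t₁ Φ 0 r)‖ ^ 2
      ≤ Real.exp ((D.cA + D.cB) * t₁)
        * ∑ n ∈ Finset.range (N + 1), D.dualEnergy s N t₁ Φ n t₁ := by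
  have hc : Continuous fun r => D.δ * ‖D.j (D.dual s N t₁ Φ 0 r)‖ ^ 2 := by
    have := D.continuous_dual (s := s) (N := N) (t₁ := t₁) (Φ := Φ) 0
    fun_prop
  have h := (IsPrimitive.sum (Finset.range (N + 1)) fun n _ =>
    D.isPrimitive_dualEnergy (s := s) (N := N) (t₁ := t₁) (Φ := Φ) n).gronwall
    (add_nonneg D.cA_nonneg D.cB_nonneg) ht (hc.intervalIntegrable 0 t₁)
    (fun r _ => mul_nonneg D.δ_pos.le (sq_nonneg _))
    (fun r hr => D.le_sum_dualEnergyDeriv hr.2)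
  rw [intervalIntegral.integral_const_mul] at h
  refine le_trans (add_le_add_left ?_ _) h
  rw [Finset.sum_range_succ']
  have : D.dualEnergy s N t₁ Φ 0 0 = ‖D.dual s N t₁ Φ 0 0‖ ^ 2 := by
    rw [dualEnergy, chaosForm_zero, innerForm_apply, real_inner_self_eq_norm_sq]
  rw [this, le_add_iff_nonneg_left]
  exact Finset.sum_nonneg fun n _ => D.dualEnergy_nonneg ht _

theorem intervalIntegrable_noise_dual (a b : ℝ) : IntervalIntegrable (fun r =>
    D.noiseForm s (D.gram t₁ r) r 0 fun α => D.dual s N t₁ Φ α r) volume a b := by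
  simp only [← chaosFormDeriv_succ_eq, chaosFormDeriv, chaosForm_zero]
  refine intervalIntegrable_finset_sum fun p _ => intervalIntegrable_finset_sum fun q _ =>
    (D.integrable_gramDeriv p q).intervalIntegrable.mul_continuousOn (Continuous.continuousOn ?_)
  simp only [shift_apply, innerForm_apply]
  exact (D.continuous_dual _).inner (D.continuous_dual _)

theorem integral_noise_dual_le (ht : 0 ≤ t₁) :
    ∫ r in (0 : ℝ)..t₁, (∑ ℓ ∈ s.image Prod.snd, (D.k ℓ ^ 2)⁻¹ *
        ‖∑ p ∈ s with p.2 = ℓ, D.m p r • D.dual s N t₁ Φ (Finsupp.single p 1) r‖ ^ 2)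
      ≤ Real.exp ((D.cA + D.cB) * t₁)
        * ∑ n ∈ Finset.range (N + 1), D.dualEnergy s N t₁ Φ n t₁ := by
  have h := (IsPrimitive.sum (Finset.range N) fun n _ =>
    D.isPrimitive_dualEnergy (s := s) (N := N) (t₁ := t₁) (Φ := Φ) (n + 1)).gronwall
    (add_nonneg D.cA_nonneg D.cB_nonneg) ht (D.intervalIntegrable_noise_dual 0 t₁)
    (fun r hr => D.noiseForm_nonneg (D.isGram_gram s hr.2) r 0 _)
    (fun r hr => D.le_sum_dualEnergyDeriv' hr.2)
  simp only [noiseForm_zero] at h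
  rw [Finset.sum_range_succ']
  have h1 : 0 ≤ ∑ n ∈ Finset.range N, D.dualEnergy s N t₁ Φ (n + 1) 0 :=
    Finset.sum_nonneg fun n _ => D.dualEnergy_nonneg ht _
  have h2 := mul_nonneg (Real.exp_pos ((D.cA + D.cB) * t₁)).le
    (D.dualEnergy_nonneg (s := s) (N := N) (Φ := Φ) (le_refl t₁) 0)
  rw [mul_add]
  linarith

theorem dualEnergy_self (n : ℕ) (hn : n ≤ N) : D.dualEnergy s N t₁ Φ n t₁
    = ∑ α ∈ s.finsuppAntidiag n, (multiFactorial α)⁻¹ * ‖Φ α‖ ^ 2 := by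
  rw [dualEnergy, chaosForm_one fun p _ q _ => D.gram_self t₁ p q]
  refine Finset.sum_congr rfl fun α hα => ?_
  rw [(D.dual_spec α).1 (by rwa [degree_of_mem_finsuppAntidiag hα]), innerForm_apply,
    real_inner_self_eq_norm_sq]

/-- The square norm of the part of the solution of the S-system that is supported by the
multi-indices on `s` of degree at most `N`. -/
noncomputable def energy (s : Finset (ℕ × ℕ)) (N : ℕ) (t : ℝ) : ℝ :=
  ∑ n ∈ Finset.range (N + 1), ∑ α ∈ s.finsuppAntidiag n, multiFactorial α * ‖D.coeff α t‖ ^ 2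

/-- The terminal value of the adjoint system that is dual to the solution at time `t`. -/
noncomputable def terminal (t : ℝ) (α : MultiIndex) : Y := multiFactorial α • D.coeff α t

/-- The factor α! in `terminal` makes two quantities agree: the pairing of terminal value and
solution, and the dual norm ∑‖Φ_α‖²/α!, are both the energy. This lets the estimate close by
absorption. -/
theorem sum_dualEnergy_terminal (t : ℝ) :
    ∑ n ∈ Finset.range (N + 1), D.dualEnergy s N t (D.terminal t) n t = D.energy s N t := by
  refine Finset.sum_congr rfl fun n hn => ?_
  rw [D.dualEnergy_self n (by simpa [Nat.lt_succ_iff] using hn)]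
  refine Finset.sum_congr rfl fun α _ => ?_
  have := multiFactorial_pos α
  rw [terminal, norm_smul, Real.norm_of_nonneg this.le]
  field_simp

theorem energy_eq (t : ℝ) : D.energy s (N + 1) t
    = inner ℝ D.x₀ (D.dual s (N + 1) t (D.terminal t) 0 0)
      + ∫ r in (0 : ℝ)..t, (inner ℝ (D.f r) (D.dual s (N + 1) t (D.terminal t) 0 r)
        + ∑ p ∈ s, D.m p r * inner ℝ (D.g p.2 r)
            (D.dual s (N + 1) t (D.terminal t) (Finsupp.single p 1) r)) := by
  have h := (D.isPrimitive_pairing s N t (D.terminal t)).sub_eq 0 t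
  rw [← h]
  have h1 : ∑ n ∈ Finset.range (N + 2), ∑ α ∈ s.finsuppAntidiag n,
      inner ℝ (D.coeff α t) (D.dual s (N + 1) t (D.terminal t) α t) = D.energy s (N + 1) t := by
    refine Finset.sum_congr rfl fun n hn => Finset.sum_congr rfl fun α hα => ?_
    rw [(D.dual_spec α).1 (by
      rw [degree_of_mem_finsuppAntidiag hα]; have := Finset.mem_range.1 hn; omega),
      terminal, real_inner_smul_right, real_inner_self_eq_norm_sq]
  have h2 : ∑ n ∈ Finset.range (N + 2), ∑ α ∈ s.finsuppAntidiag n,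
      inner ℝ (D.coeff α 0) (D.dual s (N + 1) t (D.terminal t) α 0)
      = inner ℝ D.x₀ (D.dual s (N + 1) t (D.terminal t) 0 0) := by
    rw [Finset.sum_range_succ', Finset.sum_eq_zero, zero_add]
    · simp [(D.coeff_spec 0).1]
    · refine fun n _ => Finset.sum_eq_zero fun α hα => ?_
      rw [(D.coeff_spec α).1, if_neg, inner_zero_left]
      rintro rfl
      have := degree_of_mem_finsuppAntidiag hα
      simp at this
  rw [h1, h2]
  abel

end EvolutionData

end ColoredChaos

/-! ### The energy estimate. -/

namespace ColoredChaos

theorem mul_le_young {x y θ : ℝ} (hθ : 0 < θ) : x * y ≤ θ / 2 * x ^ 2 + (2 * θ)⁻¹ * y ^ 2 := by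
  have h : θ / 2 * x ^ 2 + (2 * θ)⁻¹ * y ^ 2 - x * y = (2 * θ)⁻¹ * (θ * x - y) ^ 2 := by
    field_simp; ring
  have h2 : 0 ≤ (2 * θ)⁻¹ * (θ * x - y) ^ 2 := by positivity
  linarith

namespace EvolutionData

variable {X Y : Type*} [NormedAddCommGroup X] [InnerProductSpace ℝ X]
  [NormedAddCommGroup Y] [InnerProductSpace ℝ Y] (D : EvolutionData X Y)
  {s : Finset (ℕ × ℕ)} {N : ℕ} {t : ℝ}

/-- Cauchy–Schwarz for each noise, with weights k and k⁻¹ that reproduce the input size of g on one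
side and the degree-zero noise form on the other. -/
theorem sum_noise_inner_le {θ : ℝ} (hθ : 0 < θ) (r : ℝ) (φ : ℕ × ℕ → Y) :
    ∑ p ∈ s, D.m p r * inner ℝ (D.g p.2 r) (φ p)
      ≤ θ / 2 * (∑ ℓ ∈ s.image Prod.snd, D.k ℓ ^ 2 * ‖D.g ℓ r‖ ^ 2)
        + (2 * θ)⁻¹ * ∑ ℓ ∈ s.image Prod.snd, (D.k ℓ ^ 2)⁻¹ *
            ‖∑ p ∈ s with p.2 = ℓ, D.m p r • φ p‖ ^ 2 := by
  rw [sum_fiber, Finset.mul_sum, Finset.mul_sum, ← Finset.sum_add_distrib]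
  refine Finset.sum_le_sum fun ℓ _ => ?_
  have h1 : ∑ p ∈ s with p.2 = ℓ, D.m p r * inner ℝ (D.g p.2 r) (φ p)
      = inner ℝ (D.g ℓ r) (∑ p ∈ s with p.2 = ℓ, D.m p r • φ p) := by
    rw [inner_sum]
    refine Finset.sum_congr rfl fun p hp => ?_
    rw [(Finset.mem_filter.1 hp).2, real_inner_smul_right]
  rw [h1]
  by_cases hk : D.k ℓ = 0
  · rw [Finset.sum_eq_zero fun p hp => by
      rw [D.m_eq_zero p r (by rw [(Finset.mem_filter.1 hp).2, hk]), zero_smul]]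
    simp [hk]
  · have h2 := mul_le_young (x := D.k ℓ * ‖D.g ℓ r‖)
      (y := (D.k ℓ)⁻¹ * ‖∑ p ∈ s with p.2 = ℓ, D.m p r • φ p‖) hθ
    have h3 := real_inner_le_norm (D.g ℓ r) (∑ p ∈ s with p.2 = ℓ, D.m p r • φ p)
    rw [mul_pow, mul_pow, inv_pow] at h2
    refine h3.trans (le_trans (le_of_eq ?_) h2)
    field_simp

theorem energy_nonneg (t : ℝ) : 0 ≤ D.energy s N t :=
  Finset.sum_nonneg fun _ _ => Finset.sum_nonneg fun α _ =>
    mul_nonneg (multiFactorial_pos α).le (sq_nonneg _)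

variable [CompleteSpace Y]

/-- The energy estimate for the S-system. -/
theorem energy_le (ht : 0 ≤ t) :
    D.energy s (N + 1) t ≤ 3 * Real.exp ((D.cA + D.cB) * t) *
      (‖D.x₀‖ ^ 2 + D.δ⁻¹ * (∫ r in (0 : ℝ)..t, D.fBound r ^ 2)
        + ∑ ℓ ∈ s.image Prod.snd, D.k ℓ ^ 2 * ∫ r in (0 : ℝ)..t, ‖D.g ℓ r‖ ^ 2) := by
  set E := Real.exp ((D.cA + D.cB) * t) with hE
  have hEpos : 0 < E := Real.exp_pos _
  have hδ := D.δ_pos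
  have hEn := D.energy_nonneg (s := s) (N := N + 1) t
  set φ : MultiIndex → ℝ → Y := D.dual s (N + 1) t (D.terminal t) with hφ
  have b1 := D.norm_dual_zero_sq_add_le (s := s) (N := N + 1) (Φ := D.terminal t) ht
  have b2 := D.integral_noise_dual_le (s := s) (N := N + 1) (Φ := D.terminal t) ht
  rw [sum_dualEnergy_terminal] at b1 b2
  have heq := D.energy_eq (s := s) (N := N) t
  rw [← hφ] at b1 b2 heq
  rw [← hE] at b1 b2
  set En := D.energy s (N + 1) t with hEn'
  have i1 : IntervalIntegrable (fun r => D.fBound r ^ 2) volume 0 t :=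
    D.memLp_fBound.integrable_sq.intervalIntegrable
  have i2 : IntervalIntegrable (fun r => ‖D.j (φ 0 r)‖ ^ 2) volume 0 t := by
    have := D.continuous_dual (s := s) (N := N + 1) (t₁ := t) (Φ := D.terminal t) 0
    exact Continuous.intervalIntegrable (by fun_prop) _ _
  have i3 : ∀ ℓ, IntervalIntegrable (fun r => ‖D.g ℓ r‖ ^ 2) volume 0 t := fun ℓ =>
    ((D.memLp_g ℓ).integrable_norm_pow two_ne_zero).intervalIntegrable
  have i4 : IntervalIntegrable (fun r => ∑ ℓ ∈ s.image Prod.snd, (D.k ℓ ^ 2)⁻¹ *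
        ‖∑ p ∈ s with p.2 = ℓ, D.m p r • φ (Finsupp.single p 1) r‖ ^ 2) volume 0 t := by
    have := D.intervalIntegrable_noise_dual (s := s) (N := N + 1) (t₁ := t) (Φ := D.terminal t) 0 t
    simpa only [noiseForm_zero] using this
  have j1 : IntervalIntegrable (fun r => inner ℝ (D.f r) (φ 0 r)) volume 0 t :=
    IsPrimitive.intervalIntegrable_bilin (innerForm Y) (D.memLp_f.intervalIntegrable_two 0 t)
      (D.continuous_dual 0)
  have j2 : IntervalIntegrable (fun r => ∑ p ∈ s, D.m p r * inner ℝ (D.g p.2 r)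
      (φ (Finsupp.single p 1) r)) volume 0 t := by
    refine intervalIntegrable_finset_sum fun p _ => ?_
    have := IsPrimitive.intervalIntegrable_bilin (innerForm Y)
      (intervalIntegrable_smul_memLp (D.memLp_m p) (D.memLp_g p.2) 0 t)
      (D.continuous_dual (s := s) (N := N + 1) (t₁ := t) (Φ := D.terminal t) (Finsupp.single p 1))
    simpa only [map_smul, smul_apply, smul_eq_mul, innerForm_apply] using this
  -- The Young parameters 3E/δ here and 3E in `c2` and `c3` make the adjoint terms at most En/6 from
  -- `b1` (used for `c1` and `c3` together) and En/6 from `b2`. This leaves (2/3) En ≤ (3E/2) times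
  -- the input, that is the factor 9/4, below the stated 3.
  have c1 : ∫ r in (0 : ℝ)..t, inner ℝ (D.f r) (φ 0 r)
      ≤ 3 * E / (2 * D.δ) * (∫ r in (0 : ℝ)..t, D.fBound r ^ 2)
        + D.δ / (6 * E) * ∫ r in (0 : ℝ)..t, ‖D.j (φ 0 r)‖ ^ 2 := by
    rw [← intervalIntegral.integral_const_mul, ← intervalIntegral.integral_const_mul,
      ← intervalIntegral.integral_add (i1.const_mul _) (i2.const_mul _)]
    refine intervalIntegral.integral_mono_on ht j1 ((i1.const_mul _).add (i2.const_mul _))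
      fun r _ => ?_
    have h1 := mul_le_young (x := D.fBound r) (y := ‖D.j (φ 0 r)‖)
      (θ := 3 * E / D.δ) (by positivity)
    refine (D.inner_f_le r _).trans (h1.trans (le_of_eq ?_))
    field_simp
    ring
  have c2 : ∫ r in (0 : ℝ)..t, ∑ p ∈ s, D.m p r * inner ℝ (D.g p.2 r) (φ (Finsupp.single p 1) r)
      ≤ 3 * E / 2 * (∑ ℓ ∈ s.image Prod.snd, D.k ℓ ^ 2 * ∫ r in (0 : ℝ)..t, ‖D.g ℓ r‖ ^ 2)
        + (6 * E)⁻¹ * ∫ r in (0 : ℝ)..t, (∑ ℓ ∈ s.image Prod.snd, (D.k ℓ ^ 2)⁻¹ *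
            ‖∑ p ∈ s with p.2 = ℓ, D.m p r • φ (Finsupp.single p 1) r‖ ^ 2) := by
    have i5 : IntervalIntegrable (fun r => ∑ ℓ ∈ s.image Prod.snd, D.k ℓ ^ 2 * ‖D.g ℓ r‖ ^ 2)
        volume 0 t := intervalIntegrable_finset_sum fun ℓ _ => (i3 ℓ).const_mul _
    have e : ∑ ℓ ∈ s.image Prod.snd, D.k ℓ ^ 2 * ∫ r in (0 : ℝ)..t, ‖D.g ℓ r‖ ^ 2
        = ∫ r in (0 : ℝ)..t, ∑ ℓ ∈ s.image Prod.snd, D.k ℓ ^ 2 * ‖D.g ℓ r‖ ^ 2 := by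
      rw [intervalIntegral.integral_finsetSum fun ℓ _ => (i3 ℓ).const_mul _]
      simp only [intervalIntegral.integral_const_mul]
    rw [e, ← intervalIntegral.integral_const_mul, ← intervalIntegral.integral_const_mul,
      ← intervalIntegral.integral_add (i5.const_mul _) (i4.const_mul _)]
    refine intervalIntegral.integral_mono_on ht j2 ((i5.const_mul _).add (i4.const_mul _))
      fun r _ => ?_
    refine (D.sum_noise_inner_le (θ := 3 * E) (by positivity) r
      fun p => φ (Finsupp.single p 1) r).trans (le_of_eq ?_)
    ring
  have c3 : inner ℝ D.x₀ (φ 0 0) ≤ 3 * E / 2 * ‖D.x₀‖ ^ 2 + (6 * E)⁻¹ * ‖φ 0 0‖ ^ 2 := by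
    have h1 := mul_le_young (x := ‖D.x₀‖) (y := ‖φ 0 0‖) (θ := 3 * E) (by positivity)
    refine (real_inner_le_norm _ _).trans (h1.trans (le_of_eq ?_))
    ring
  rw [intervalIntegral.integral_add j1 j2] at heq
  have k1 : (6 * E)⁻¹ * (‖φ 0 0‖ ^ 2 + D.δ * ∫ r in (0 : ℝ)..t, ‖D.j (φ 0 r)‖ ^ 2) ≤ En / 6 := by
    calc _ ≤ (6 * E)⁻¹ * (E * En) := by gcongr
      _ = En / 6 := by field_simp
  have k2 : (6 * E)⁻¹ * (∫ r in (0 : ℝ)..t, (∑ ℓ ∈ s.image Prod.snd, (D.k ℓ ^ 2)⁻¹ *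
      ‖∑ p ∈ s with p.2 = ℓ, D.m p r • φ (Finsupp.single p 1) r‖ ^ 2)) ≤ En / 6 := by
    calc _ ≤ (6 * E)⁻¹ * (E * En) := by gcongr
      _ = En / 6 := by field_simp
  have k3 : D.δ / (6 * E) * ∫ r in (0 : ℝ)..t, ‖D.j (φ 0 r)‖ ^ 2
      = (6 * E)⁻¹ * (D.δ * ∫ r in (0 : ℝ)..t, ‖D.j (φ 0 r)‖ ^ 2) := by
    field_simp
  have k4 : 3 * E / (2 * D.δ) * (∫ r in (0 : ℝ)..t, D.fBound r ^ 2)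
      = 3 * E / 2 * (D.δ⁻¹ * ∫ r in (0 : ℝ)..t, D.fBound r ^ 2) := by
    field_simp
  rw [mul_add] at k1
  have k5 : 0 ≤ E * (‖D.x₀‖ ^ 2 + D.δ⁻¹ * (∫ r in (0 : ℝ)..t, D.fBound r ^ 2)
        + ∑ ℓ ∈ s.image Prod.snd, D.k ℓ ^ 2 * ∫ r in (0 : ℝ)..t, ‖D.g ℓ r‖ ^ 2) := by
    have p1 : 0 ≤ ∫ r in (0 : ℝ)..t, D.fBound r ^ 2 :=
      intervalIntegral.integral_nonneg ht fun r _ => sq_nonneg _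
    have p2 : 0 ≤ ∑ ℓ ∈ s.image Prod.snd, D.k ℓ ^ 2 * ∫ r in (0 : ℝ)..t, ‖D.g ℓ r‖ ^ 2 :=
      Finset.sum_nonneg fun ℓ _ => mul_nonneg (sq_nonneg _)
        (intervalIntegral.integral_nonneg ht fun r _ => sq_nonneg _)
    positivity
  rw [k3] at c1
  rw [k4] at c1
  generalize ∫ r in (0 : ℝ)..t, D.fBound r ^ 2 = I1 at *
  generalize (∑ ℓ ∈ s.image Prod.snd, D.k ℓ ^ 2 * ∫ r in (0 : ℝ)..t, ‖D.g ℓ r‖ ^ 2) = I2 at *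
  nlinarith

theorem energy_le_of_eq_zero (ht : 0 ≤ t) (hf : D.f =ᵐ[volume] 0)
    (hg : ∀ ℓ, D.g ℓ =ᵐ[volume] 0) :
    D.energy s (N + 1) t ≤ Real.exp ((D.cA + D.cB) * t) * ‖D.x₀‖ ^ 2 := by
  set E := Real.exp ((D.cA + D.cB) * t) with hE
  have hEpos : 0 < E := Real.exp_pos _
  have b1 := D.norm_dual_zero_sq_add_le (s := s) (N := N + 1) (Φ := D.terminal t) ht
  rw [sum_dualEnergy_terminal, ← hE] at b1
  have heq := D.energy_eq (s := s) (N := N) t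
  have h0 : ∫ r in (0 : ℝ)..t, (inner ℝ (D.f r) (D.dual s (N + 1) t (D.terminal t) 0 r)
        + ∑ p ∈ s, D.m p r * inner ℝ (D.g p.2 r)
            (D.dual s (N + 1) t (D.terminal t) (Finsupp.single p 1) r)) = 0 := by
    refine (intervalIntegral.integral_congr_ae (g := fun _ => 0) ?_).trans (by simp)
    filter_upwards [hf, ae_all_iff.2 hg] with r h1 h2 _
    rw [h1, Finset.sum_eq_zero fun p _ => by rw [h2 p.2]; simp]
    simp
  rw [h0, add_zero] at heq
  -- With a single term to absorb, the parameter E gives En ≤ (E/2)‖x₀‖² + En/2, hence the constant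
  -- 1.
  have h1 := mul_le_young (x := ‖D.x₀‖) (y := ‖D.dual s (N + 1) t (D.terminal t) 0 0‖) hEpos
  have h2 := real_inner_le_norm D.x₀ (D.dual s (N + 1) t (D.terminal t) 0 0)
  have h3 : 0 ≤ D.δ * ∫ r in (0 : ℝ)..t, ‖D.j (D.dual s (N + 1) t (D.terminal t) 0 r)‖ ^ 2 :=
    mul_nonneg D.δ_pos.le (intervalIntegral.integral_nonneg ht fun r _ => sq_nonneg _)
  have h4 : (2 * E)⁻¹ * ‖D.dual s (N + 1) t (D.terminal t) 0 0‖ ^ 2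
      ≤ (2 * E)⁻¹ * (E * D.energy s (N + 1) t) := by
    gcongr; linarith
  have h5 : (2 * E)⁻¹ * (E * D.energy s (N + 1) t) = D.energy s (N + 1) t / 2 := by field_simp
  linarith

end EvolutionData

end ColoredChaos

/-! ### Bounds for the smoothed coefficients. -/

namespace ColoredChaos

namespace EvolutionData

variable {X Y : Type*} [NormedAddCommGroup X] [InnerProductSpace ℝ X]
  [NormedAddCommGroup Y] [InnerProductSpace ℝ Y] [CompleteSpace Y] (D : EvolutionData X Y)

theorem one_le_multiFactorial {κ : Type*} (α : κ →₀ ℕ) : 1 ≤ multiFactorial α := by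
  refine Finset.prod_induction _ (fun x : ℝ => 1 ≤ x) (fun _ _ => one_le_mul_of_one_le_of_one_le)
    le_rfl fun i _ => ?_
  exact Nat.one_le_cast.2 (Nat.factorial_pos _)

/-- A bound for the smoothing of the coefficients. -/
theorem integral_norm_j_coeff_sq_le {R t : ℝ} (ht : 0 ≤ t)
    (hR : ∀ β, ∀ r ∈ Set.Icc 0 t, ‖D.coeff β r‖ ≤ R) {bB : ℕ → ℝ} (hb : ∀ ℓ, ‖D.b ℓ‖ ≤ bB ℓ)
    {gB : ℕ → ℝ → ℝ} (hgB : ∀ ℓ, MemLp (gB ℓ) 2 volume) (hg : ∀ ℓ r, ‖D.g ℓ r‖ ≤ gB ℓ r)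
    (α : MultiIndex) :
    D.δ / 2 * ∫ r in (0 : ℝ)..t, ‖D.j (D.coeff α r)‖ ^ 2 ≤ R ^ 2 + ∫ r in (0 : ℝ)..t,
      (D.cA * R ^ 2 + 2 / D.δ * D.fBound r ^ 2
        + ∑ p ∈ α.support, 2 * R * (bB p.2 * R * |D.m p r| + |D.m p r| * gB p.2 r)) := by
  have hR0 : 0 ≤ R := (norm_nonneg _).trans (hR 0 0 ⟨le_rfl, ht⟩)
  have hδ := D.δ_pos
  have hbB : ∀ ℓ, 0 ≤ bB ℓ := fun ℓ => (norm_nonneg _).trans (hb ℓ)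
  have hgB0 : ∀ ℓ r, 0 ≤ gB ℓ r := fun ℓ r => (norm_nonneg _).trans (hg ℓ r)
  have hint : IntervalIntegrable (fun r => D.cA * R ^ 2 + 2 / D.δ * D.fBound r ^ 2
        + ∑ p ∈ α.support, 2 * R * (bB p.2 * R * |D.m p r| + |D.m p r| * gB p.2 r))
        volume 0 t := by
    refine (intervalIntegrable_const.add
      (D.memLp_fBound.integrable_sq.intervalIntegrable.const_mul _)).add
      (intervalIntegrable_finset_sum fun p _ => IntervalIntegrable.const_mul
        (((D.intervalIntegrable_m p 0 t).abs.const_mul _).add ?_) _)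
    exact ((D.memLp_m p).abs.integrable_mul (hgB p.2)).intervalIntegrable
  have hi2 : IntervalIntegrable (fun r => D.δ / 2 * ‖D.j (D.coeff α r)‖ ^ 2) volume 0 t := by
    have := D.continuous_coeff α
    exact Continuous.intervalIntegrable (by fun_prop) _ _
  -- Energy identity for a single coefficient, negated so that `IsPrimitive.mono` bounds the
  -- dissipation from above. The noise forcing contains only coefficients already bounded by R; the
  -- term with f takes half of δ ‖j y‖².
  have hprim := ((D.isPrimitive_coeff α).bilin (innerForm Y) (D.isPrimitive_coeff α)).const_smul
    (-1 : ℝ)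
  have h := hprim.mono ht (hi2.sub hint) fun r hr => ?_
  · rw [intervalIntegral.integral_sub hi2 hint, intervalIntegral.integral_const_mul] at h
    simp only [innerForm_apply, real_inner_self_eq_norm_sq, smul_eq_mul] at h
    have h0 : ‖D.coeff α 0‖ ^ 2 ≤ R ^ 2 := by
      have := hR α 0 ⟨le_rfl, ht⟩
      gcongr
    have ht' : 0 ≤ ‖D.coeff α t‖ ^ 2 := sq_nonneg _
    linarith
  · set y := D.coeff α r with hy
    have hyR : ‖y‖ ≤ R := hR α r hr
    have e1 : inner ℝ (D.forcing α r) y ≤ D.δ / 4 * ‖D.j y‖ ^ 2 + 1 / D.δ * D.fBound r ^ 2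
        + ∑ p ∈ α.support, R * (bB p.2 * R * |D.m p r| + |D.m p r| * gB p.2 r) := by
      rw [forcing, inner_add_left, sum_inner]
      refine add_le_add ?_ (Finset.sum_le_sum fun p _ => ?_)
      · have h1 : inner ℝ (if α = 0 then D.f r else 0) y ≤ |D.fBound r| * ‖D.j y‖ := by
          split_ifs
          · exact (D.inner_f_le r y).trans (by gcongr; exact le_abs_self _)
          · rw [inner_zero_left]; positivity
        have h2 := mul_le_young (x := |D.fBound r|) (y := ‖D.j y‖) (θ := 2 / D.δ) (by positivity)
        rw [sq_abs] at h2
        refine h1.trans (h2.trans (le_of_eq ?_))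
        field_simp
        ring
      · refine (real_inner_le_norm _ _).trans ?_
        have h1 : ‖D.m p r • (D.b p.2 (D.coeff (α - Finsupp.single p 1) r)
            + if α - Finsupp.single p 1 = 0 then D.g p.2 r else 0)‖
            ≤ |D.m p r| * (bB p.2 * R + gB p.2 r) := by
          rw [norm_smul, Real.norm_eq_abs]
          gcongr
          refine (norm_add_le _ _).trans (add_le_add ?_ ?_)
          · refine ((D.b p.2).le_opNorm _).trans ?_
            have := hR (α - Finsupp.single p 1) r hr
            have := hb p.2
            have := hbB p.2
            gcongr
          · split_ifs
            · exact hg _ _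
            · simpa using hgB0 _ _
        have h2 := hbB p.2
        have h3 := hgB0 p.2 r
        calc _ ≤ (|D.m p r| * (bB p.2 * R + gB p.2 r)) * R := by gcongr
          _ = _ := by ring
    have e2 := D.parabolic y
    have e3 : ‖y‖ ^ 2 ≤ R ^ 2 := by gcongr
    have e4 := mul_le_mul_of_nonneg_left e3 D.cA_nonneg
    have e5 : ∑ p ∈ α.support, 2 * R * (bB p.2 * R * |D.m p r| + |D.m p r| * gB p.2 r)
        = 2 * ∑ p ∈ α.support, R * (bB p.2 * R * |D.m p r| + |D.m p r| * gB p.2 r) := by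
      rw [Finset.mul_sum]; exact Finset.sum_congr rfl fun p _ => by ring
    have e6 : 2 / D.δ * D.fBound r ^ 2 = 2 * (1 / D.δ * D.fBound r ^ 2) := by ring
    simp only [innerForm_apply, smul_eq_mul]
    rw [real_inner_comm (D.a y + D.forcing α r) y, inner_add_left, e5, e6]
    linarith

end EvolutionData

end ColoredChaos

namespace ColoredChaos

/-! ### Regularization of a parabolic equation -/

/-- A parabolic equation in the normal triple with the inclusion `ι`, driven by a colored noise
whose representation operators take the basis functions to the functions `m p`. -/
structure ParabolicData (X H : Type*) [NormedAddCommGroup X] [InnerProductSpace ℝ X]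
    [NormedAddCommGroup H] [InnerProductSpace ℝ H] where
  /-- the inclusion -/
  ι : X →L[ℝ] H
  /-- the drift operator -/
  A : X →L[ℝ] StrongDual ℝ X
  /-- the diffusion operators -/
  B : ℕ → H →L[ℝ] H
  /-- the initial value -/
  u₀ : H
  /-- the free term of the drift -/
  F : ℝ → StrongDual ℝ X
  /-- the free terms of the diffusion -/
  G : ℕ → ℝ → H
  /-- the images of the basis functions -/
  m : ℕ × ℕ → ℝ → ℝ
  /-- the norms of the representation operators -/
  k : ℕ → ℝ
  /-- the ellipticity constant -/
  δ : ℝ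
  /-- the constant in the parabolicity condition -/
  cA : ℝ
  /-- a bound for the diffusion operators -/
  cB : ℝ
  δ_pos : 0 < δ
  cA_nonneg : 0 ≤ cA
  parabolic : ∀ v, 2 * A v v + δ * ‖v‖ ^ 2 ≤ cA * ‖ι v‖ ^ 2
  sum_B_le : ∀ Λ : Finset ℕ, ∑ ℓ ∈ Λ, k ℓ ^ 2 * ‖B ℓ‖ ^ 2 ≤ cB
  memLp_F : MemLp F 2 volume
  memLp_G : ∀ ℓ, MemLp (G ℓ) 2 volume
  memLp_m : ∀ p, MemLp (m p) 2 volume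
  m_eq_zero : ∀ p r, k p.2 = 0 → m p r = 0
  bessel : ∀ (s : Finset (ℕ × ℕ)) (c : ℕ × ℕ → ℝ) (ℓ : ℕ),
    ∫ r, (∑ p ∈ s with p.2 = ℓ, c p * m p r) ^ 2 ≤ k ℓ ^ 2 * ∑ p ∈ s with p.2 = ℓ, c p ^ 2

section Regularization

variable {X H : Type*} [NormedAddCommGroup X] [InnerProductSpace ℝ X]
  [NormedAddCommGroup H] [InnerProductSpace ℝ H] (ι : X →L[ℝ] H) (ε : ℝ)

/-- The continuous linear map whose kernel is the space `X` with the norm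
`(ε ‖v‖_X² + ‖v‖_H²)^(1/2)`. -/
noncomputable def regMap : WithLp 2 (X × H) →L[ℝ] H :=
  -- For ε > 0 the kernel consists of the pairs (√ε v, ι v). As a closed subspace of a Hilbert sum
  -- it is complete, and no second norm has to be put on X.
  √ε • WithLp.sndL 2 ℝ X H - ι ∘L WithLp.fstL 2 ℝ X H

/-- The space `X` with the norm `(ε ‖v‖_X² + ‖v‖_H²)^(1/2)`. -/
abbrev RegSpace : Type _ := LinearMap.ker (regMap ι ε).toLinearMap

/-- The identification of `RegSpace ι ε` with `X`. -/
noncomputable def regToX : RegSpace ι ε →L[ℝ] X :=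
  (√ε)⁻¹ • (WithLp.fstL 2 ℝ X H ∘L (LinearMap.ker (regMap ι ε).toLinearMap).subtypeL)

/-- The identification of `X` with `RegSpace ι ε`. -/
noncomputable def xToReg (v : X) : RegSpace ι ε :=
  ⟨WithLp.toLp 2 (√ε • v, ι v), by simp [regMap]⟩

variable {ε} (hε : 0 < ε)

theorem fst_eq (hε : 0 < ε) (y : RegSpace ι ε) : y.1.fst = √ε • regToX ι ε y := by
  have : √ε ≠ 0 := (Real.sqrt_pos.2 hε).ne'
  simp [regToX, smul_smul, this]

theorem snd_eq (hε : 0 < ε) (y : RegSpace ι ε) : y.1.snd = ι (regToX ι ε y) := by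
  have h0 : √ε ≠ 0 := (Real.sqrt_pos.2 hε).ne'
  have h := y.2
  rw [LinearMap.mem_ker] at h
  have h1 : √ε • y.1.snd = ι y.1.fst := by
    have : √ε • y.1.snd - ι y.1.fst = 0 := h
    exact sub_eq_zero.1 this
  rw [fst_eq ι hε, map_smul] at h1
  exact smul_right_injective H h0 h1

theorem regToX_xToReg (hε : 0 < ε) (v : X) : regToX ι ε (xToReg ι ε v) = v := by
  have : √ε ≠ 0 := (Real.sqrt_pos.2 hε).ne'
  simp [regToX, xToReg, smul_smul, this]

theorem reg_inner (hε : 0 < ε) (y z : RegSpace ι ε) : inner ℝ y z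
    = inner ℝ (ι (regToX ι ε y)) (ι (regToX ι ε z))
      + ε * inner ℝ (regToX ι ε y) (regToX ι ε z) := by
  rw [Submodule.coe_inner, WithLp.prod_inner_apply]
  change inner ℝ y.1.fst z.1.fst + inner ℝ y.1.snd z.1.snd = _
  rw [fst_eq ι hε, fst_eq ι hε, snd_eq ι hε, snd_eq ι hε, real_inner_smul_left,
    real_inner_smul_right, ← mul_assoc, Real.mul_self_sqrt hε.le]
  ring

theorem reg_norm_sq (hε : 0 < ε) (y : RegSpace ι ε) :
    ‖y‖ ^ 2 = ‖ι (regToX ι ε y)‖ ^ 2 + ε * ‖regToX ι ε y‖ ^ 2 := by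
  rw [← real_inner_self_eq_norm_sq, reg_inner ι hε, real_inner_self_eq_norm_sq,
    real_inner_self_eq_norm_sq]

theorem norm_incl_le (hε : 0 < ε) (y : RegSpace ι ε) : ‖ι (regToX ι ε y)‖ ≤ ‖y‖ := by
  refine le_of_sq_le_sq ?_ (norm_nonneg _)
  rw [reg_norm_sq ι hε]
  have := mul_nonneg hε.le (sq_nonneg ‖regToX ι ε y‖)
  linarith

variable [CompleteSpace X] [CompleteSpace H] (ε)

/-- The Riesz representation of the elements of the dual of `X`. -/
noncomputable def regRiesz : StrongDual ℝ X →L[ℝ] RegSpace ι ε :=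
  (InnerProductSpace.toDual ℝ (RegSpace ι ε)).symm.toContinuousLinearEquiv.toContinuousLinearMap ∘L
    ContinuousLinearMap.precomp ℝ (regToX ι ε)

theorem inner_regRiesz (ψ : StrongDual ℝ X) (y : RegSpace ι ε) :
    inner ℝ (regRiesz ι ε ψ) y = ψ (regToX ι ε y) :=
  InnerProductSpace.toDual_symm_apply (𝕜 := ℝ)

theorem norm_le_of_inner_le {E : Type*} [NormedAddCommGroup E] [InnerProductSpace ℝ E] {y : E}
    {C : ℝ} (hC : 0 ≤ C) (h : inner ℝ y y ≤ C * ‖y‖) : ‖y‖ ≤ C := by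
  rw [real_inner_self_eq_norm_sq, sq] at h
  rcases (norm_nonneg y).eq_or_lt with h0 | h0
  · rwa [← h0]
  · exact le_of_mul_le_mul_right h h0

variable {ε}

/-- Elements of H are represented with norm at most one times theirs, whatever ε is, because the new
norm dominates the norm of H. This keeps all constants of the regularized equation independent of ε.
-/
theorem norm_regRiesz_toDual_le (hε : 0 < ε) (x : H) : ‖regRiesz ι ε (toDual ι x)‖ ≤ ‖x‖ := by
  refine norm_le_of_inner_le (norm_nonneg _) ?_
  rw [inner_regRiesz, toDual_apply]
  exact (real_inner_le_norm _ _).trans (by gcongr; exact norm_incl_le ι hε _)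

end Regularization

namespace ParabolicData

variable {X H : Type*} [NormedAddCommGroup X] [InnerProductSpace ℝ X] [CompleteSpace X]
  [NormedAddCommGroup H] [InnerProductSpace ℝ H] [CompleteSpace H] (E : ParabolicData X H)

theorem norm_reg_b_le {ε : ℝ} (hε : 0 < ε) (ℓ : ℕ) :
    ‖regRiesz E.ι ε ∘L toDual E.ι ∘L E.B ℓ ∘L E.ι ∘L regToX E.ι ε‖ ≤ ‖E.B ℓ‖ := by
  refine ContinuousLinearMap.opNorm_le_bound _ (norm_nonneg _) fun y => ?_
  refine (norm_regRiesz_toDual_le E.ι hε _).trans (((E.B ℓ).le_opNorm _).trans ?_)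
  gcongr
  exact norm_incl_le E.ι hε y

/-- The regularization of a parabolic equation. -/
noncomputable def regularize {ε : ℝ} (hε : 0 < ε) : EvolutionData X (RegSpace E.ι ε) where
  a := regRiesz E.ι ε ∘L E.A ∘L regToX E.ι ε
  b ℓ := regRiesz E.ι ε ∘L toDual E.ι ∘L E.B ℓ ∘L E.ι ∘L regToX E.ι ε
  j := regToX E.ι ε
  x₀ := regRiesz E.ι ε (toDual E.ι E.u₀)
  f r := regRiesz E.ι ε (E.F r)
  fBound r := ‖E.F r‖
  g ℓ r := regRiesz E.ι ε (toDual E.ι (E.G ℓ r))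
  m := E.m
  k := E.k
  δ := E.δ
  cA := E.cA
  cB := E.cB
  δ_pos := E.δ_pos
  cA_nonneg := E.cA_nonneg
  parabolic y := by
    have h := E.parabolic (regToX E.ι ε y)
    have h2 : ‖E.ι (regToX E.ι ε y)‖ ^ 2 ≤ ‖y‖ ^ 2 := by
      have := norm_incl_le E.ι hε y
      gcongr
    have h3 := mul_le_mul_of_nonneg_left h2 E.cA_nonneg
    change 2 * inner ℝ (regRiesz E.ι ε (E.A (regToX E.ι ε y))) y + _ ≤ _
    rw [inner_regRiesz]
    linarith
  sum_b_le Λ := by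
    refine le_trans (Finset.sum_le_sum fun ℓ _ => ?_) (E.sum_B_le Λ)
    have := E.norm_reg_b_le hε ℓ
    gcongr
  memLp_f := (regRiesz E.ι ε).comp_memLp' E.memLp_F
  memLp_fBound := E.memLp_F.norm
  inner_f_le r y := by
    rw [inner_regRiesz]
    exact (le_abs_self _).trans ((E.F r).le_opNorm _)
  memLp_g ℓ := (regRiesz E.ι ε ∘L toDual E.ι).comp_memLp' (E.memLp_G ℓ)
  memLp_m := E.memLp_m
  m_eq_zero := E.m_eq_zero
  bessel := E.bessel

/-- The right-hand side of the equation for the coefficient with index `α` (normalized by the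
factor `1 / √α!`), tested with `v`. -/
noncomputable def drift (w : MultiIndex → ℝ → X) (α : MultiIndex) (v : X) (r : ℝ) : ℝ :=
  E.A (w α r) v + (if α = 0 then E.F r v else 0)
    + ∑ p ∈ α.support, E.m p r * (inner ℝ (E.B p.2 (E.ι (w (α - Finsupp.single p 1) r))) (E.ι v)
      + if α - Finsupp.single p 1 = 0 then inner ℝ (E.G p.2 r) (E.ι v) else 0)

variable {ε : ℝ} (hε : 0 < ε)

/-- The coefficients of the solution of the regularized equation. -/
noncomputable def regCoeff (α : MultiIndex) (r : ℝ) : X :=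
  regToX E.ι ε ((E.regularize hε).coeff α r)

theorem continuous_regCoeff (α : MultiIndex) : Continuous (E.regCoeff hε α) :=
  (regToX E.ι ε).continuous.comp ((E.regularize hε).continuous_coeff α)

/-- Every term on the right was transported by Riesz's theorem for the new inner product, so testing
with v recovers the original expression. The regularization survives only in the term ε (y, v)_X on
the left. -/
theorem regCoeff_eq (α : MultiIndex) (t : ℝ) (v : X) :
    inner ℝ (E.ι (E.regCoeff hε α t)) (E.ι v) + ε * inner ℝ (E.regCoeff hε α t) v
      = (if α = 0 then inner ℝ E.u₀ (E.ι v) else 0)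
        + ∫ r in (0 : ℝ)..t, E.drift (E.regCoeff hε) α v r := by
  have h := ((E.regularize hε).isPrimitive_coeff α).clm_comp
    (innerSL ℝ (xToReg E.ι ε v)) |>.sub_eq 0 t
  simp only [innerSL_apply_apply] at h
  rw [sub_eq_iff_eq_add', ((E.regularize hε).coeff_spec α).1] at h
  rw [real_inner_comm, reg_inner E.ι hε, regToX_xToReg E.ι hε] at h
  refine h.trans ?_
  congr 1
  · split_ifs
    · rw [real_inner_comm]
      change inner ℝ (regRiesz E.ι ε (toDual E.ι E.u₀)) (xToReg E.ι ε v) = _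
      rw [inner_regRiesz, regToX_xToReg E.ι hε, toDual_apply]
    · rw [inner_zero_right]
  · refine intervalIntegral.integral_congr fun r _ => ?_
    simp only [EvolutionData.forcing, drift]
    rw [real_inner_comm, inner_add_left, inner_add_left, sum_inner, ← add_assoc]
    congr 1
    · congr 1
      · change inner ℝ (regRiesz E.ι ε (E.A (E.regCoeff hε α r))) (xToReg E.ι ε v) = _
        rw [inner_regRiesz, regToX_xToReg E.ι hε]
      · split_ifs
        · change inner ℝ (regRiesz E.ι ε (E.F r)) (xToReg E.ι ε v) = _
          rw [inner_regRiesz, regToX_xToReg E.ι hε]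
        · rw [inner_zero_left]
    · refine Finset.sum_congr rfl fun p _ => ?_
      rw [real_inner_smul_left, inner_add_left]
      congr 2
      · change inner ℝ (regRiesz E.ι ε (toDual E.ι (E.B p.2
          (E.ι (E.regCoeff hε (α - Finsupp.single p 1) r))))) (xToReg E.ι ε v) = _
        rw [inner_regRiesz, regToX_xToReg E.ι hε, toDual_apply]
      · split_ifs
        · change inner ℝ (regRiesz E.ι ε (toDual E.ι (E.G p.2 r))) (xToReg E.ι ε v) = _
          rw [inner_regRiesz, regToX_xToReg E.ι hε, toDual_apply]
        · rw [inner_zero_left]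

/-- The size of the inputs on the time interval `[0, t]`. -/
noncomputable def inputBound (Λ : Finset ℕ) (t : ℝ) : ℝ :=
  ‖E.u₀‖ ^ 2 + E.δ⁻¹ * (∫ r in (0 : ℝ)..t, ‖E.F r‖ ^ 2)
    + ∑ ℓ ∈ Λ, E.k ℓ ^ 2 * ∫ r in (0 : ℝ)..t, ‖E.G ℓ r‖ ^ 2

theorem norm_x₀_sq_le : ‖(E.regularize hε).x₀‖ ^ 2 ≤ ‖E.u₀‖ ^ 2 := by
  have := norm_regRiesz_toDual_le E.ι hε E.u₀
  have h2 : ‖(E.regularize hε).x₀‖ ≤ ‖E.u₀‖ := this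
  gcongr

theorem reg_energy_eq (s : Finset (ℕ × ℕ)) (N : ℕ) (t : ℝ) :
    (E.regularize hε).energy s N t
      = ∑ n ∈ Finset.range (N + 1), ∑ α ∈ s.finsuppAntidiag n, multiFactorial α *
        (‖E.ι (E.regCoeff hε α t)‖ ^ 2 + ε * ‖E.regCoeff hε α t‖ ^ 2) := by
  rw [EvolutionData.energy]
  simp only [reg_norm_sq E.ι hε]
  rfl

theorem reg_energy_le (s : Finset (ℕ × ℕ)) (N : ℕ) {t : ℝ} (ht : 0 ≤ t) :
    (E.regularize hε).energy s (N + 1) t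
      ≤ 3 * Real.exp ((E.cA + E.cB) * t) * E.inputBound (s.image Prod.snd) t := by
  refine ((E.regularize hε).energy_le ht).trans ?_
  have h1 := E.norm_x₀_sq_le hε
  have h2 : ∀ ℓ, ∫ r in (0 : ℝ)..t, ‖(E.regularize hε).g ℓ r‖ ^ 2
      ≤ ∫ r in (0 : ℝ)..t, ‖E.G ℓ r‖ ^ 2 := fun ℓ => by
    refine intervalIntegral.integral_mono_on ht
      (((E.regularize hε).memLp_g ℓ).integrable_norm_pow two_ne_zero).intervalIntegrable
      ((E.memLp_G ℓ).integrable_norm_pow two_ne_zero).intervalIntegrable fun r _ => ?_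
    have : ‖(E.regularize hε).g ℓ r‖ ≤ ‖E.G ℓ r‖ := norm_regRiesz_toDual_le E.ι hε _
    gcongr
  have h3 : ∑ ℓ ∈ s.image Prod.snd, E.k ℓ ^ 2 * ∫ r in (0 : ℝ)..t, ‖(E.regularize hε).g ℓ r‖ ^ 2
      ≤ ∑ ℓ ∈ s.image Prod.snd, E.k ℓ ^ 2 * ∫ r in (0 : ℝ)..t, ‖E.G ℓ r‖ ^ 2 :=
    Finset.sum_le_sum fun ℓ _ => mul_le_mul_of_nonneg_left (h2 ℓ) (sq_nonneg _)
  unfold inputBound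
  change 3 * Real.exp ((E.cA + E.cB) * t) * (‖(E.regularize hε).x₀‖ ^ 2
    + E.δ⁻¹ * (∫ r in (0 : ℝ)..t, ‖E.F r‖ ^ 2)
    + ∑ ℓ ∈ s.image Prod.snd, E.k ℓ ^ 2 * ∫ r in (0 : ℝ)..t, ‖(E.regularize hε).g ℓ r‖ ^ 2) ≤ _
  gcongr

theorem reg_energy_le_of_eq_zero (hF : E.F =ᵐ[volume] 0) (hG : ∀ ℓ, E.G ℓ =ᵐ[volume] 0)
    (s : Finset (ℕ × ℕ)) (N : ℕ) {t : ℝ} (ht : 0 ≤ t) :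
    (E.regularize hε).energy s (N + 1) t ≤ Real.exp ((E.cA + E.cB) * t) * ‖E.u₀‖ ^ 2 := by
  refine ((E.regularize hε).energy_le_of_eq_zero ht ?_ fun ℓ => ?_).trans ?_
  · filter_upwards [hF] with r hr
    change regRiesz E.ι ε (E.F r) = 0
    rw [hr]; simp
  · filter_upwards [hG ℓ] with r hr
    change regRiesz E.ι ε (toDual E.ι (E.G ℓ r)) = 0
    rw [hr]; simp
  · exact mul_le_mul_of_nonneg_left (E.norm_x₀_sq_le hε) (Real.exp_pos _).le

end ParabolicData

end ColoredChaos

namespace ColoredChaos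

/-! ### Weak limits along ultrafilters -/

/-- Along an ultrafilter every bounded sequence of numbers converges, so all pairings have limits at
once and Riesz's theorem gives the vector. No subsequences are extracted: one ultrafilter serves all
coefficients and all times. -/
theorem exists_weak_limit {E : Type*} [NormedAddCommGroup E] [InnerProductSpace ℝ E]
    [CompleteSpace E] (𝒰 : Ultrafilter ℕ) {x : ℕ → E} {C : ℝ} (hx : ∀ n, ‖x n‖ ≤ C) :
    ∃ x' : E, ∀ y, Tendsto (fun n => inner ℝ (x n) y) 𝒰 (𝓝 (inner ℝ x' y)) := by
  have hb : ∀ n y, |inner ℝ (x n) y| ≤ C * ‖y‖ := fun n y =>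
    (abs_real_inner_le_norm _ _).trans (by gcongr; exact hx n)
  have hlim : ∀ y, ∃ l, |l| ≤ C * ‖y‖ ∧ Tendsto (fun n => inner ℝ (x n) y) 𝒰 (𝓝 l) := by
    intro y
    obtain ⟨l, hl, h⟩ := (isCompact_Icc (a := -(C * ‖y‖)) (b := C * ‖y‖)).ultrafilter_le_nhds
      (𝒰.map fun n => inner ℝ (x n) y)
      (le_principal_iff.2 (Ultrafilter.mem_map.2 (univ_mem' fun n => abs_le.1 (hb n y))))
    exact ⟨l, abs_le.2 hl, h⟩
  choose l hl hlt using hlim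
  let L : E →ₗ[ℝ] ℝ :=
    { toFun := l
      map_add' := fun y z => tendsto_nhds_unique (hlt (y + z))
        (((hlt y).add (hlt z)).congr fun n => (inner_add_right _ _ _).symm)
      map_smul' := fun c y => tendsto_nhds_unique (hlt (c • y))
        (((hlt y).const_mul c).congr fun n => (real_inner_smul_right _ _ _).symm) }
  refine ⟨(InnerProductSpace.toDual ℝ E).symm (L.mkContinuous C fun y => hl y), fun y => ?_⟩
  rw [InnerProductSpace.toDual_symm_apply]
  exact hlt y

/-- Weak lower semicontinuity, from 2(x,x') - ‖x'‖² ≤ ‖x‖², whose left side is affine in x and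
passes to the limit. -/
theorem norm_sum_le_of_weak_limit {E κ : Type*} [NormedAddCommGroup E] [InnerProductSpace ℝ E]
    (𝒰 : Ultrafilter ℕ) (S : Finset κ) {c : κ → ℝ} (hc : ∀ i, 0 ≤ c i) {x : κ → ℕ → E} {x' : κ → E}
    (h : ∀ i ∈ S, ∀ y, Tendsto (fun n => inner ℝ (x i n) y) 𝒰 (𝓝 (inner ℝ (x' i) y))) {M : ℝ}
    (hM : ∀ n, ∑ i ∈ S, c i * ‖x i n‖ ^ 2 ≤ M) : ∑ i ∈ S, c i * ‖x' i‖ ^ 2 ≤ M := by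
  have h1 : Tendsto (fun n => ∑ i ∈ S, c i * (2 * inner ℝ (x i n) (x' i) - ‖x' i‖ ^ 2)) 𝒰
      (𝓝 (∑ i ∈ S, c i * (2 * inner ℝ (x' i) (x' i) - ‖x' i‖ ^ 2))) :=
    tendsto_finsetSum _ fun i hi => (((h i hi (x' i)).const_mul 2).sub_const _).const_mul _
  have h2 := le_of_tendsto h1 (Eventually.of_forall fun n => le_trans
    (Finset.sum_le_sum fun i _ => mul_le_mul_of_nonneg_left (b := 2 * inner ℝ (x i n) (x' i)
      - ‖x' i‖ ^ 2) (c := ‖x i n‖ ^ 2) (by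
        have := norm_sub_sq_real (x i n) (x' i)
        have h0 := sq_nonneg ‖x i n - x' i‖
        linarith) (hc i)) (hM n))
  simp only [real_inner_self_eq_norm_sq] at h2
  refine le_of_eq_of_le (Finset.sum_congr rfl fun i _ => ?_) h2
  ring

theorem intervalIntegral_eq_indicator {E : Type*} [NormedAddCommGroup E] [NormedSpace ℝ E]
    {T t : ℝ} (ht : t ∈ Set.Icc 0 T) (f : ℝ → E) :
    ∫ r in (0 : ℝ)..t, f r = ∫ r, (Set.Iio t).indicator f r ∂(timeMeasure T) := by
  rw [intervalIntegral.integral_of_le ht.1, integral_Ioc_eq_integral_Ioo,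
    integral_indicator measurableSet_Iio, Measure.restrict_restrict measurableSet_Iio]
  congr 2
  ext r
  simp only [Set.mem_Ioo, Set.mem_inter_iff, Set.mem_Iio]
  exact ⟨fun h => ⟨h.2, h.1, h.2.trans_le ht.2⟩, fun h => ⟨h.2.1, h.1⟩⟩

theorem intervalIntegrable_of_timeMeasure {E : Type*} [NormedAddCommGroup E]
    {T : ℝ} {f : ℝ → E} (hf : Integrable f (timeMeasure T)) {a b : ℝ} (ha : a ∈ Set.Icc 0 T)
    (hb : b ∈ Set.Icc 0 T) : IntervalIntegrable f volume a b := by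
  have hT : (0 : ℝ) ≤ T := ha.1.trans ha.2
  have : IntervalIntegrable f volume 0 T := by
    rw [intervalIntegrable_iff_integrableOn_Ioo_of_le hT]; exact hf
  exact this.mono_set (by
    rw [Set.uIcc_of_le hT]
    exact Set.uIcc_subset_Icc ha hb)

theorem integrable_sum_of_forall {Ω E κ : Type*} [NormedAddCommGroup E] [MeasurableSpace Ω]
    {μ : Measure Ω} {s : Finset κ} {f : κ → Ω → E} (hf : ∀ i ∈ s, Integrable (f i) μ) :
    Integrable (fun ω => ∑ i ∈ s, f i ω) μ := by
  classical
  induction s using Finset.induction_on with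
  | empty => simp
  | insert a s ha ih =>
    simp only [Finset.sum_insert ha]
    exact (hf a (Finset.mem_insert_self a s)).add
      (ih fun i hi => hf i (Finset.mem_insert_of_mem hi))

theorem integrable_add_of_normed {Ω E : Type*} [NormedAddCommGroup E] [MeasurableSpace Ω]
    {μ : Measure Ω} {f g : Ω → E} (hf : Integrable f μ) (hg : Integrable g μ) :
    Integrable (fun ω => f ω + g ω) μ := hf.add hg

namespace ParabolicData

variable {X H : Type*} [NormedAddCommGroup X] [InnerProductSpace ℝ X]
  [NormedAddCommGroup H] [InnerProductSpace ℝ H] (E : ParabolicData X H)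
  {T : ℝ}

/-- The right-hand side of the equation for the coefficient with index `α` (normalized by the
factor `1 / √α!`). -/
noncomputable def driftX (w : MultiIndex → ℝ → X) (α : MultiIndex) (r : ℝ) : StrongDual ℝ X :=
  E.A (w α r) + (if α = 0 then E.F r else 0)
    + ∑ p ∈ α.support, E.m p r • (toDual E.ι (E.B p.2 (E.ι (w (α - Finsupp.single p 1) r)))
      + if α - Finsupp.single p 1 = 0 then toDual E.ι (E.G p.2 r) else 0)

theorem driftX_apply (w : MultiIndex → ℝ → X) (α : MultiIndex) (r : ℝ) (v : X) :
    E.driftX w α r v = E.drift w α v r := by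
  rw [driftX, drift, add_apply, add_apply, sum_apply]
  congr 1
  · congr 1
    split_ifs <;> rfl
  · refine Finset.sum_congr rfl fun p _ => ?_
    rw [smul_apply, add_apply, smul_eq_mul, toDual_apply]
    congr 2
    split_ifs <;> rfl

theorem integrable_drift_parabolic {w : MultiIndex → ℝ → X} (α : MultiIndex)
    (hw : MemLp (w α) 2 (timeMeasure T)) :
    Integrable (fun r => E.A (w α r) + if α = 0 then E.F r else 0) (timeMeasure T) := by
  have i1 : Integrable (fun r => E.A (w α r)) (timeMeasure T) :=
    (E.A.comp_memLp' hw).integrable one_le_two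
  have i2 : Integrable (fun r => if α = 0 then E.F r else 0) (timeMeasure T) := by
    split_ifs
    · exact (E.memLp_F.restrict _).integrable one_le_two
    · exact integrable_zero ℝ (StrongDual ℝ X) _
  exact integrable_add_of_normed i1 i2

theorem integrable_drift_noise {w : MultiIndex → ℝ → X}
    (hw : ∀ α, MemLp (w α) 2 (timeMeasure T)) (α : MultiIndex) (p : ℕ × ℕ) :
    Integrable (fun r => E.m p r • (toDual E.ι (E.B p.2 (E.ι (w (α - Finsupp.single p 1) r)))
      + if α - Finsupp.single p 1 = 0 then toDual E.ι (E.G p.2 r) else 0)) (timeMeasure T) := by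
  have h0 : MemLp (fun r => if α - Finsupp.single p 1 = 0 then toDual E.ι (E.G p.2 r) else 0) 2
      (timeMeasure T) := by
    split_ifs
    · exact (toDual E.ι).comp_memLp' ((E.memLp_G p.2).restrict _)
    · exact memLp_const 0
  have h1 := ((toDual E.ι ∘L E.B p.2 ∘L E.ι).comp_memLp' (hw (α - Finsupp.single p 1))).add h0
  exact memLp_one_iff_integrable.1 (h1.smul ((E.memLp_m p).restrict _))

theorem integrable_driftX {w : MultiIndex → ℝ → X} (hw : ∀ α, MemLp (w α) 2 (timeMeasure T))
    (α : MultiIndex) : Integrable (E.driftX w α) (timeMeasure T) :=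
  (E.integrable_drift_parabolic α (hw α)).add
    (integrable_sum_of_forall fun p _ => E.integrable_drift_noise hw α p)

theorem integral_driftX {w : MultiIndex → ℝ → X} (hw : ∀ α, MemLp (w α) 2 (timeMeasure T))
    (α : MultiIndex) {t : ℝ} (ht : t ∈ Set.Icc 0 T) : ∫ r in (0 : ℝ)..t, E.driftX w α r
      = (∫ r in (0 : ℝ)..t, (E.A (w α r) + if α = 0 then E.F r else 0))
        + ∑ p ∈ α.support, ∫ r in (0 : ℝ)..t,
          E.m p r • (toDual E.ι (E.B p.2 (E.ι (w (α - Finsupp.single p 1) r)))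
            + if α - Finsupp.single p 1 = 0 then toDual E.ι (E.G p.2 r) else 0) := by
  have h0 : (0 : ℝ) ∈ Set.Icc 0 T := Set.left_mem_Icc.2 (ht.1.trans ht.2)
  have h1 := fun p => intervalIntegrable_of_timeMeasure (E.integrable_drift_noise hw α p) h0 ht
  rw [← intervalIntegral.integral_finsetSum fun p _ => h1 p]
  exact intervalIntegral.integral_add
    (intervalIntegrable_of_timeMeasure (E.integrable_drift_parabolic α (hw α)) h0 ht)
    (intervalIntegrable_of_timeMeasure
      (integrable_sum_of_forall fun p _ => E.integrable_drift_noise hw α p) h0 ht)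

variable [CompleteSpace X]

/-- The tested drift is affine in w: its linear part consists of inner products with fixed
functions, square integrable because ζ is bounded and m is square integrable. Weak convergence in
L₂((0,T); X) therefore suffices for the passage to the limit. -/
theorem integral_mul_drift_eq {w : MultiIndex → ℝ → X}
    (hw : ∀ α, MemLp (w α) 2 (timeMeasure T)) {ζ : ℝ → ℝ}
    (hζ : MemLp ζ ∞ (timeMeasure T)) (α : MultiIndex) (v : X) :
    ∫ r, ζ r * E.drift w α v r ∂(timeMeasure T)
      = (∫ r, inner ℝ (w α r) (ζ r • (InnerProductSpace.toDual ℝ X).symm (E.A.flip v))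
          ∂(timeMeasure T))
        + (∫ r, ζ r * (if α = 0 then E.F r v else 0) ∂(timeMeasure T))
        + ∑ p ∈ α.support, ((∫ r, inner ℝ (w (α - Finsupp.single p 1) r)
            (ζ r • E.m p r • (InnerProductSpace.toDual ℝ X).symm
              (innerSL ℝ (E.ι v) ∘L E.B p.2 ∘L E.ι)) ∂(timeMeasure T))
          + ∫ r, ζ r * (E.m p r * if α - Finsupp.single p 1 = 0
              then inner ℝ (E.G p.2 r) (E.ι v) else 0) ∂(timeMeasure T)) := by
  have hdual : ∀ (x : X) (ψ : StrongDual ℝ X),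
      inner ℝ x ((InnerProductSpace.toDual ℝ X).symm ψ) = ψ x := fun x ψ => by
    rw [real_inner_comm, InnerProductSpace.toDual_symm_apply]
  have e : ∀ r, ζ r * E.drift w α v r
      = inner ℝ (w α r) (ζ r • (InnerProductSpace.toDual ℝ X).symm (E.A.flip v))
        + ζ r * (if α = 0 then E.F r v else 0)
        + ∑ p ∈ α.support, (inner ℝ (w (α - Finsupp.single p 1) r)
            (ζ r • E.m p r • (InnerProductSpace.toDual ℝ X).symm
              (innerSL ℝ (E.ι v) ∘L E.B p.2 ∘L E.ι))
          + ζ r * (E.m p r * if α - Finsupp.single p 1 = 0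
              then inner ℝ (E.G p.2 r) (E.ι v) else 0)) := by
    intro r
    rw [drift, mul_add, mul_add, Finset.mul_sum]
    congr 1
    · congr 1
      rw [real_inner_smul_right, hdual]
      rfl
    · refine Finset.sum_congr rfl fun p _ => ?_
      rw [real_inner_smul_right, real_inner_smul_right, hdual, mul_add, mul_add]
      congr 3
      exact real_inner_comm _ _
  have hinner : ∀ {f g : ℝ → X}, MemLp f 2 (timeMeasure T) → MemLp g 2 (timeMeasure T) →
      Integrable (fun r => inner ℝ (f r) (g r)) (timeMeasure T) := fun hf hg =>
    (hf.norm.integrable_mul hg.norm).mono' (hf.1.inner hg.1)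
      (Eventually.of_forall fun _ => norm_inner_le_norm _ _)
  have i1 : Integrable (fun r => inner ℝ (w α r)
      (ζ r • (InnerProductSpace.toDual ℝ X).symm (E.A.flip v))) (timeMeasure T) :=
    hinner (hw α) (MemLp.smul (p := ∞) (q := 2) (r := 2) (memLp_const _) hζ)
  have i2 : Integrable (fun r => ζ r * (if α = 0 then E.F r v else 0)) (timeMeasure T) := by
    have : MemLp (fun r => if α = 0 then E.F r v else 0) 1 (timeMeasure T) := by
      split_ifs
      · exact ((ContinuousLinearMap.apply ℝ ℝ v).comp_memLp' (E.memLp_F.restrict _)).mono_exponent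
          one_le_two
      · exact MemLp.zero'
    exact memLp_one_iff_integrable.1 (this.mul hζ)
  have i3 : ∀ p, Integrable (fun r => inner ℝ (w (α - Finsupp.single p 1) r)
            (ζ r • E.m p r • (InnerProductSpace.toDual ℝ X).symm
              (innerSL ℝ (E.ι v) ∘L E.B p.2 ∘L E.ι))) (timeMeasure T) := fun p =>
    hinner (hw _) (MemLp.smul (p := ∞) (q := 2) (r := 2) (MemLp.smul (p := 2) (q := ∞) (r := 2)
      (memLp_const _) ((E.memLp_m p).restrict _)) hζ)
  have i4 : ∀ p, Integrable (fun r => ζ r * (E.m p r * if α - Finsupp.single p 1 = 0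
              then inner ℝ (E.G p.2 r) (E.ι v) else 0)) (timeMeasure T) := by
    intro p
    have : MemLp (fun r => if α - Finsupp.single p 1 = 0
        then inner ℝ (E.G p.2 r) (E.ι v) else 0) 2 (timeMeasure T) := by
      split_ifs
      · exact ((E.memLp_G p.2).restrict _).inner_const (E.ι v)
      · exact MemLp.zero'
    exact memLp_one_iff_integrable.1 (MemLp.mul (p := ∞) (q := 1) (r := 1)
      (MemLp.mul (p := 2) (q := 2) (r := 1) this ((E.memLp_m p).restrict _)) hζ)
  simp only [e]
  refine (integral_add (i1.add i2)
    (integrable_sum_of_forall fun p _ => (i3 p).add (i4 p))).trans ?_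
  exact congrArg₂ (· + ·) (integral_add i1 i2)
    ((integral_finsetSum _ fun p _ => (i3 p).add (i4 p)).trans
      (Finset.sum_congr rfl fun p _ => integral_add (i3 p) (i4 p)))

/-- Weak convergence of the coefficients implies weak convergence of the right-hand sides of their
equations. -/
theorem tendsto_integral_mul_drift {𝒰 : Filter ℕ} {w : ℕ → MultiIndex → ℝ → X}
    {w' : MultiIndex → ℝ → X} (hw : ∀ n α, MemLp (w n α) 2 (timeMeasure T))
    (hw' : ∀ α, MemLp (w' α) 2 (timeMeasure T))
    (h : ∀ α k, MemLp k 2 (timeMeasure T) → Tendsto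
      (fun n => ∫ r, inner ℝ (w n α r) (k r) ∂(timeMeasure T)) 𝒰
      (𝓝 (∫ r, inner ℝ (w' α r) (k r) ∂(timeMeasure T))))
    {ζ : ℝ → ℝ} (hζ : MemLp ζ ∞ (timeMeasure T)) (α : MultiIndex) (v : X) :
    Tendsto (fun n => ∫ r, ζ r * E.drift (w n) α v r ∂(timeMeasure T)) 𝒰
      (𝓝 (∫ r, ζ r * E.drift w' α v r ∂(timeMeasure T))) := by
  simp only [fun n => E.integral_mul_drift_eq (hw n) hζ α v, E.integral_mul_drift_eq hw' hζ α v]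
  refine ((h _ _ ?_).add_const _).add (tendsto_finsetSum _ fun p _ => (h _ _ ?_).add_const _)
  · exact MemLp.smul (p := ∞) (q := 2) (r := 2) (memLp_const _) hζ
  · exact (MemLp.smul (p := ∞) (q := 2) (r := 2) (MemLp.smul (p := 2) (q := ∞) (r := 2)
      (memLp_const _) ((E.memLp_m p).restrict _)) hζ)

end ParabolicData

end ColoredChaos

/-! ### Time integrals, weak limits in L₂ and uniform bounds. -/

namespace ColoredChaos

theorem intervalIntegral_eq_timeMeasure {E : Type*} [NormedAddCommGroup E] [NormedSpace ℝ E]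
    {T : ℝ} (hT : 0 ≤ T) (f : ℝ → E) : ∫ r in (0 : ℝ)..T, f r = ∫ r, f r ∂(timeMeasure T) := by
  rw [intervalIntegral.integral_of_le hT, integral_Ioc_eq_integral_Ioo]

theorem intervalIntegral_congr_timeMeasure {E : Type*} [NormedAddCommGroup E] [NormedSpace ℝ E]
    {T t : ℝ} (ht : t ∈ Set.Icc 0 T) {f g : ℝ → E} (h : f =ᵐ[timeMeasure T] g) :
    ∫ r in (0 : ℝ)..t, f r = ∫ r in (0 : ℝ)..t, g r := by
  rw [intervalIntegral_eq_indicator ht, intervalIntegral_eq_indicator ht]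
  refine integral_congr_ae ?_
  filter_upwards [h] with r hr
  simp only [Set.indicator_apply, hr]

/-- Every integrable function on `(0, T)` is the derivative of a primitive function on the line. -/
theorem exists_isPrimitive_of_timeMeasure {E : Type*} [NormedAddCommGroup E] [NormedSpace ℝ E]
    {T : ℝ} {f : ℝ → E} (hf : Integrable f (timeMeasure T)) :
    ∃ y : ℝ → E, IsPrimitive y ((Set.Ioo 0 T).indicator f) ∧
      ∀ t ∈ Set.Icc 0 T, y t = ∫ r in (0 : ℝ)..t, f r := by
  have hi : Integrable ((Set.Ioo 0 T).indicator f) volume :=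
    (integrable_indicator_iff measurableSet_Ioo).2 hf
  refine ⟨_, isPrimitive_integral (fun a b => hi.intervalIntegrable) 0 0, fun t ht => ?_⟩
  rw [zero_add]
  refine intervalIntegral_congr_timeMeasure ht ?_
  filter_upwards [ae_restrict_mem measurableSet_Ioo] with r hr
  exact Set.indicator_of_mem hr _

/-- Integration by parts against an indicator function. -/
theorem exists_adjoint_primitive {T : ℝ} (hT : 0 ≤ T) {S : Set ℝ} (hS : MeasurableSet S) :
    ∃ z : ℝ → ℝ, MemLp z ∞ (timeMeasure T) ∧ ∀ D, Integrable D (timeMeasure T) →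
      ∫ r, S.indicator 1 r * (∫ q in (0 : ℝ)..r, D q) ∂(timeMeasure T)
        = ∫ r, z r * D r ∂(timeMeasure T) := by
  have hi : ∀ a b, IntervalIntegrable (S.indicator (1 : ℝ → ℝ)) volume a b := fun a b =>
    (intervalIntegrable_const (c := (1 : ℝ))).mono_fun
      ((measurable_const.indicator hS).aestronglyMeasurable)
      (Eventually.of_forall fun r => by
        by_cases h : r ∈ S <;> simp [h])
  have hz := isPrimitive_integral hi 0 T
  -- This primitive vanishes at T and the primitive of D vanishes at 0, so integration by parts
  -- leaves no boundary term.
  set z : ℝ → ℝ := fun t => 0 + ∫ r in T..t, S.indicator (1 : ℝ → ℝ) r with hzdef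
  have hzT : z T = 0 := by simp [z]
  have hzc := hz.continuous
  refine ⟨fun r => -z r, ?_, fun D hD => ?_⟩
  · obtain ⟨C, hC⟩ := isCompact_Icc.exists_bound_of_continuousOn (s := Set.Icc 0 T)
      hzc.continuousOn
    refine memLp_top_of_bound hzc.neg.aestronglyMeasurable C ?_
    filter_upwards [ae_restrict_mem measurableSet_Ioo] with r hr
    rw [norm_neg]
    exact hC r (Set.Ioo_subset_Icc_self hr)
  · obtain ⟨y, hy, hy0⟩ := exists_isPrimitive_of_timeMeasure hD
    have h := (hz.mul hy).sub_eq 0 T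
    rw [hzT, hy0 0 ⟨le_rfl, hT⟩, intervalIntegral.integral_same, zero_mul, mul_zero, sub_zero] at h
    rw [intervalIntegral.integral_add, intervalIntegral_eq_timeMeasure hT,
      intervalIntegral_eq_timeMeasure hT] at h
    · have e1 : ∫ r, S.indicator 1 r * (∫ q in (0 : ℝ)..r, D q) ∂(timeMeasure T)
          = ∫ r, S.indicator 1 r * y r ∂(timeMeasure T) := by
        refine integral_congr_ae ?_
        filter_upwards [ae_restrict_mem measurableSet_Ioo] with r hr
        rw [hy0 r (Set.Ioo_subset_Icc_self hr)]
      have e2 : ∫ r, -z r * D r ∂(timeMeasure T)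
          = - ∫ r, z r * (Set.Ioo 0 T).indicator D r ∂(timeMeasure T) := by
        rw [← integral_neg]
        refine integral_congr_ae ?_
        filter_upwards [ae_restrict_mem measurableSet_Ioo] with r hr
        rw [Set.indicator_of_mem hr, neg_mul]
      rw [e1, e2]
      linarith
    · exact (hi 0 T).mul_continuousOn hy.continuous.continuousOn
    · exact (hy.intervalIntegrable 0 T).continuousOn_mul hzc.continuousOn

/-- Bounded sequences of square integrable functions have weak limits along ultrafilters. -/
theorem exists_weak_limit_memLp {E : Type*} [NormedAddCommGroup E] [InnerProductSpace ℝ E]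
    [CompleteSpace E] (𝒰 : Ultrafilter ℕ) {Ω : Type*} [MeasurableSpace Ω] {μ : Measure Ω}
    {w : ℕ → Ω → E} (hw : ∀ n, MemLp (w n) 2 μ) {C : ℝ} (hC : ∀ n, ∫ r, ‖w n r‖ ^ 2 ∂μ ≤ C) :
    ∃ w' : Ω → E, MemLp w' 2 μ ∧ ∀ k, MemLp k 2 μ →
      Tendsto (fun n => ∫ r, inner ℝ (w n r) (k r) ∂μ) 𝒰 (𝓝 (∫ r, inner ℝ (w' r) (k r) ∂μ)) := by
  have hn : ∀ n, ‖(hw n).toLp (w n)‖ ≤ √C := fun n => by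
    refine Real.le_sqrt_of_sq_le (le_trans (le_of_eq ?_) (hC n))
    rw [← real_inner_self_eq_norm_sq, L2.inner_def]
    refine integral_congr_ae ?_
    filter_upwards [(hw n).coeFn_toLp] with r hr
    rw [hr, real_inner_self_eq_norm_sq]
  obtain ⟨w', h⟩ := exists_weak_limit 𝒰 hn
  refine ⟨w', Lp.memLp w', fun k hk => ?_⟩
  have e : ∀ x : Lp E 2 μ, inner ℝ x (hk.toLp k) = ∫ r, inner ℝ (x r) (k r) ∂μ := fun x => by
    rw [L2.inner_def]
    refine integral_congr_ae ?_
    filter_upwards [hk.coeFn_toLp] with r hr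
    rw [hr]
  have h' := h (hk.toLp k)
  rw [e] at h'
  refine h'.congr fun n => ?_
  rw [e]
  refine integral_congr_ae ?_
  filter_upwards [(hw n).coeFn_toLp] with r hr
  rw [hr]

namespace ParabolicData

variable {X H : Type*} [NormedAddCommGroup X] [InnerProductSpace ℝ X]
  [NormedAddCommGroup H] [InnerProductSpace ℝ H] (E : ParabolicData X H)
  {T I₀ : ℝ}

theorem cB_nonneg : 0 ≤ E.cB := by simpa using E.sum_B_le ∅

theorem inputBound_nonneg (Λ : Finset ℕ) {t : ℝ} (ht : 0 ≤ t) : 0 ≤ E.inputBound Λ t := by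
  have h1 := intervalIntegral.integral_nonneg (μ := volume) ht fun r _ => sq_nonneg ‖E.F r‖
  have h2 := fun ℓ => intervalIntegral.integral_nonneg (μ := volume) ht
    fun r _ => sq_nonneg ‖E.G ℓ r‖
  have h3 := E.δ_pos
  unfold inputBound
  have h4 : 0 ≤ ∑ ℓ ∈ Λ, E.k ℓ ^ 2 * ∫ r in (0 : ℝ)..t, ‖E.G ℓ r‖ ^ 2 :=
    Finset.sum_nonneg fun ℓ _ => mul_nonneg (sq_nonneg _) (h2 ℓ)
  positivity

variable [CompleteSpace X] [CompleteSpace H]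

theorem norm_coeff_sq_le (hI : ∀ Λ, ∀ t ∈ Set.Icc 0 T, E.inputBound Λ t ≤ I₀)
    {ε : ℝ} (hε : 0 < ε) (α : MultiIndex) {t : ℝ} (ht : t ∈ Set.Icc 0 T) :
    ‖(E.regularize hε).coeff α t‖ ^ 2 ≤ 3 * Real.exp ((E.cA + E.cB) * T) * I₀ := by
  have h1 := E.reg_energy_le hε α.support (α.support.sum α) ht.1
  have h2 : ‖(E.regularize hε).coeff α t‖ ^ 2
      ≤ (E.regularize hε).energy α.support (α.support.sum α + 1) t := by
    have hmem : α ∈ α.support.finsuppAntidiag (α.support.sum α) :=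
      Finset.mem_finsuppAntidiag.2 ⟨rfl, subset_rfl⟩
    have h0 : ∀ β t, 0 ≤ multiFactorial β * ‖(E.regularize hε).coeff β t‖ ^ 2 := fun β t =>
      mul_nonneg (multiFactorial_pos β).le (sq_nonneg _)
    calc ‖(E.regularize hε).coeff α t‖ ^ 2
        ≤ multiFactorial α * ‖(E.regularize hε).coeff α t‖ ^ 2 :=
          le_mul_of_one_le_left (sq_nonneg _) (EvolutionData.one_le_multiFactorial α)
      _ ≤ ∑ β ∈ α.support.finsuppAntidiag (α.support.sum α),
            multiFactorial β * ‖(E.regularize hε).coeff β t‖ ^ 2 :=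
          Finset.single_le_sum (f := fun β => multiFactorial β *
            ‖(E.regularize hε).coeff β t‖ ^ 2) (fun β _ => h0 β t) hmem
      _ ≤ _ := Finset.single_le_sum (f := fun n => ∑ β ∈ α.support.finsuppAntidiag n,
            multiFactorial β * ‖(E.regularize hε).coeff β t‖ ^ 2)
            (fun n _ => Finset.sum_nonneg fun β _ => h0 β t) (Finset.mem_range.2 (by omega))
  refine h2.trans (h1.trans ?_)
  have h3 := hI (α.support.image Prod.snd) t ht
  have h4 := E.inputBound_nonneg (α.support.image Prod.snd) ht.1
  have h5 := E.cA_nonneg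
  have h6 := E.cB_nonneg
  have h7 := ht.2
  gcongr

theorem exists_integral_norm_sq_le (hT : 0 ≤ T)
    (hI : ∀ Λ, ∀ t ∈ Set.Icc 0 T, E.inputBound Λ t ≤ I₀) (α : MultiIndex) :
    ∃ C, ∀ ε : ℝ, ∀ hε : 0 < ε, ∫ r, ‖E.regCoeff hε α r‖ ^ 2 ∂(timeMeasure T) ≤ C := by
  have h := fun (ε : ℝ) (hε : 0 < ε) => (E.regularize hε).integral_norm_j_coeff_sq_le hT
    (R := √(3 * Real.exp ((E.cA + E.cB) * T) * I₀))
    (fun β r hr => Real.le_sqrt_of_sq_le (E.norm_coeff_sq_le hI hε β hr))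
    (E.norm_reg_b_le hε) (fun ℓ => (E.memLp_G ℓ).norm)
    (fun ℓ r => norm_regRiesz_toDual_le E.ι hε (E.G ℓ r)) α
  have hδ := E.δ_pos
  refine ⟨2 / E.δ * (√(3 * Real.exp ((E.cA + E.cB) * T) * I₀) ^ 2 + ∫ r in (0 : ℝ)..T,
      (E.cA * √(3 * Real.exp ((E.cA + E.cB) * T) * I₀) ^ 2 + 2 / E.δ * ‖E.F r‖ ^ 2
        + ∑ p ∈ α.support, 2 * √(3 * Real.exp ((E.cA + E.cB) * T) * I₀) *
          (‖E.B p.2‖ * √(3 * Real.exp ((E.cA + E.cB) * T) * I₀) * |E.m p r|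
            + |E.m p r| * ‖E.G p.2 r‖))), fun ε hε => ?_⟩
  rw [← intervalIntegral_eq_timeMeasure hT]
  have h1 := mul_le_mul_of_nonneg_left (h ε hε) (by positivity : 0 ≤ 2 / E.δ)
  refine le_trans (le_of_eq ?_) h1
  change _ = 2 / E.δ * (E.δ / 2 * ∫ r in (0 : ℝ)..T, ‖E.regCoeff hε α r‖ ^ 2)
  field_simp

end ParabolicData

end ColoredChaos

/-! ### Existence by passage to the limit. -/

namespace ColoredChaos

namespace ParabolicData

variable {X H : Type*} [NormedAddCommGroup X] [InnerProductSpace ℝ X]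
  [NormedAddCommGroup H] [InnerProductSpace ℝ H] (E : ParabolicData X H)
  {T I₀ : ℝ}

theorem integrable_drift {w : MultiIndex → ℝ → X} (hw : ∀ α, MemLp (w α) 2 (timeMeasure T))
    (α : MultiIndex) (v : X) : Integrable (E.drift w α v) (timeMeasure T) := by
  have := (ContinuousLinearMap.apply ℝ ℝ v).integrable_comp (E.integrable_driftX hw α)
  refine this.congr (Eventually.of_forall fun r => ?_)
  exact E.driftX_apply w α r v

theorem integral_driftX_apply {w : MultiIndex → ℝ → X} (hw : ∀ α, MemLp (w α) 2 (timeMeasure T))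
    (α : MultiIndex) {t : ℝ} (ht : t ∈ Set.Icc 0 T) (v : X) :
    (∫ r in (0 : ℝ)..t, E.driftX w α r) v = ∫ r in (0 : ℝ)..t, E.drift w α v r := by
  have h := (ContinuousLinearMap.apply ℝ ℝ v).intervalIntegral_comp_comm
    (intervalIntegrable_of_timeMeasure (E.integrable_driftX hw α)
      (Set.left_mem_Icc.2 (ht.1.trans ht.2)) ht)
  refine (Eq.trans ?_ h).symm
  exact intervalIntegral.integral_congr fun r _ => (E.driftX_apply w α r v).symm

variable [CompleteSpace X] [CompleteSpace H]

theorem memLp_regCoeff {ε : ℝ} (hε : 0 < ε) (α : MultiIndex) :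
    MemLp (E.regCoeff hε α) 2 (timeMeasure T) := by
  have hc := E.continuous_regCoeff hε α
  obtain ⟨C, hC⟩ := (isCompact_Icc (a := (0 : ℝ)) (b := T)).exists_bound_of_continuousOn
    hc.continuousOn
  refine MemLp.of_bound hc.aestronglyMeasurable C ?_
  filter_upwards [ae_restrict_mem measurableSet_Ioo] with r hr
  exact hC r (Set.Ioo_subset_Icc_self hr)

theorem norm_incl_sq_add_le (hI : ∀ Λ, ∀ t ∈ Set.Icc 0 T, E.inputBound Λ t ≤ I₀)
    {ε : ℝ} (hε : 0 < ε) (α : MultiIndex) {t : ℝ} (ht : t ∈ Set.Icc 0 T) :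
    ‖E.ι (E.regCoeff hε α t)‖ ^ 2 + ε * ‖E.regCoeff hε α t‖ ^ 2
      ≤ 3 * Real.exp ((E.cA + E.cB) * T) * I₀ := by
  have h := E.norm_coeff_sq_le hI hε α ht
  rwa [reg_norm_sq E.ι hε] at h

set_option maxHeartbeats 1000000 in
-- Two weak limits are taken along one ultrafilter: in L₂((0,T); X), which gives w and the drift,
-- and in H at each fixed time, which gives u. The second makes the equation and the energy bounds
-- hold at every t; the two limits are then matched almost everywhere.
theorem exists_solution (hT : 0 ≤ T)
    (hI : ∀ Λ, ∀ t ∈ Set.Icc 0 T, E.inputBound Λ t ≤ I₀) :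
    ∃ (w : MultiIndex → ℝ → X) (u : MultiIndex → ℝ → H),
      (∀ α, MemLp (w α) 2 (timeMeasure T)) ∧
      (∀ α, ∀ t ∈ Set.Icc 0 T, toDual E.ι (u α t)
        = (if α = 0 then toDual E.ι E.u₀ else 0) + ∫ r in (0 : ℝ)..t, E.driftX w α r) ∧
      (∀ α, ∀ᵐ r ∂(timeMeasure T), toDual E.ι (u α r) = toDual E.ι (E.ι (w α r))) ∧
      (∀ (s : Finset (ℕ × ℕ)) N, ∀ t ∈ Set.Icc 0 T, ∑ n ∈ Finset.range (N + 2), ∑ α ∈ s.finsuppAntidiag n,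
        multiFactorial α * ‖u α t‖ ^ 2
          ≤ 3 * Real.exp ((E.cA + E.cB) * t) * E.inputBound (s.image Prod.snd) t) ∧
      (E.F =ᵐ[volume] 0 → (∀ ℓ, E.G ℓ =ᵐ[volume] 0) →
        ∀ (s : Finset (ℕ × ℕ)) N, ∀ t ∈ Set.Icc 0 T,
        ∑ n ∈ Finset.range (N + 2), ∑ α ∈ s.finsuppAntidiag n, multiFactorial α * ‖u α t‖ ^ 2
          ≤ Real.exp ((E.cA + E.cB) * t) * ‖E.u₀‖ ^ 2) := by
  classical
  set M : ℝ := 3 * Real.exp ((E.cA + E.cB) * T) * I₀ with hM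
  let 𝒰 : Ultrafilter ℕ := hyperfilter ℕ
  let ε : ℕ → ℝ := fun n => 1 / ((n : ℝ) + 1)
  have hε : ∀ n, 0 < ε n := fun n => by positivity
  have hε0 : Tendsto ε 𝒰 (𝓝 0) :=
    tendsto_one_div_add_atTop_nhds_zero_nat.mono_left Nat.hyperfilter_le_atTop
  let W : ℕ → MultiIndex → ℝ → X := fun n => E.regCoeff (hε n)
  have hWmem : ∀ n α, MemLp (W n α) 2 (timeMeasure T) := fun n => E.memLp_regCoeff (hε n)
  have hw : ∀ α, ∃ w' : ℝ → X, MemLp w' 2 (timeMeasure T) ∧ ∀ k, MemLp k 2 (timeMeasure T) →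
      Tendsto (fun n => ∫ r, inner ℝ (W n α r) (k r) ∂(timeMeasure T)) 𝒰
        (𝓝 (∫ r, inner ℝ (w' r) (k r) ∂(timeMeasure T))) := fun α => by
    obtain ⟨C, hC⟩ := E.exists_integral_norm_sq_le hT hI α
    exact exists_weak_limit_memLp 𝒰 (fun n => hWmem n α) fun n => hC _ (hε n)
  choose w hwmem hwlim using hw
  have hu : ∀ α t, ∃ y : H, t ∈ Set.Icc 0 T → ∀ z,
      Tendsto (fun n => inner ℝ (E.ι (W n α t)) z) 𝒰 (𝓝 (inner ℝ y z)) := fun α t => by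
    by_cases ht : t ∈ Set.Icc 0 T
    · obtain ⟨y, hy⟩ := exists_weak_limit 𝒰 (x := fun n => E.ι (W n α t)) (C := √M) fun n => by
        refine Real.le_sqrt_of_sq_le (le_trans ?_ (E.norm_incl_sq_add_le hI (hε n) α ht))
        exact le_add_of_nonneg_right (mul_nonneg (hε n).le (sq_nonneg _))
      exact ⟨y, fun _ => hy⟩
    · exact ⟨0, fun h => absurd h ht⟩
  choose u hulim using hu
  have hdrift : ∀ {ζ : ℝ → ℝ}, MemLp ζ ∞ (timeMeasure T) → ∀ α v,
      Tendsto (fun n => ∫ r, ζ r * E.drift (W n) α v r ∂(timeMeasure T)) 𝒰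
        (𝓝 (∫ r, ζ r * E.drift w α v r ∂(timeMeasure T))) := fun hζ α v =>
    E.tendsto_integral_mul_drift hWmem hwmem (fun α k hk => hwlim α k hk) hζ α v
  have hmemind : ∀ S : Set ℝ, MeasurableSet S →
      MemLp (S.indicator (1 : ℝ → ℝ)) ∞ (timeMeasure T) := fun S hS =>
    memLp_top_of_bound ((measurable_const.indicator hS).aestronglyMeasurable) 1
      (Eventually.of_forall fun r => by by_cases h : r ∈ S <;> simp [h])
  have hequ : ∀ α, ∀ t ∈ Set.Icc 0 T, toDual E.ι (u α t)
        = (if α = 0 then toDual E.ι E.u₀ else 0) + ∫ r in (0 : ℝ)..t, E.driftX w α r := by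
    intro α t ht
    ext v
    rw [add_apply, E.integral_driftX_apply hwmem α ht, toDual_apply]
    have e0 : (if α = 0 then toDual E.ι E.u₀ else 0) v
        = if α = 0 then inner ℝ E.u₀ (E.ι v) else 0 := by split_ifs <;> rfl
    rw [e0]
    -- At a fixed time only √ε ‖W‖ is known to be bounded in X; the other factor √ε sends the term
    -- to zero.
    have hsmall : Tendsto (fun n => ε n * inner ℝ (W n α t) v) 𝒰 (𝓝 0) := by
      have h1 : Tendsto (fun n => √(ε n) * (√M * ‖v‖)) 𝒰 (𝓝 0) := by
        have := ((Real.continuous_sqrt.tendsto 0).comp hε0).mul_const (√M * ‖v‖)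
        simpa using this
      refine squeeze_zero_norm (fun n => ?_) h1
      have h2 : √(ε n) * ‖W n α t‖ ≤ √M := by
        refine Real.le_sqrt_of_sq_le (le_trans ?_ (E.norm_incl_sq_add_le hI (hε n) α ht))
        rw [mul_pow, Real.sq_sqrt (hε n).le]
        exact le_add_of_nonneg_left (sq_nonneg _)
      rw [norm_mul, Real.norm_of_nonneg (hε n).le]
      calc ε n * ‖inner ℝ (W n α t) v‖ ≤ ε n * (‖W n α t‖ * ‖v‖) := by
            have := norm_inner_le_norm (𝕜 := ℝ) (W n α t) v
            have := (hε n).le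
            gcongr
        _ = √(ε n) * ((√(ε n) * ‖W n α t‖) * ‖v‖) := by
            nth_rewrite 1 [← Real.mul_self_sqrt (hε n).le]; ring
        _ ≤ _ := by gcongr
    have h1 := (hulim α t ht (E.ι v)).add hsmall
    have h2 := (hdrift (hmemind _ measurableSet_Iio) α v (ζ := (Set.Iio t).indicator 1)).const_add
      (if α = 0 then inner ℝ E.u₀ (E.ι v) else 0)
    have key : ∀ f : ℝ → ℝ, ∫ r in (0 : ℝ)..t, f r
        = ∫ r, (Set.Iio t).indicator 1 r * f r ∂(timeMeasure T) := fun f => by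
      rw [intervalIntegral_eq_indicator ht]
      refine integral_congr_ae (Eventually.of_forall fun r => ?_)
      by_cases h : r ∈ Set.Iio t <;> simp [h]
    rw [key]
    rw [add_zero] at h1
    refine tendsto_nhds_unique h1 (h2.congr fun n => ?_)
    rw [← key]
    exact (E.regCoeff_eq (hε n) α t v).symm
  refine ⟨w, u, hwmem, hequ, fun α => ?_, fun s N t ht => ?_, fun hF hG s N t ht => ?_⟩
  · set Pr : ℝ → StrongDual ℝ X := fun t =>
      (if α = 0 then toDual E.ι E.u₀ else 0) + ∫ r in (0 : ℝ)..t, E.driftX w α r with hPr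
    have hPint : Integrable Pr (timeMeasure T) := by
      obtain ⟨y, hy, hy0⟩ := exists_isPrimitive_of_timeMeasure (E.integrable_driftX hwmem α)
      have hc := hy.continuous
      have h1 : Integrable y (timeMeasure T) :=
        (hc.integrableOn_Icc (a := 0) (b := T)).mono_set Set.Ioo_subset_Icc_self
      refine ((integrable_const (if α = 0 then toDual E.ι E.u₀ else 0)).add h1).congr ?_
      filter_upwards [ae_restrict_mem measurableSet_Ioo] with r hr
      rw [Pi.add_apply, hy0 r (Set.Ioo_subset_Icc_self hr)]
    have hwint : Integrable (fun r => toDual E.ι (E.ι (w α r))) (timeMeasure T) :=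
      ((toDual E.ι ∘L E.ι).comp_memLp' (hwmem α)).integrable one_le_two
    -- The limit in L₂((0,T); X) cannot be evaluated at a time. The regularized equations are
    -- therefore integrated over a measurable set S, and the iterated time integral becomes ∫ z ·
    -- drift, to which weak convergence applies.
    have hae : Pr =ᵐ[timeMeasure T] fun r => toDual E.ι (E.ι (w α r)) := by
      refine hPint.ae_eq_of_forall_setIntegral_eq _ _ hwint fun S hS _ => ?_
      ext v
      set c : ℝ := if α = 0 then inner ℝ E.u₀ (E.ι v) else 0 with hc
      have hset : ∀ {f : ℝ → StrongDual ℝ X}, Integrable f (timeMeasure T) →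
          (∫ r in S, f r ∂(timeMeasure T)) v
            = ∫ r, S.indicator 1 r * f r v ∂(timeMeasure T) := fun {f} hf => by
        rw [ContinuousLinearMap.integral_apply hf.integrableOn, ← integral_indicator hS]
        refine integral_congr_ae (Eventually.of_forall fun r => ?_)
        by_cases h : r ∈ S <;> simp [h]
      obtain ⟨z, hz, hzD⟩ := exists_adjoint_primitive hT hS
      have hmeas1 : Integrable (S.indicator (1 : ℝ → ℝ)) (timeMeasure T) :=
        (integrable_const (1 : ℝ)).indicator hS
      have hsplit : ∀ {w' : MultiIndex → ℝ → X}, (∀ α, MemLp (w' α) 2 (timeMeasure T)) →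
          ∫ r, S.indicator 1 r * (c + ∫ q in (0 : ℝ)..r, E.drift w' α v q) ∂(timeMeasure T)
          = c * (∫ r, S.indicator 1 r ∂(timeMeasure T))
            + ∫ r, z r * E.drift w' α v r ∂(timeMeasure T) := fun {w'} hw' => by
        rw [← hzD _ (E.integrable_drift hw' α v), ← integral_const_mul, ← integral_add]
        · refine integral_congr_ae (Eventually.of_forall fun r => ?_)
          simp only []
          ring
        · exact hmeas1.const_mul c
        · obtain ⟨y, hy, hy0⟩ := exists_isPrimitive_of_timeMeasure (E.integrable_drift hw' α v)
          have hcy := hy.continuous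
          have h1 : Integrable y (timeMeasure T) :=
            (hcy.integrableOn_Icc (a := 0) (b := T)).mono_set Set.Ioo_subset_Icc_self
          refine (h1.indicator hS).congr ?_
          filter_upwards [ae_restrict_mem measurableSet_Ioo] with r hr
          rw [← hy0 r (Set.Ioo_subset_Icc_self hr)]
          by_cases h : r ∈ S <;> simp [h]
      have hk : ∀ x : X, MemLp (fun r => S.indicator (1 : ℝ → ℝ) r • x) 2 (timeMeasure T) :=
        fun x => MemLp.smul (p := ∞) (q := 2) (r := 2) (memLp_const x) (hmemind S hS)
      have hinner : ∀ (x : X) (ψ : StrongDual ℝ X),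
          inner ℝ x ((InnerProductSpace.toDual ℝ X).symm ψ) = ψ x := fun x ψ => by
        rw [real_inner_comm, InnerProductSpace.toDual_symm_apply]
      have l1 := hwlim α _ (hk ((InnerProductSpace.toDual ℝ X).symm (toDual E.ι (E.ι v) )))
      have l2 := hε0.mul (hwlim α _ (hk v))
      have l3 := (hdrift hz α v).const_add (c * (∫ r, S.indicator 1 r ∂(timeMeasure T)))
      rw [zero_mul] at l2
      have l4 := l1.add l2
      rw [add_zero] at l4
      rw [hset hPint, hset hwint]
      have e1 : ∫ r, S.indicator 1 r * Pr r v ∂(timeMeasure T)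
          = c * (∫ r, S.indicator 1 r ∂(timeMeasure T))
            + ∫ r, z r * E.drift w α v r ∂(timeMeasure T) := by
        rw [← hsplit hwmem]
        refine integral_congr_ae ?_
        filter_upwards [ae_restrict_mem measurableSet_Ioo] with r hr
        rw [hPr, add_apply, E.integral_driftX_apply hwmem α (Set.Ioo_subset_Icc_self hr)]
        congr 2
        rw [hc]
        split_ifs <;> rfl
      have e2 : ∫ r, S.indicator 1 r * toDual E.ι (E.ι (w α r)) v ∂(timeMeasure T)
          = ∫ r, inner ℝ (w α r) (S.indicator (1 : ℝ → ℝ) r •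
            (InnerProductSpace.toDual ℝ X).symm (toDual E.ι (E.ι v))) ∂(timeMeasure T) := by
        refine integral_congr_ae (Eventually.of_forall fun r => ?_)
        simp only [real_inner_smul_right, hinner, toDual_apply]
        rw [real_inner_comm]
      rw [e1, e2]
      refine tendsto_nhds_unique l3 (l4.congr fun n => ?_)
      rw [← hsplit (hWmem n), ← integral_const_mul, ← integral_add]
      · refine integral_congr_ae (Eventually.of_forall fun r => ?_)
        have h := E.regCoeff_eq (hε n) α r v
        simp only [real_inner_smul_right, hinner, toDual_apply]
        rw [hc, ← h, real_inner_comm]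
        ring
      · exact ((hWmem n α).norm.integrable_mul (hk _).norm).mono'
          ((hWmem n α).1.inner (hk _).1) (Eventually.of_forall fun _ => norm_inner_le_norm _ _)
      · exact (((hWmem n α).norm.integrable_mul (hk _).norm).mono'
          ((hWmem n α).1.inner (hk _).1)
          (Eventually.of_forall fun _ => norm_inner_le_norm _ _)).const_mul _
    filter_upwards [hae, ae_restrict_mem measurableSet_Ioo] with r hr hr2
    rw [← hr, hequ α r (Set.Ioo_subset_Icc_self hr2)]
  · rw [Finset.sum_sigma']
    refine norm_sum_le_of_weak_limit 𝒰 _ (c := fun i : Σ _ : ℕ, MultiIndex => multiFactorial i.2)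
      (fun i => (multiFactorial_pos _).le) (x := fun i n => E.ι (W n i.2 t))
      (x' := fun i => u i.2 t) (fun i _ y => hulim i.2 t ht y) fun n => ?_
    refine le_trans ?_ (E.reg_energy_le (hε n) s N ht.1)
    rw [E.reg_energy_eq, Finset.sum_sigma']
    refine Finset.sum_le_sum fun i _ => mul_le_mul_of_nonneg_left ?_ (multiFactorial_pos _).le
    exact le_add_of_nonneg_right (mul_nonneg (hε n).le (sq_nonneg _))
  · rw [Finset.sum_sigma']
    refine norm_sum_le_of_weak_limit 𝒰 _ (c := fun i : Σ _ : ℕ, MultiIndex => multiFactorial i.2)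
      (fun i => (multiFactorial_pos _).le) (x := fun i n => E.ι (W n i.2 t))
      (x' := fun i => u i.2 t) (fun i _ y => hulim i.2 t ht y) fun n => ?_
    refine le_trans ?_ (E.reg_energy_le_of_eq_zero (hε n) hF hG s N ht.1)
    rw [E.reg_energy_eq, Finset.sum_sigma']
    refine Finset.sum_le_sum fun i _ => mul_le_mul_of_nonneg_left ?_ (multiFactorial_pos _).le
    exact le_add_of_nonneg_right (mul_nonneg (hε n).le (sq_nonneg _))

end ParabolicData

end ColoredChaos

/-! ### Uniqueness. -/

namespace ColoredChaos

variable {X H : Type*} [NormedAddCommGroup X] [InnerProductSpace ℝ X]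
  [NormedAddCommGroup H] [InnerProductSpace ℝ H]

theorem IsNormalTriple.toDual_injective {ι : X →L[ℝ] H} (hι : IsNormalTriple ι) :
    Function.Injective (toDual ι) := by
  refine (injective_iff_map_eq_zero _).2 fun y hy => ?_
  refine hι.denseRange.eq_zero_of_inner_left (𝕜 := ℝ) fun x => ?_
  exact DFunLike.congr_fun hy x

theorem IsPrimitive.nonpos_of_le_mul {y y' : ℝ → ℝ} (hy : IsPrimitive y y') (h0 : y 0 = 0) {c : ℝ}
    (h : ∀ᵐ r, y' r ≤ c * y r) {t : ℝ} (ht : 0 ≤ t) : y t ≤ 0 := by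
  have h1 := (isPrimitive_exp_mul (-c)).mul hy
  have h2 := h1.sub_eq 0 t
  have h3 : ∫ r in (0 : ℝ)..t, (-c * Real.exp (-c * r) * y r + Real.exp (-c * r) * y' r)
      ≤ ∫ r in (0 : ℝ)..t, (0 : ℝ) := by
    refine intervalIntegral.integral_mono_ae ht (h1.intervalIntegrable 0 t)
      intervalIntegrable_const ?_
    filter_upwards [h] with r hr
    have := mul_le_mul_of_nonneg_left hr (Real.exp_pos (-c * r)).le
    linarith
  rw [intervalIntegral.integral_zero, ← h2, h0, mul_zero, sub_zero] at h3
  exact nonpos_of_mul_nonpos_right h3 (Real.exp_pos _)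

/-- The homogeneous parabolic equation with zero initial value has only the zero solution. -/
theorem ae_eq_zero_of_parabolic [CompleteSpace X] [CompleteSpace H] {ι : X →L[ℝ] H}
    (hι : IsNormalTriple ι)
    {A : X →L[ℝ] StrongDual ℝ X} {c : ℝ} (hc : 0 ≤ c) (hA : ∀ v, 2 * A v v ≤ c * ‖ι v‖ ^ 2) {T : ℝ}
    {d : ℝ → X} (hd : Integrable d (timeMeasure T))
    (h : ∀ᵐ s ∂(timeMeasure T), toDual ι (ι (d s)) = ∫ r in (0 : ℝ)..s, A (d r)) :
    d =ᵐ[timeMeasure T] 0 := by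
  -- The energy is estimated for the primitive D of d. The equation reads d = A D in X', so the
  -- derivative of ‖ι D‖² is 2⟨A D, D⟩ ≤ c ‖ι D‖². This uses only the product rule in H, not one for
  -- functions with derivatives in X'.
  obtain ⟨D, hD, hD0⟩ := exists_isPrimitive_of_timeMeasure hd
  have hAD : ∀ s ∈ Set.Ioo 0 T, ∫ r in (0 : ℝ)..s, A (d r) = A (D s) := fun s hs => by
    have hs' := Set.Ioo_subset_Icc_self hs
    rw [hD0 s hs', ContinuousLinearMap.intervalIntegral_comp_comm]
    exact intervalIntegrable_of_timeMeasure hd (Set.left_mem_Icc.2 (hs'.1.trans hs'.2)) hs'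
  have h1 : ∀ᵐ s ∂(timeMeasure T), toDual ι (ι (d s)) = A (D s) := by
    filter_upwards [h, ae_restrict_mem measurableSet_Ioo] with s hs hs2
    rw [hs, hAD s hs2]
  rcases le_or_gt T 0 with hT | hT
  · have : timeMeasure T = 0 := by
      rw [timeMeasure, Set.Ioo_eq_empty (not_lt.2 hT), Measure.restrict_empty]
    rw [this]
    exact ae_zero.le trivial
  have hιD := hD.clm_comp ι
  have hE := hιD.bilin (innerForm H) hιD
  simp only [innerForm_apply] at hE
  have h2 : ∀ᵐ r : ℝ, inner ℝ (ι ((Set.Ioo 0 T).indicator d r)) (ι (D r))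
      + inner ℝ (ι (D r)) (ι ((Set.Ioo 0 T).indicator d r))
      ≤ c * inner ℝ (ι (D r)) (ι (D r)) := by
    have h1' := (ae_restrict_iff' measurableSet_Ioo).1 h1
    filter_upwards [h1'] with r hr
    by_cases hr2 : r ∈ Set.Ioo 0 T
    · rw [Set.indicator_of_mem hr2, real_inner_comm (ι (d r)), real_inner_self_eq_norm_sq,
        ← toDual_apply ι (ι (d r)), hr hr2, ← two_mul]
      exact hA (D r)
    · rw [Set.indicator_of_notMem hr2, map_zero, inner_zero_left, inner_zero_right,
        real_inner_self_eq_norm_sq, add_zero]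
      positivity
  have hD00 : D 0 = 0 := by
    rw [hD0 0 ⟨le_rfl, hT.le⟩, intervalIntegral.integral_same]
  have h3 : ∀ t, 0 ≤ t → D t = 0 := fun t ht => by
    have := hE.nonpos_of_le_mul (by rw [hD00, map_zero, inner_zero_left]) h2 ht
    rw [real_inner_self_nonpos] at this
    exact hι.injective (this.trans (map_zero ι).symm)
  filter_upwards [h1, ae_restrict_mem measurableSet_Ioo] with s hs hs2
  rw [h3 s hs2.1.le, map_zero] at hs
  have := hι.toDual_injective (hs.trans (map_zero _).symm)
  exact hι.injective (this.trans (map_zero ι).symm)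

/-- By induction on the degree the noise terms of two solutions coincide, so their difference solves
the homogeneous equation. Almost everywhere equality of the functions w then yields equality of u at
every time, since the integral equation determines u from w. -/
theorem IsChaosSolution.unique [CompleteSpace X] [CompleteSpace H] {ι : X →L[ℝ] H}
    (hι : IsNormalTriple ι)
    {A : X →L[ℝ] StrongDual ℝ X} {c : ℝ} (hc : 0 ≤ c) (hA : ∀ v, 2 * A v v ≤ c * ‖ι v‖ ^ 2)
    {Ω : Type*} [MeasurableSpace Ω] {P : Measure Ω} {T : ℝ}
    {ξ : MultiIndex → Ω → ℝ} {h : ℕ → L2T T} {K : ℕ → L2T T →L[ℝ] L2T T}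
    {B : ℕ → X →L[ℝ] StrongDual ℝ X}
    {u₀ : Ω → StrongDual ℝ X} {F : Ω → ℝ → StrongDual ℝ X} {G : ℕ → Ω → ℝ → StrongDual ℝ X}
    (hF : ∀ α, Integrable (fun s => ∫ ω, ξ α ω • F ω s ∂P) (timeMeasure T))
    {u u' : MultiIndex → Set.Icc 0 T → StrongDual ℝ X}
    (hu : IsChaosSolution P ξ h K ι A B u₀ F G u)
    (hu' : IsChaosSolution P ξ h K ι A B u₀ F G u') : u = u' := by
  obtain ⟨w, hw, hwu, he⟩ := hu
  obtain ⟨w', hw', hwu', he'⟩ := hu'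
  have hsum : ∀ α : MultiIndex, (∀ p ∈ α.support,
      w (α - Finsupp.single p 1) =ᵐ[timeMeasure T] w' (α - Finsupp.single p 1)) →
      ∀ t : Set.Icc 0 T, u α t - u' α t = ∫ s in (0 : ℝ)..t, A (w α s - w' α s) := by
    intro α hα t
    have hsame : (α.sum fun kl n => √(n : ℝ) • ∫ s in (0 : ℝ)..t, (K kl.2 (h kl.1) s) •
          (B kl.2 (w (α - Finsupp.single kl 1) s)
            + ∫ ω, ξ (α - Finsupp.single kl 1) ω • G kl.2 ω s ∂P))
        = α.sum fun kl n => √(n : ℝ) • ∫ s in (0 : ℝ)..t, (K kl.2 (h kl.1) s) •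
          (B kl.2 (w' (α - Finsupp.single kl 1) s)
            + ∫ ω, ξ (α - Finsupp.single kl 1) ω • G kl.2 ω s ∂P) := by
      refine Finset.sum_congr rfl fun p hp => congrArg _ ?_
      refine intervalIntegral_congr_timeMeasure t.2 ?_
      filter_upwards [hα p hp] with s hs
      rw [hs]
    have hi : ∀ {v : MultiIndex → ℝ → X}, MemLp (v α) 2 (timeMeasure T) →
        IntervalIntegrable (fun s => A (v α s) + ∫ ω, ξ α ω • F ω s ∂P) volume 0 t := fun hv =>
      intervalIntegrable_of_timeMeasure
        (((A.comp_memLp' hv).integrable one_le_two).add (hF α))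
        (Set.left_mem_Icc.2 (t.2.1.trans t.2.2)) t.2
    rw [he α t, he' α t, hsame, add_sub_add_right_eq_sub, add_sub_add_left_eq_sub,
      ← intervalIntegral.integral_sub (hi (hw α)) (hi (hw' α))]
    refine intervalIntegral.integral_congr fun s _ => ?_
    simp only [map_sub]
    abel
  have hae : ∀ α, w α =ᵐ[timeMeasure T] w' α := by
    intro α
    induction hn : α.degree using Nat.strong_induction_on generalizing α with
    | _ n ih =>
    have h1 := hsum α fun p hp => ih _ (by
      rw [← hn]
      have := congrArg Finsupp.degree (sub_single_add_single hp)
      rw [map_add, Finsupp.degree_single] at this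
      omega) _ rfl
    have h2 := ae_eq_zero_of_parabolic hι hc hA (((hw α).sub (hw' α)).integrable one_le_two) (by
      filter_upwards [hwu α, hwu' α, ae_restrict_mem measurableSet_Ioo] with s h3 h4 hs
      have hs' := Set.Ioo_subset_Icc_self hs
      have h5 := h1 ⟨s, hs'⟩
      rw [h3 hs', h4 hs', ← map_sub, ← map_sub] at h5
      exact h5)
    filter_upwards [h2] with s hs
    exact sub_eq_zero.1 hs
  ext1 α
  ext1 t
  refine sub_eq_zero.1 ((hsum α (fun p _ => hae _) t).trans ?_)
  refine (intervalIntegral_congr_timeMeasure t.2 (g := fun _ => 0) ?_).trans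
    intervalIntegral.integral_zero
  filter_upwards [hae α] with s hs
  rw [hs, sub_self, map_zero]

end ColoredChaos

namespace ColoredChaos

/-! ### Random variables with moments of all orders -/

section Moments

variable {Ω : Type*} [MeasurableSpace Ω] {P : Measure Ω}

theorem memLp_mul_of_forall {f g : Ω → ℝ} (hf : ∀ n : ℕ, MemLp f n P) (hg : ∀ n : ℕ, MemLp g n P)
    (n : ℕ) : MemLp (fun ω => f ω * g ω) n P := by
  have : ENNReal.HolderTriple ((2 * n : ℕ) : ℝ≥0∞) ((2 * n : ℕ) : ℝ≥0∞) n := ⟨by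
    rw [Nat.cast_mul, ENNReal.mul_inv (by simp) (by simp), ← add_mul, Nat.cast_ofNat,
      ENNReal.inv_two_add_inv_two, one_mul]⟩
  exact (hg (2 * n)).mul (hf (2 * n))

theorem memLp_prod_of_forall {κ : Type*} [IsFiniteMeasure P] (s : Finset κ) {f : κ → Ω → ℝ}
    (hf : ∀ i ∈ s, ∀ n : ℕ, MemLp (f i) n P) : ∀ n : ℕ, MemLp (fun ω => ∏ i ∈ s, f i ω) n P := by
  classical
  induction s using Finset.induction_on with
  | empty => intro n; simpa using memLp_const (1 : ℝ)
  | insert a s ha ih =>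
    intro n
    simp only [Finset.prod_insert ha]
    exact memLp_mul_of_forall (hf a (Finset.mem_insert_self a s))
      (ih fun i hi => hf i (Finset.mem_insert_of_mem hi)) n

theorem memLp_aeval_of_forall [IsFiniteMeasure P] {f : Ω → ℝ} (hf : ∀ n : ℕ, MemLp f n P)
    (p : Polynomial ℤ) : ∀ n : ℕ, MemLp (fun ω => Polynomial.aeval (f ω) p) n P := by
  induction p using Polynomial.induction_on' with
  | add p q hp hq =>
    intro n
    simp only [map_add]
    exact (hp n).add (hq n)
  | monomial k a =>
    intro n
    simp only [Polynomial.aeval_monomial]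
    refine memLp_mul_of_forall (fun m => memLp_const _) ?_ n
    have := memLp_prod_of_forall (Finset.range k) (f := fun _ => f) (fun _ _ => hf)
    simpa using this

end Moments

/-! ### Orthogonality of the Hermite polynomials -/

theorem integrable_aeval_gaussianReal (p : Polynomial ℤ) :
    Integrable (fun x : ℝ => Polynomial.aeval x p) (gaussianReal 0 1) :=
  memLp_one_iff_integrable.1 (by
    simpa using memLp_aeval_of_forall (f := id)
      (fun n => memLp_id_gaussianReal' (n : ℝ≥0∞) (ENNReal.natCast_ne_top n)) p 1)

theorem integrable_aeval_mul_gaussianPDFReal (p : Polynomial ℤ) :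
    Integrable (fun x : ℝ => gaussianPDFReal 0 1 x * Polynomial.aeval x p) volume := by
  have h := integrable_aeval_gaussianReal p
  rw [gaussianReal_of_var_ne_zero 0 one_ne_zero,
    integrable_withDensity_iff_integrable_smul' (measurable_gaussianPDF 0 1)
      (Eventually.of_forall fun _ => gaussianPDF_lt_top)] at h
  simpa only [toReal_gaussianPDF, smul_eq_mul] using h

theorem hasDerivAt_gaussianPDFReal (x : ℝ) :
    HasDerivAt (gaussianPDFReal 0 1) (-x * gaussianPDFReal 0 1 x) x := by
  have h : HasDerivAt (fun y : ℝ => -(y - 0) ^ 2 / (2 * ((1 : ℝ≥0) : ℝ))) (-x) x := by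
    have h1 := (((hasDerivAt_id x).sub_const 0).pow 2).neg.div_const (2 * ((1 : ℝ≥0) : ℝ))
    refine h1.congr_deriv ?_
    simp
    ring
  have h2 := h.exp.const_mul ((√(2 * Real.pi * ((1 : ℝ≥0) : ℝ)))⁻¹)
  refine h2.congr_deriv ?_
  rw [gaussianPDFReal]
  ring

/-- Integration by parts with respect to the standard Gaussian measure. -/
theorem integral_mul_aeval_gaussianReal (p : Polynomial ℤ) :
    ∫ x, Polynomial.aeval x (Polynomial.X * p) ∂(gaussianReal 0 1)
      = ∫ x, Polynomial.aeval x (Polynomial.derivative p) ∂(gaussianReal 0 1) := by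
  have hd : ∀ x : ℝ, HasDerivAt (fun y => gaussianPDFReal 0 1 y * Polynomial.aeval y p)
      (gaussianPDFReal 0 1 x * Polynomial.aeval x (Polynomial.derivative p)
        - gaussianPDFReal 0 1 x * Polynomial.aeval x (Polynomial.X * p)) x := fun x => by
    refine ((hasDerivAt_gaussianPDFReal x).mul (p.hasDerivAt_aeval x)).congr_deriv ?_
    rw [map_mul, Polynomial.aeval_X]
    ring
  have h := integral_eq_zero_of_hasDerivAt_of_integrable hd
    ((integrable_aeval_mul_gaussianPDFReal _).sub (integrable_aeval_mul_gaussianPDFReal _))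
    (integrable_aeval_mul_gaussianPDFReal p)
  rw [integral_sub (integrable_aeval_mul_gaussianPDFReal _)
    (integrable_aeval_mul_gaussianPDFReal _), sub_eq_zero] at h
  rw [integral_gaussianReal_eq_integral_smul one_ne_zero,
    integral_gaussianReal_eq_integral_smul one_ne_zero]
  exact h.symm

theorem derivative_hermite_succ (n : ℕ) : Polynomial.derivative (Polynomial.hermite (n + 1))
    = (n + 1 : ℤ) • Polynomial.hermite n := by
  induction n with
  | zero => simp
  | succ n ih =>
    rw [Polynomial.hermite_succ (n + 1), Polynomial.derivative_sub, Polynomial.derivative_mul,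
      Polynomial.derivative_X, ih, Polynomial.derivative_smul]
    rw [one_mul, mul_smul_comm, add_sub_assoc, ← smul_sub, ← Polynomial.hermite_succ, add_comm,
      ← add_one_zsmul]
    push_cast
    rfl

/-- The recursion H_{n+1} = x H_n - H_n' and Gaussian integration by parts move one derivative to
the other factor. Since H_{m+1}' = (m+1) H_m, both indices drop together until one of them is zero.
-/
theorem integral_hermite_mul_hermite (n m : ℕ) :
    ∫ x, Polynomial.aeval x (Polynomial.hermite n) * Polynomial.aeval x (Polynomial.hermite m)
      ∂(gaussianReal 0 1) = if n = m then (n.factorial : ℝ) else 0 := by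
  have hstep : ∀ n (q : Polynomial ℤ),
      ∫ x, Polynomial.aeval x (Polynomial.hermite (n + 1)) * Polynomial.aeval x q
        ∂(gaussianReal 0 1)
      = ∫ x, Polynomial.aeval x (Polynomial.hermite n) * Polynomial.aeval x
          (Polynomial.derivative q) ∂(gaussianReal 0 1) := by
    intro n q
    have h := integral_mul_aeval_gaussianReal (Polynomial.hermite n * q)
    rw [Polynomial.derivative_mul] at h
    have e : ∀ x : ℝ, Polynomial.aeval x (Polynomial.hermite (n + 1)) * Polynomial.aeval x q
        = Polynomial.aeval x (Polynomial.X * (Polynomial.hermite n * q))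
          - Polynomial.aeval x (Polynomial.derivative (Polynomial.hermite n) * q) := fun x => by
      rw [Polynomial.hermite_succ]
      simp only [map_mul, map_sub]
      ring
    simp only [e]
    rw [integral_sub (integrable_aeval_gaussianReal _) (integrable_aeval_gaussianReal _), h]
    simp only [map_add]
    rw [integral_add (integrable_aeval_gaussianReal _) (integrable_aeval_gaussianReal _)]
    simp only [map_mul]
    ring
  induction n generalizing m with
  | zero =>
    cases m with
    | zero => simp
    | succ m =>
      simp only [mul_comm (Polynomial.aeval _ (Polynomial.hermite 0))]
      rw [hstep]
      simp
  | succ n ih =>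
    rw [hstep]
    cases m with
    | zero => simp
    | succ m =>
      rw [derivative_hermite_succ]
      have e : ∀ x : ℝ, Polynomial.aeval x (Polynomial.hermite n)
          * Polynomial.aeval x ((m + 1 : ℤ) • Polynomial.hermite m)
          = (m + 1 : ℝ) * (Polynomial.aeval x (Polynomial.hermite n)
            * Polynomial.aeval x (Polynomial.hermite m)) := fun x => by
        rw [map_zsmul, zsmul_eq_mul]
        push_cast
        ring
      simp only [e]
      rw [integral_const_mul, ih]
      by_cases h : n = m
      · subst h
        simp [Nat.factorial_succ]
      · simp [h]

end ColoredChaos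

namespace ColoredChaos

/-! ### Wiener integrals -/

theorem inner_chi {T : ℝ} {s t : ℝ} (hs : s ∈ Set.Icc 0 T) (ht : t ∈ Set.Icc 0 T) :
    inner ℝ (chi T s) (chi T t) = min s t := by
  have h0 : 0 ≤ min s t := le_min hs.1 ht.1
  rw [chi, chi, L2.real_inner_indicatorConstLp_one_indicatorConstLp_one, Set.Icc_inter_Icc, sup_idem,
    timeMeasure, measureReal_restrict_apply measurableSet_Icc,
    measureReal_congr (s := Set.Icc 0 (min s t) ∩ Set.Ioo 0 T) (t := Set.Icc 0 (min s t))]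
  · rw [Real.volume_real_Icc_of_le h0, sub_zero]
  · have h1 : (Set.Icc (0 : ℝ) (min s t) ∩ Set.Icc 0 T : Set ℝ) = Set.Icc 0 (min s t) :=
      Set.inter_eq_left.2 (Set.Icc_subset_Icc_right ((min_le_left _ _).trans hs.2))
    have h2 := (ae_eq_refl (Set.Icc (0 : ℝ) (min s t))).inter
      (Ioo_ae_eq_Icc (μ := volume) (a := (0 : ℝ)) (b := T))
    rwa [h1] at h2

/-- The hypothesis says that the primitive of f vanishes on [0,T], and Lebesgue differentiation
concludes. This is the density of step functions. -/
theorem eq_zero_of_inner_chi {T : ℝ} (f : L2T T)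
    (hf : ∀ t ∈ Set.Icc 0 T, inner ℝ (chi T t) f = 0) : f = 0 := by
  have hint : Integrable f (timeMeasure T) := (Lp.memLp f).integrable one_le_two
  obtain ⟨y, hy, hy0⟩ := exists_isPrimitive_of_timeMeasure hint
  have hz : ∀ t ∈ Set.Icc 0 T, y t = 0 := fun t ht => by
    have h := hf t ht
    rw [chi, L2.inner_indicatorConstLp_one] at h
    rw [hy0 t ht, intervalIntegral_eq_indicator ht, integral_indicator measurableSet_Iio, ← h]
    refine setIntegral_congr_set ?_
    have h1 : (Set.Ioo 0 t : Set ℝ) =ᵐ[timeMeasure T] Set.Icc 0 t :=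
      ae_restrict_of_ae Ioo_ae_eq_Icc
    refine Filter.EventuallyEq.trans ?_ h1
    filter_upwards [ae_restrict_mem measurableSet_Ioo] with r hr
    exact propext ⟨fun h => ⟨hr.1, h⟩, fun h => h.2⟩
  have hloc : LocallyIntegrable ((Set.Ioo 0 T).indicator f) volume :=
    ((integrable_indicator_iff measurableSet_Ioo).2 hint).locallyIntegrable
  refine (Lp.eq_zero_iff_ae_eq_zero).2 ?_
  refine (ae_restrict_iff' measurableSet_Ioo).2 ?_
  filter_upwards [LocallyIntegrable.ae_hasDerivAt_integral hloc] with x hx hxT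
  have h1 := hx 0
  have h2 : (fun x => ∫ t in (0 : ℝ)..x, (Set.Ioo 0 T).indicator f t) =ᶠ[𝓝 x] fun _ => 0 := by
    filter_upwards [isOpen_Ioo.mem_nhds hxT] with r hr
    rw [← hy.sub_eq, hz r (Set.Ioo_subset_Icc_self hr),
      hz 0 ⟨le_rfl, (hr.1.trans hr.2).le⟩, sub_zero]
  have h3 := h1.unique ((hasDerivAt_const x (0 : ℝ)).congr_of_eventuallyEq h2)
  rwa [Set.indicator_of_mem hxT] at h3

section Wiener

variable {Ω : Type*} [MeasurableSpace Ω] {P : Measure Ω} {T : ℝ}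

/-- The pairs of a step function and its Wiener integral. -/
noncomputable def stepGraph (P : Measure Ω) (T : ℝ) (W : ℝ≥0 → Ω → ℝ) : Submodule ℝ (L2T T × Lp ℝ 2 P) :=
  Submodule.span ℝ
    {p : L2T T × Lp ℝ 2 P | ∃ t : ℝ≥0, (t : ℝ) ≤ T ∧ p.1 = chi T t ∧ p.2 =ᵐ[P] W t}

theorem exists_of_mem_stepGraph {W : ℝ≥0 → Ω → ℝ} {p : L2T T × Lp ℝ 2 P}
    (hp : p ∈ stepGraph P T W) : ∃ (n : ℕ) (c : Fin n → ℝ) (t : Fin n → ℝ≥0),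
      (∀ i, (t i : ℝ) ≤ T) ∧ p.1 = ∑ i, c i • chi T (t i) ∧
      p.2 =ᵐ[P] fun ω => ∑ i, c i * W (t i) ω := by
  obtain ⟨n, c, g, rfl⟩ := Submodule.mem_span_set'.1 hp
  choose t ht h1 h2 using fun i => (g i).2
  refine ⟨n, c, t, ht, ?_, ?_⟩
  · rw [Prod.fst_sum]
    exact Finset.sum_congr rfl fun i _ => by rw [Prod.smul_fst, h1]
  · rw [Prod.snd_sum]
    refine (Lp.coeFn_finsetSum _ _).trans ?_
    have h3 : ∀ᵐ ω ∂P, ∀ i, (c i • (g i : L2T T × Lp ℝ 2 P)).2 ω = c i * W (t i) ω := by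
      refine ae_all_iff.2 fun i => ?_
      filter_upwards [Lp.coeFn_smul (c i) (g i : L2T T × Lp ℝ 2 P).2, h2 i] with ω h4 h5
      rw [Prod.smul_snd, h4, Pi.smul_apply, h5, smul_eq_mul]
    filter_upwards [h3] with ω hω
    simp only [Finset.sum_apply]
    exact Finset.sum_congr rfl fun i _ => hω i

theorem hasGaussianLaw_sum_brownian {W : ℝ≥0 → Ω → ℝ} (hW : IsPreBrownianReal W P) {n : ℕ}
    (c : Fin n → ℝ) (t : Fin n → ℝ≥0) : HasGaussianLaw (fun ω => ∑ i, c i * W (t i) ω) P :=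
  ((hW.isGaussianProcess.comp_right t).smul c).hasGaussianLaw_fun_sum (I := Finset.univ)

theorem integral_sum_brownian {W : ℝ≥0 → Ω → ℝ} (hW : IsPreBrownianReal W P) {n : ℕ}
    (c : Fin n → ℝ) (t : Fin n → ℝ≥0) : ∫ ω, ∑ i, c i * W (t i) ω ∂P = 0 := by
  rw [integral_finsetSum _ fun i _ => (hW.integrable_eval (t i)).const_mul _]
  refine Finset.sum_eq_zero fun i _ => ?_
  rw [integral_const_mul, hW.integral_eval, mul_zero]

theorem variance_sum_brownian {W : ℝ≥0 → Ω → ℝ} (hW : IsPreBrownianReal W P) {n : ℕ}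
    (c : Fin n → ℝ) (t : Fin n → ℝ≥0) (ht : ∀ i, (t i : ℝ) ≤ T) :
    Var[fun ω => ∑ i, c i * W (t i) ω; P] = ‖∑ i, c i • chi T (t i)‖ ^ 2 := by
  have hP := hW.isGaussianProcess.isProbabilityMeasure
  have hmem : ∀ i, MemLp (fun ω => c i * W (t i) ω) 2 P := fun i =>
    (hW.isGaussianProcess.hasGaussianLaw_eval (t i)).memLp_two.const_mul _
  rw [← covariance_self (hasGaussianLaw_sum_brownian hW c t).aemeasurable,
    covariance_fun_sum_fun_sum hmem hmem, ← real_inner_self_eq_norm_sq, sum_inner]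
  refine Finset.sum_congr rfl fun i _ => ?_
  rw [inner_sum]
  refine Finset.sum_congr rfl fun j _ => ?_
  rw [covariance_const_mul_left, covariance_const_mul_right, real_inner_smul_left,
    real_inner_smul_right, inner_chi (s := (t i : ℝ)) (t := (t j : ℝ)) ⟨(t i).2, ht i⟩ ⟨(t j).2, ht j⟩]
  have := hW.covariance_fun_eval (t i) (t j)
  rw [this, NNReal.coe_min]

/-- For step functions this is the covariance min(s,t) of Brownian motion, which is also the inner
product of χ_s and χ_t. The condition is closed, so it extends to the closure. -/
theorem norm_eq_of_mem_wienerGraph {W : ℝ≥0 → Ω → ℝ} (hW : IsPreBrownianReal W P)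
    {p : L2T T × Lp ℝ 2 P} (hp : p ∈ wienerGraph P T W) : ‖p.2‖ = ‖p.1‖ := by
  have hclosed : IsClosed {p : L2T T × Lp ℝ 2 P | ‖p.2‖ = ‖p.1‖} :=
    isClosed_eq continuous_snd.norm continuous_fst.norm
  have hp' : p ∈ closure (stepGraph P T W : Set (L2T T × Lp ℝ 2 P)) := hp
  refine closure_minimal (fun q hq => ?_) hclosed hp'
  obtain ⟨n, c, t, ht, h1, h2⟩ := exists_of_mem_stepGraph hq
  refine (sq_eq_sq₀ (norm_nonneg _) (norm_nonneg _)).1 ?_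
  rw [h1, ← variance_sum_brownian hW c t ht, variance_of_integral_eq_zero
    (hasGaussianLaw_sum_brownian hW c t).aemeasurable (integral_sum_brownian hW c t),
    ← real_inner_self_eq_norm_sq, L2.inner_def]
  refine integral_congr_ae ?_
  filter_upwards [h2] with ω hω
  rw [hω, real_inner_self_eq_norm_sq, Real.norm_eq_abs, sq_abs]

/-- `wienerIntegral` is a choice, so a partner of f in the graph must exist. The projection of the
graph to L₂((0,T)) is isometric, hence has closed range since the graph is complete, and the range
is dense because it contains every χ_t. -/
theorem wienerIntegral_mem {W : ℝ≥0 → Ω → ℝ} (hW : IsPreBrownianReal W P) (f : L2T T) :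
    (f, wienerIntegral P T W f) ∈ wienerGraph P T W := by
  suffices h : ∃ η, (f, η) ∈ wienerGraph P T W from Classical.epsilon_spec h
  have hcomplete : CompleteSpace (wienerGraph P T W) :=
    (Submodule.isClosed_topologicalClosure _).completeSpace_coe
  let L : wienerGraph P T W →ₗᵢ[ℝ] L2T T :=
    { toLinearMap := (LinearMap.fst ℝ _ _).domRestrict _
      norm_map' := fun p => by
        have h := norm_eq_of_mem_wienerGraph hW p.2
        change ‖p.1.1‖ = ‖p.1‖
        rw [Prod.norm_def, h, max_self] }
  have hrange : IsClosed (Set.range L) := L.isometry.isClosedEmbedding.isClosed_range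
  have hdense : (LinearMap.range L.toLinearMap).topologicalClosure = ⊤ := by
    rw [Submodule.topologicalClosure_eq_top_iff, Submodule.eq_bot_iff]
    intro g hg
    refine eq_zero_of_inner_chi g fun t ht => ?_
    have hmem : MemLp (W ⟨t, ht.1⟩) 2 P :=
      (hW.isGaussianProcess.hasGaussianLaw_eval _).memLp_two
    refine (Submodule.mem_orthogonal _ _).1 hg _ ⟨⟨(chi T t, hmem.toLp _), ?_⟩, rfl⟩
    refine Submodule.le_topologicalClosure _ (Submodule.subset_span ?_)
    exact ⟨⟨t, ht.1⟩, ht.2, rfl, hmem.coeFn_toLp⟩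
  have htop : f ∈ (LinearMap.range L.toLinearMap).topologicalClosure := hdense ▸ trivial
  obtain ⟨p, hp⟩ := hrange.closure_subset htop
  exact ⟨p.1.2, by rw [← hp]; exact p.2⟩

end Wiener

end ColoredChaos

namespace ColoredChaos

/-! ### The joint law of the Wiener integrals -/

variable {Ω : Type*} [MeasurableSpace Ω] {P : Measure Ω}

theorem integral_norm_le_norm [IsProbabilityMeasure P] (η : Lp ℝ 2 P) : ∫ ω, ‖η ω‖ ∂P ≤ ‖η‖ := by
  rw [integral_norm_eq_lintegral_enorm (Lp.aestronglyMeasurable η),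
    ← eLpNorm_one_eq_lintegral_enorm, Lp.norm_def]
  exact ENNReal.toReal_mono (Lp.eLpNorm_ne_top η)
    (eLpNorm_le_eLpNorm_of_exponent_le one_le_two (Lp.aestronglyMeasurable η))

theorem integrable_exp_I_mul [IsFiniteMeasure P] {f : Ω → ℝ} (hf : AEMeasurable f P) :
    Integrable (fun ω => Complex.exp (Complex.I * f ω)) P := by
  refine (integrable_const (1 : ℝ)).mono' ?_ (Eventually.of_forall fun ω => ?_)
  · exact (Complex.continuous_exp.measurable.comp_aemeasurable
      ((Complex.measurable_ofReal.comp_aemeasurable hf).const_mul _)).aestronglyMeasurable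
  · rw [mul_comm, Complex.norm_exp_ofReal_mul_I]

/-- From |e^{ix} - e^{iy}| ≤ |x - y| the map is Lipschitz for the L₁ norm, hence for the L₂ norm.
This carries characteristic functions from step functions to their limits. -/
theorem continuous_integral_exp [IsProbabilityMeasure P] :
    Continuous fun η : Lp ℝ 2 P => ∫ ω, Complex.exp (Complex.I * η ω) ∂P := by
  refine (LipschitzWith.of_dist_le_mul (K := 1) fun η θ => ?_).continuous
  have hη := (Lp.aestronglyMeasurable η).aemeasurable
  have hθ := (Lp.aestronglyMeasurable θ).aemeasurable
  rw [dist_eq_norm, dist_eq_norm, NNReal.coe_one, one_mul,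
    ← integral_sub (integrable_exp_I_mul hη) (integrable_exp_I_mul hθ)]
  refine (norm_integral_le_integral_norm _).trans (le_trans ?_ (integral_norm_le_norm (η - θ)))
  refine integral_mono_ae ((integrable_exp_I_mul hη).sub (integrable_exp_I_mul hθ)).norm
    ((Lp.memLp (η - θ)).integrable one_le_two).norm ?_
  filter_upwards [Lp.coeFn_sub η θ] with ω hω
  rw [hω, Pi.sub_apply]
  have e : Complex.exp (Complex.I * η ω) - Complex.exp (Complex.I * θ ω)
      = Complex.exp (θ ω * Complex.I)
        * (Complex.exp (Complex.I * ((η ω - θ ω : ℝ) : ℂ)) - 1) := by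
    rw [mul_sub, ← Complex.exp_add, mul_one, mul_comm (θ ω : ℂ)]
    congr 2
    push_cast
    ring
  rw [e, norm_mul, Complex.norm_exp_ofReal_mul_I, one_mul]
  exact Real.norm_exp_I_mul_ofReal_sub_one_le

theorem integral_exp_of_hasGaussianLaw {f : Ω → ℝ} (hf : HasGaussianLaw f P) (h0 : ∫ ω, f ω ∂P = 0) :
    ∫ ω, Complex.exp (Complex.I * f ω) ∂P = Complex.exp (-(Var[f; P] / 2 : ℝ)) := by
  have h1 := charFun_apply_real (μ := P.map f) 1
  rw [integral_map hf.aemeasurable (by fun_prop), hf.map_eq_gaussianReal, charFun_gaussianReal,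
    h0] at h1
  rw [Real.coe_toNNReal _ (variance_nonneg _ _)] at h1
  have e : ∀ x : ℝ, Complex.I * (x : ℂ) = (1 : ℝ) * (x : ℂ) * Complex.I := fun x => by
    push_cast; ring
  simp only [e]
  rw [← h1]
  congr 1
  push_cast
  ring

variable {T : ℝ} {κ : Type*} [Fintype κ] {W : κ → ℝ≥0 → Ω → ℝ}

theorem integral_exp_of_mem_stepGraph (hW : ∀ k, IsPreBrownianReal (W k) P)
    (hind : iIndepFun (fun k ω t => W k t ω) P) {p : κ → L2T T × Lp ℝ 2 P}
    (hp : ∀ k, p k ∈ stepGraph P T (W k)) :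
    ∫ ω, Complex.exp (Complex.I * ((∑ k, (p k).2 : Lp ℝ 2 P) ω)) ∂P
      = Complex.exp (-((∑ k, ‖(p k).1‖ ^ 2) / 2 : ℝ)) := by
  choose n c t ht h1 h2 using fun k => exists_of_mem_stepGraph (hp k)
  have hind' : iIndepFun (fun k ω => ∑ i, c k i * W k (t k i) ω) P :=
    hind.comp (fun k x => ∑ i, c k i * x (t k i)) fun k => by fun_prop
  have hg := fun k => hasGaussianLaw_sum_brownian (hW k) (c k) (t k)
  have e : ∀ᵐ ω ∂P, Complex.exp (Complex.I * ((∑ k, (p k).2 : Lp ℝ 2 P) ω))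
      = ∏ k, Complex.exp (Complex.I * ((∑ i, c k i * W k (t k i) ω : ℝ) : ℂ)) := by
    filter_upwards [Lp.coeFn_finsetSum Finset.univ fun k => (p k).2, ae_all_iff.2 h2] with ω h3 h4
    rw [h3, Finset.sum_apply, ← Complex.exp_sum, ← Finset.mul_sum]
    simp only [h4]
    push_cast
    rfl
  rw [integral_congr_ae e]
  have h5 := iIndepFun.integral_fun_prod_comp (𝓧 := fun _ => ℝ)
    (X := fun k ω => ∑ i, c k i * W k (t k i) ω) hind' (fun k => (hg k).aemeasurable)
    (f := fun _ x => Complex.exp (Complex.I * (x : ℂ))) fun k => by fun_prop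
  rw [h5]
  have h6 : ∀ k, ∫ ω, Complex.exp (Complex.I * ((∑ i, c k i * W k (t k i) ω : ℝ) : ℂ)) ∂P
      = Complex.exp (-(‖(p k).1‖ ^ 2 / 2 : ℝ)) := fun k => by
    rw [integral_exp_of_hasGaussianLaw (hg k) (integral_sum_brownian (hW k) (c k) (t k)),
      variance_sum_brownian (hW k) (c k) (t k) (ht k), h1]
  rw [Finset.prod_congr rfl fun k _ => h6 k, ← Complex.exp_sum, Finset.sum_neg_distrib,
    Finset.sum_div]
  push_cast
  rfl

/-- The joint characteristic function of Wiener integrals with respect to independent Brownian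
motions. -/
theorem integral_exp_of_mem_wienerGraph [IsProbabilityMeasure P]
    (hW : ∀ k, IsPreBrownianReal (W k) P)
    (hind : iIndepFun (fun k ω t => W k t ω) P) {p : κ → L2T T × Lp ℝ 2 P}
    (hp : ∀ k, p k ∈ wienerGraph P T (W k)) :
    ∫ ω, Complex.exp (Complex.I * ((∑ k, (p k).2 : Lp ℝ 2 P) ω)) ∂P
      = Complex.exp (-((∑ k, ‖(p k).1‖ ^ 2) / 2 : ℝ)) := by
  have hclosed : IsClosed {p : κ → L2T T × Lp ℝ 2 P |
      ∫ ω, Complex.exp (Complex.I * ((∑ k, (p k).2 : Lp ℝ 2 P) ω)) ∂P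
        = Complex.exp (-((∑ k, ‖(p k).1‖ ^ 2) / 2 : ℝ))} := by
    refine isClosed_eq (continuous_integral_exp.comp (g := fun η : Lp ℝ 2 P =>
      ∫ ω, Complex.exp (Complex.I * η ω) ∂P) (f := fun p : κ → L2T T × Lp ℝ 2 P =>
      (∑ k, (p k).2 : Lp ℝ 2 P)) (by fun_prop)) (by fun_prop)
  -- The closure of a product is the product of the closures, so the integrands for all the Brownian
  -- motions are approximated simultaneously.
  have hp' : p ∈ closure (Set.univ.pi fun k => (stepGraph P T (W k) : Set (L2T T × Lp ℝ 2 P))) := by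
    rw [closure_pi_set]
    exact fun k _ => hp k
  refine closure_minimal (fun q hq => ?_) hclosed hp'
  exact integral_exp_of_mem_stepGraph hW hind fun k => hq k trivial

theorem sum_fiberwise_image {ι κ E : Type*} [DecidableEq κ] [AddCommMonoid E] (s : Finset ι)
    (g : ι → κ) (f : ι → E) :
    ∑ ℓ : ↥(s.image g), ∑ p ∈ s with g p = (ℓ : κ), f p = ∑ p ∈ s, f p := by
  rw [Finset.sum_coe_sort (s.image g) (fun ℓ => ∑ p ∈ s with g p = ℓ, f p)]
  exact Finset.sum_fiberwise_of_maps_to (fun p hp => Finset.mem_image_of_mem _ hp) f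

/-- The characteristic function of finitely many Wiener integrals of orthonormal functions with
respect to independent Brownian motions. -/
theorem integral_exp_sum_wienerIntegral [IsProbabilityMeasure P] {W : ℕ → ℝ≥0 → Ω → ℝ}
    (hW : ∀ ℓ, IsPreBrownianReal (W ℓ) P) (hind : iIndepFun (fun ℓ ω t => W ℓ t ω) P)
    {h : ℕ → L2T T} (hh : Orthonormal ℝ h) (s : Finset (ℕ × ℕ)) (x : ℕ × ℕ → ℝ) :
    ∫ ω, Complex.exp (Complex.I * ((∑ p ∈ s, x p * wienerIntegral P T (W p.2) (h p.1) ω : ℝ) : ℂ))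
      ∂P = Complex.exp (-((∑ p ∈ s, x p ^ 2) / 2 : ℝ)) := by
  classical
  set q : ↥(s.image Prod.snd) → L2T T × Lp ℝ 2 P := fun ℓ =>
    ∑ p ∈ s with p.2 = (ℓ : ℕ), x p • (h p.1, wienerIntegral P T (W p.2) (h p.1)) with hq
  have hmem : ∀ ℓ : ↥(s.image Prod.snd), q ℓ ∈ wienerGraph P T (W ℓ) := fun ℓ => by
    refine Submodule.sum_mem _ fun p hp => Submodule.smul_mem _ _ ?_
    rw [← (Finset.mem_filter.1 hp).2]
    exact wienerIntegral_mem (hW _) _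
  have h1 := integral_exp_of_mem_wienerGraph (W := fun ℓ : ↥(s.image Prod.snd) => W ℓ)
    (fun ℓ => hW ℓ) (hind.precomp Subtype.val_injective) hmem
  have e1 : (∑ ℓ, (q ℓ).2 : Lp ℝ 2 P)
      = ∑ p ∈ s, x p • wienerIntegral P T (W p.2) (h p.1) := by
    rw [← sum_fiberwise_image s Prod.snd]
    refine Finset.sum_congr rfl fun ℓ _ => ?_
    rw [hq, Prod.snd_sum]
    rfl
  have e2 : ∑ ℓ, ‖(q ℓ).1‖ ^ 2 = ∑ p ∈ s, x p ^ 2 := by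
    rw [← sum_fiberwise_image s Prod.snd]
    refine Finset.sum_congr rfl fun ℓ _ => ?_
    have e3 : (q ℓ).1 = ∑ p ∈ s with p.2 = (ℓ : ℕ), x p • h p.1 := by
      rw [hq, Prod.fst_sum]
      rfl
    rw [e3, ← real_inner_self_eq_norm_sq, sum_inner]
    refine Finset.sum_congr rfl fun p hp => ?_
    rw [inner_sum, Finset.sum_eq_single p]
    · rw [real_inner_smul_left, real_inner_smul_right, real_inner_self_eq_norm_sq, hh.1]
      ring
    · intro r hr hrp
      rw [real_inner_smul_left, real_inner_smul_right, hh.2 (fun he => hrp (Prod.ext he.symm ?_)),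
        mul_zero, mul_zero]
      rw [(Finset.mem_filter.1 hr).2, (Finset.mem_filter.1 hp).2]
    · exact fun hp' => absurd hp hp'
  rw [e1, e2] at h1
  rw [← h1]
  refine integral_congr_ae ?_
  have h2 : ∀ᵐ ω ∂P, ∀ p : ↥s, (x p • wienerIntegral P T (W p.1.2) (h p.1.1) : Lp ℝ 2 P) ω
      = x p * wienerIntegral P T (W p.1.2) (h p.1.1) ω :=
    ae_all_iff.2 fun p => Lp.coeFn_smul _ _
  filter_upwards [Lp.coeFn_finsetSum s fun p => x p • wienerIntegral P T (W p.2) (h p.1), h2]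
    with ω h3 h4
  rw [h3, Finset.sum_apply]
  congr 3
  exact Finset.sum_congr rfl fun p hp => (h4 ⟨p, hp⟩).symm

theorem aemeasurable_wienerIntegral {W : ℝ≥0 → Ω → ℝ} (f : L2T T) :
    AEMeasurable (wienerIntegral P T W f) P :=
  (Lp.aestronglyMeasurable _).aemeasurable

theorem map_wienerIntegral [IsProbabilityMeasure P] {W : ℕ → ℝ≥0 → Ω → ℝ}
    (hW : ∀ ℓ, IsPreBrownianReal (W ℓ) P) (hind : iIndepFun (fun ℓ ω t => W ℓ t ω) P)
    {h : ℕ → L2T T} (hh : Orthonormal ℝ h) (p : ℕ × ℕ) :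
    P.map (wienerIntegral P T (W p.2) (h p.1)) = gaussianReal 0 1 := by
  have hm := aemeasurable_wienerIntegral (P := P) (W := W p.2) (h p.1)
  have := Measure.isProbabilityMeasure_map hm
  refine Measure.ext_of_charFun (funext fun x => ?_)
  rw [charFun_apply_real, charFun_gaussianReal, integral_map hm (by fun_prop)]
  have h1 := integral_exp_sum_wienerIntegral hW hind hh {p} fun _ => x
  simp only [Finset.sum_singleton] at h1
  have e : ∀ ω, (x : ℂ) * (wienerIntegral P T (W p.2) (h p.1) ω : ℂ) * Complex.I
      = Complex.I * ((x * wienerIntegral P T (W p.2) (h p.1) ω : ℝ) : ℂ) := fun ω => by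
    push_cast; ring
  simp only [e]
  rw [h1]
  congr 1
  push_cast
  ring

/-- The joint characteristic function exp(-∑ x_p²/2) factors into those of the marginals. Different
noises contribute through independence, different basis functions of one noise through
orthogonality. -/
theorem iIndepFun_wienerIntegral [IsProbabilityMeasure P] {W : ℕ → ℝ≥0 → Ω → ℝ}
    (hW : ∀ ℓ, IsPreBrownianReal (W ℓ) P) (hind : iIndepFun (fun ℓ ω t => W ℓ t ω) P)
    {h : ℕ → L2T T} (hh : Orthonormal ℝ h) :
    iIndepFun (fun (p : ℕ × ℕ) ω => wienerIntegral P T (W p.2) (h p.1) ω) P := by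
  classical
  rw [iIndepFun_iff_finset]
  intro s
  have hm : ∀ p : ↥s, AEMeasurable (fun ω => wienerIntegral P T (W p.1.2) (h p.1.1) ω) P := fun p =>
    aemeasurable_wienerIntegral _
  refine (iIndepFun_iff_charFun_pi hm).2 fun x => ?_
  have h1 : ∀ p : ↥s, charFun (P.map (fun ω => wienerIntegral P T (W p.1.2) (h p.1.1) ω)) (x p)
      = Complex.exp (-(x p ^ 2 / 2 : ℝ)) := fun p => by
    rw [map_wienerIntegral hW hind hh p.1, charFun_gaussianReal]
    congr 1
    push_cast
    ring
  refine Eq.trans ?_ (Finset.prod_congr rfl fun p _ => h1 p).symm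
  have h2 := integral_exp_sum_wienerIntegral hW hind hh s
    fun p => if hp : p ∈ s then x ⟨p, hp⟩ else 0
  have e1 : ∀ f : ℕ × ℕ → ℝ → ℝ, ∑ p ∈ s, f p (if hp : p ∈ s then x ⟨p, hp⟩ else 0)
      = ∑ p : ↥s, f p (x p) := fun f => by
    rw [← Finset.sum_coe_sort s]
    exact Finset.sum_congr rfl fun p _ => by rw [dif_pos p.2]
  simp only [e1 fun _ y => y ^ 2] at h2
  rw [← Complex.exp_sum, Finset.sum_neg_distrib, charFun_apply,
    integral_map (by fun_prop) (by fun_prop)]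
  have e2 : ∀ ω, Complex.exp (((inner ℝ (WithLp.toLp 2 fun p : ↥s =>
      wienerIntegral P T (W p.1.2) (h p.1.1) ω) x : ℝ) : ℂ) * Complex.I)
      = Complex.exp (Complex.I * ((∑ p ∈ s, (if hp : p ∈ s then x ⟨p, hp⟩ else 0)
        * wienerIntegral P T (W p.2) (h p.1) ω : ℝ) : ℂ)) := fun ω => by
    rw [e1 fun p y => y * wienerIntegral P T (W p.2) (h p.1) ω, mul_comm, PiLp.inner_apply]
    rfl
  refine Eq.trans (integral_congr_ae (Eventually.of_forall fun ω => e2 ω)) (h2.trans ?_)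
  rw [Finset.sum_div]
  push_cast
  rfl

end ColoredChaos

namespace ColoredChaos

/-! ### Orthonormality of the chaos basis -/

section Xi

variable {Ω : Type*} [MeasurableSpace Ω] {P : Measure Ω} {T : ℝ} {h : ℕ → L2T T}
  {W : ℕ → ℝ≥0 → Ω → ℝ}

theorem xi_eq_prod {α : MultiIndex} {s : Finset (ℕ × ℕ)} (hs : α.support ⊆ s) (ω : Ω) :
    xi P h W α ω = ∏ p ∈ s, Polynomial.aeval (wienerIntegral P T (W p.2) (h p.1) ω)
      (Polynomial.hermite (α p)) / √((α p).factorial : ℝ) := by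
  rw [xi]
  exact Finsupp.prod_of_support_subset _ hs _ fun p _ => by simp

theorem xi_zero (ω : Ω) : xi P h W 0 ω = 1 := Finsupp.prod_zero_index

variable [IsProbabilityMeasure P]

theorem memLp_wienerIntegral (hW : ∀ ℓ, IsPreBrownianReal (W ℓ) P)
    (hind : iIndepFun (fun ℓ ω t => W ℓ t ω) P) (hh : Orthonormal ℝ h) (p : ℕ × ℕ) (n : ℕ) :
    MemLp (wienerIntegral P T (W p.2) (h p.1)) n P := by
  have h1 := memLp_id_gaussianReal' (μ := 0) (v := 1) (n : ℝ≥0∞) (ENNReal.natCast_ne_top n)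
  rw [← map_wienerIntegral hW hind hh p, memLp_map_measure_iff
    aestronglyMeasurable_id (aemeasurable_wienerIntegral _)] at h1
  exact h1

theorem memLp_xi (hW : ∀ ℓ, IsPreBrownianReal (W ℓ) P)
    (hind : iIndepFun (fun ℓ ω t => W ℓ t ω) P) (hh : Orthonormal ℝ h) (α : MultiIndex) :
    MemLp (xi P h W α) 2 P := by
  have h1 := memLp_prod_of_forall (P := P) α.support
    (f := fun p ω => Polynomial.aeval (wienerIntegral P T (W p.2) (h p.1) ω)
      (Polynomial.hermite (α p)) / √((α p).factorial : ℝ)) (fun p _ n => by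
        simp only [div_eq_mul_inv]
        exact (memLp_aeval_of_forall (memLp_wienerIntegral hW hind hh p) _ n).mul_const _) 2
  rw [Nat.cast_ofNat] at h1
  exact (memLp_congr_ae (Eventually.of_forall fun ω => xi_eq_prod subset_rfl ω)).2 h1

/-- Over the union of the supports the product is one of functions of independent Gaussians, so the
expectation factors. A single p with α_p ≠ β_p makes it vanish. -/
theorem integral_xi_mul_xi (hW : ∀ ℓ, IsPreBrownianReal (W ℓ) P)
    (hind : iIndepFun (fun ℓ ω t => W ℓ t ω) P) (hh : Orthonormal ℝ h) (α β : MultiIndex) :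
    ∫ ω, xi P h W α ω * xi P h W β ω ∂P = if α = β then 1 else 0 := by
  classical
  set s := α.support ∪ β.support with hs
  let g : ℕ × ℕ → ℝ → ℝ := fun p x => (Polynomial.aeval x (Polynomial.hermite (α p))
    * Polynomial.aeval x (Polynomial.hermite (β p)))
      / (√((α p).factorial : ℝ) * √((β p).factorial : ℝ))
  have hg : ∀ p, Measurable (g p) := fun p => by
    refine (Measurable.mul ?_ ?_).div_const _ <;>
      exact (Polynomial.continuous_aeval _).measurable
  have e1 : ∀ ω, xi P h W α ω * xi P h W β ω
      = ∏ p : ↥s, g p (wienerIntegral P T (W p.1.2) (h p.1.1) ω) := fun ω => by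
    rw [xi_eq_prod (s := s) Finset.subset_union_left, xi_eq_prod (s := s) Finset.subset_union_right,
      ← Finset.prod_mul_distrib,
      Finset.prod_coe_sort s (fun p => g p (wienerIntegral P T (W p.2) (h p.1) ω))]
    exact Finset.prod_congr rfl fun p _ => div_mul_div_comm _ _ _ _
  have e2 : ∀ p, ∫ ω, g p (wienerIntegral P T (W p.2) (h p.1) ω) ∂P
      = if α p = β p then 1 else 0 := fun p => by
    rw [← integral_map (φ := wienerIntegral P T (W p.2) (h p.1)) (f := g p)
      (aemeasurable_wienerIntegral _) (hg p).aestronglyMeasurable, map_wienerIntegral hW hind hh p,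
      integral_div, integral_hermite_mul_hermite]
    split_ifs with hp
    · rw [← hp, Real.mul_self_sqrt (by positivity), div_self (by positivity)]
    · rw [zero_div]
  have h1 := iIndepFun.integral_fun_prod_comp (𝓧 := fun _ => ℝ)
    (X := fun (p : ↥s) ω => wienerIntegral P T (W p.1.2) (h p.1.1) ω)
    ((iIndepFun_wienerIntegral hW hind hh).precomp Subtype.val_injective)
    (fun p => aemeasurable_wienerIntegral _) (f := fun p => g p)
    fun p => (hg p).aestronglyMeasurable
  simp only [e1]
  rw [h1, Finset.prod_congr rfl fun (p : ↥s) _ => e2 p]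
  split_ifs with hαβ
  · subst hαβ
    simp
  · obtain ⟨p, hp⟩ := DFunLike.ne_iff.1 hαβ
    have hps : p ∈ s := by
      by_contra hps
      rw [hs, Finset.mem_union, not_or, Finsupp.notMem_support_iff, Finsupp.notMem_support_iff]
        at hps
      exact hp (hps.1.trans hps.2.symm)
    exact Finset.prod_eq_zero (Finset.mem_univ (⟨p, hps⟩ : ↥s)) (if_neg hp)

theorem integral_xi (hW : ∀ ℓ, IsPreBrownianReal (W ℓ) P)
    (hind : iIndepFun (fun ℓ ω t => W ℓ t ω) P) (hh : Orthonormal ℝ h) (α : MultiIndex) :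
    ∫ ω, xi P h W α ω ∂P = if α = 0 then 1 else 0 := by
  simpa only [xi_zero, mul_one] using integral_xi_mul_xi hW hind hh α 0

end Xi

/-! ### Convergence of chaos series -/

/-- Each map x ↦ ξ_α x embeds H isometrically in L₂(Ω; H), and the ranges are mutually orthogonal.
Summability of ‖a_α‖² is then unconditional convergence, and the norm bound is Pythagoras in the
limit. -/
theorem exists_isChaosSum {Ω H : Type*} [MeasurableSpace Ω] [NormedAddCommGroup H]
    [InnerProductSpace ℝ H] [CompleteSpace H] {P : Measure Ω} {ξ : MultiIndex → Ω → ℝ}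
    (hξ : ∀ α, MemLp (ξ α) 2 P)
    (horth : ∀ α β, ∫ ω, ξ α ω * ξ β ω ∂P = if α = β then 1 else 0) {a : MultiIndex → H} {M : ℝ}
    (hM : ∀ S : Finset MultiIndex, ∑ α ∈ S, ‖a α‖ ^ 2 ≤ M) :
    ∃ U, IsChaosSum P ξ a U ∧ ∫ ω, ‖U ω‖ ^ 2 ∂P ≤ M := by
  have hmem : ∀ α (x : H), MemLp (fun ω => ξ α ω • x) 2 P := fun α x =>
    (ContinuousLinearMap.toSpanSingleton ℝ x).comp_memLp' (hξ α)
  have hinner : ∀ α β x y, inner ℝ ((hmem α x).toLp _) ((hmem β y).toLp _)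
      = if α = β then inner ℝ x y else (0 : ℝ) := fun α β x y => by
    have e : ∀ᵐ ω ∂P, inner ℝ ((hmem α x).toLp _ ω) ((hmem β y).toLp _ ω)
        = ξ α ω * ξ β ω * inner ℝ x y := by
      filter_upwards [(hmem α x).coeFn_toLp, (hmem β y).coeFn_toLp] with ω h1 h2
      rw [h1, h2, real_inner_smul_left, real_inner_smul_right, mul_assoc]
    rw [L2.inner_def, integral_congr_ae e, integral_mul_const, horth]
    split_ifs <;> simp
  let V : MultiIndex → H →ₗᵢ[ℝ] Lp H 2 P := fun α =>
    { toFun := fun x => (hmem α x).toLp _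
      map_add' := fun x y => by
        rw [← MemLp.toLp_add]
        exact MemLp.toLp_congr _ _ (Eventually.of_forall fun ω => smul_add _ _ _)
      map_smul' := fun c x => by
        rw [RingHom.id_apply, ← MemLp.toLp_const_smul]
        exact MemLp.toLp_congr _ _ (Eventually.of_forall fun ω => smul_comm _ _ _)
      norm_map' := fun x => by
        refine (sq_eq_sq₀ (norm_nonneg _) (norm_nonneg _)).1 ?_
        rw [← real_inner_self_eq_norm_sq, ← real_inner_self_eq_norm_sq]
        exact (hinner α α x x).trans (if_pos rfl) }
  have hV : OrthogonalFamily ℝ (fun _ : MultiIndex => H) V := fun α β hαβ x y =>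
    (hinner α β x y).trans (if_neg hαβ)
  have hsum : Summable fun α => V α (a α) :=
    (hV.summable_iff_norm_sq_summable a).2
      (summable_of_sum_le (fun α => sq_nonneg _) hM)
  obtain ⟨S, hS⟩ := hsum
  have hle : ‖S‖ ^ 2 ≤ M :=
    le_of_tendsto (hS.norm.pow 2) (Eventually.of_forall fun s => by
      rw [hV.norm_sum]
      exact hM s)
  refine ⟨S, ⟨Lp.memLp S, ?_⟩, ?_⟩
  · have h1 : Tendsto (fun s : Finset MultiIndex => ‖S - ∑ α ∈ s, V α (a α)‖ₑ) atTop (𝓝 0) := by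
      have h2 := (tendsto_const_nhds (x := S)).sub hS
      rw [sub_self] at h2
      simpa using h2.enorm
    refine h1.congr fun s => ?_
    rw [Lp.enorm_def]
    refine eLpNorm_congr_ae ?_
    have h3 : ∀ᵐ ω ∂P, ∀ α : ↥s, V α (a α) ω = ξ α ω • a α :=
      ae_all_iff.2 fun α => (hmem α (a α)).coeFn_toLp
    filter_upwards [Lp.coeFn_sub S (∑ α ∈ s, V α (a α)),
      Lp.coeFn_finsetSum s fun α => V α (a α), h3] with ω h4 h5 h6
    rw [h4, Pi.sub_apply, h5, Finset.sum_apply]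
    congr 1
    exact Finset.sum_congr rfl fun α hα => h6 ⟨α, hα⟩
  · refine le_trans (le_of_eq ?_) hle
    rw [← real_inner_self_eq_norm_sq, L2.inner_def]
    exact integral_congr_ae (Eventually.of_forall fun ω => (real_inner_self_eq_norm_sq _).symm)

end ColoredChaos

namespace ColoredChaos

/-! ### From colored noises to parabolic data -/

section Noise

variable {T : ℝ}

/-- The image of a basis function under a representation operator, as a function on the line that
vanishes outside `(0, T)`. -/
noncomputable def noiseFun (K : ℕ → L2T T →L[ℝ] L2T T) (h : ℕ → L2T T) (p : ℕ × ℕ) : ℝ → ℝ :=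
  -- A representative of the zero class vanishes only almost everywhere, whereas `m_eq_zero` asks
  -- for every r; hence the separate case.
  open scoped Classical in if K p.2 = 0 then 0 else (Set.Ioo 0 T).indicator (K p.2 (h p.1))

variable (K : ℕ → L2T T →L[ℝ] L2T T) (h : ℕ → L2T T)

theorem noiseFun_ae_eq (p : ℕ × ℕ) : noiseFun K h p =ᵐ[timeMeasure T] K p.2 (h p.1) := by
  rw [noiseFun]
  split_ifs with hK
  · rw [hK]
    exact (Lp.coeFn_zero ℝ 2 (timeMeasure T)).symm
  · filter_upwards [ae_restrict_mem measurableSet_Ioo] with r hr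
    exact Set.indicator_of_mem hr _

theorem noiseFun_eq_zero (p : ℕ × ℕ) {r : ℝ} (hr : r ∉ Set.Ioo 0 T) : noiseFun K h p r = 0 := by
  rw [noiseFun]
  split_ifs
  · rfl
  · exact Set.indicator_of_notMem hr _

theorem memLp_noiseFun (p : ℕ × ℕ) : MemLp (noiseFun K h p) 2 volume := by
  rw [noiseFun]
  split_ifs
  · exact MemLp.zero
  · exact (memLp_indicator_iff_restrict measurableSet_Ioo).2 (Lp.memLp _)

variable {h}

theorem noiseFun_bessel (hh : Orthonormal ℝ h) (s : Finset (ℕ × ℕ)) (c : ℕ × ℕ → ℝ) (ℓ : ℕ) :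
    ∫ r, (∑ p ∈ s with p.2 = ℓ, c p * noiseFun K h p r) ^ 2
      ≤ ‖K ℓ‖ ^ 2 * ∑ p ∈ s with p.2 = ℓ, c p ^ 2 := by
  set f : L2T T := ∑ p ∈ s with p.2 = ℓ, c p • h p.1 with hf
  have e1 : ∫ r, (∑ p ∈ s with p.2 = ℓ, c p * noiseFun K h p r) ^ 2 = ‖K ℓ f‖ ^ 2 := by
    rw [← setIntegral_eq_integral_of_forall_compl_eq_zero (s := Set.Ioo 0 T),
      ← real_inner_self_eq_norm_sq, L2.inner_def]
    · refine integral_congr_ae ?_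
      have h1 : ∀ᵐ r ∂(timeMeasure T), ∀ p, noiseFun K h p r = K p.2 (h p.1) r :=
        ae_all_iff.2 fun p => noiseFun_ae_eq K h p
      have h2 : ∀ᵐ r ∂(timeMeasure T), ∀ p : ℕ × ℕ,
          (c p • K p.2 (h p.1) : L2T T) r = c p * K p.2 (h p.1) r :=
        ae_all_iff.2 fun p => Lp.coeFn_smul _ _
      have h3 : K ℓ f = ∑ p ∈ s with p.2 = ℓ, c p • K p.2 (h p.1) := by
        rw [hf, map_sum]
        refine Finset.sum_congr rfl fun p hp => ?_
        rw [map_smul, (Finset.mem_filter.1 hp).2]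
      filter_upwards [h1, h2, Lp.coeFn_finsetSum ({p ∈ s | p.2 = ℓ})
        fun p => c p • K p.2 (h p.1)] with r h4 h5 h6
      rw [h3, h6, Finset.sum_apply, real_inner_self_eq_norm_sq, Real.norm_eq_abs, sq_abs]
      simp only [h4, h5]
    · intro r hr
      rw [Finset.sum_eq_zero fun p _ => by rw [noiseFun_eq_zero K h p hr, mul_zero]]
      exact zero_pow two_ne_zero
  have e2 : ‖f‖ ^ 2 = ∑ p ∈ s with p.2 = ℓ, c p ^ 2 := by
    rw [hf, ← real_inner_self_eq_norm_sq, sum_inner]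
    refine Finset.sum_congr rfl fun p hp => ?_
    rw [inner_sum, Finset.sum_eq_single p]
    · rw [real_inner_smul_left, real_inner_smul_right, real_inner_self_eq_norm_sq, hh.1]
      ring
    · intro r hr hrp
      rw [real_inner_smul_left, real_inner_smul_right, hh.2 (fun he => hrp (Prod.ext he.symm ?_)),
        mul_zero, mul_zero]
      rw [(Finset.mem_filter.1 hr).2, (Finset.mem_filter.1 hp).2]
    · exact fun hp' => absurd hp hp'
  rw [e1, ← e2, ← mul_pow]
  have := (K ℓ).le_opNorm f
  gcongr

end Noise

section Assembly

theorem memLp_indicator_Ioo {E : Type*} [NormedAddCommGroup E] {T : ℝ} {f : ℝ → E}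
    (hf : MemLp f 2 (timeMeasure T)) : MemLp ((Set.Ioo 0 T).indicator f) 2 volume :=
  (memLp_indicator_iff_restrict measurableSet_Ioo).2 hf

variable {X H : Type*} [NormedAddCommGroup X] [InnerProductSpace ℝ X]
  [NormedAddCommGroup H] {T : ℝ}

/-- The parabolic data of a chaos equation. -/
noncomputable def ParabolicData.ofNoise [InnerProductSpace ℝ H] (ι : X →L[ℝ] H) (A : X →L[ℝ] StrongDual ℝ X) {δA CA : ℝ}
    (hδA : 0 < δA) (hA : ∀ v : X, 2 * A v v + δA * ‖v‖ ^ 2 ≤ CA * ‖ι v‖ ^ 2)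
    (K : ℕ → L2T T →L[ℝ] L2T T) {h : ℕ → L2T T} (hh : Orthonormal ℝ h) (B : ℕ → H →L[ℝ] H)
    (u₀ : H) {F : ℝ → StrongDual ℝ X} {G : ℕ → ℝ → H} (hF : MemLp F 2 (timeMeasure T))
    (hG : ∀ ℓ, MemLp (G ℓ) 2 (timeMeasure T))
    (hCB : Summable fun ℓ => ‖K ℓ‖ ^ 2 * ‖B ℓ‖ ^ 2) : ParabolicData X H where
  ι := ι
  A := A
  B := B
  u₀ := u₀
  F := (Set.Ioo 0 T).indicator F
  G ℓ := (Set.Ioo 0 T).indicator (G ℓ)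
  m := noiseFun K h
  k ℓ := ‖K ℓ‖
  δ := δA
  -- Gronwall's inequality and the comparison of the norms of H and of the regularized space need a
  -- nonnegative constant. For CA ≥ 0 nothing is lost.
  cA := max CA 0
  cB := operatorSize K B
  δ_pos := hδA
  cA_nonneg := le_max_right _ _
  parabolic v := (hA v).trans (by gcongr; exact le_max_left _ _)
  sum_B_le Λ := hCB.sum_le_tsum Λ fun ℓ _ => by positivity
  memLp_F := memLp_indicator_Ioo hF
  memLp_G ℓ := memLp_indicator_Ioo (hG ℓ)
  memLp_m := memLp_noiseFun K h
  m_eq_zero p r hp := by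
    rw [noiseFun, if_pos (norm_eq_zero.1 hp)]
    rfl
  bessel := noiseFun_bessel K hh

theorem inputSize_nonneg {δA : ℝ} (hδA : 0 < δA) (K : ℕ → L2T T →L[ℝ] L2T T) (u₀ : H)
    (F : ℝ → StrongDual ℝ X) (G : ℕ → ℝ → H) : 0 ≤ inputSize δA K u₀ F G := by
  rw [inputSize]
  have h1 : 0 ≤ ∫ t in Set.Ioo 0 T, ‖F t‖ ^ 2 := integral_nonneg fun t => sq_nonneg _
  have h2 : 0 ≤ ∑' ℓ, ‖K ℓ‖ ^ 2 * ∫ t in Set.Ioo 0 T, ‖G ℓ t‖ ^ 2 :=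
    tsum_nonneg fun ℓ => mul_nonneg (sq_nonneg _) (integral_nonneg fun t => sq_nonneg _)
  positivity

theorem norm_sq_le_inputSize {δA : ℝ} (hδA : 0 < δA) (K : ℕ → L2T T →L[ℝ] L2T T) (u₀ : H)
    (F : ℝ → StrongDual ℝ X) (G : ℕ → ℝ → H) : ‖u₀‖ ^ 2 ≤ inputSize δA K u₀ F G := by
  rw [inputSize, add_assoc]
  have h1 : 0 ≤ ∫ t in Set.Ioo 0 T, ‖F t‖ ^ 2 := integral_nonneg fun t => sq_nonneg _
  have h2 : 0 ≤ ∑' ℓ, ‖K ℓ‖ ^ 2 * ∫ t in Set.Ioo 0 T, ‖G ℓ t‖ ^ 2 :=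
    tsum_nonneg fun ℓ => mul_nonneg (sq_nonneg _) (integral_nonneg fun t => sq_nonneg _)
  exact le_add_of_nonneg_right (by positivity)

theorem integral_norm_indicator_sq_le {E : Type*} [NormedAddCommGroup E] {f : ℝ → E}
    (hf : MemLp f 2 (timeMeasure T)) {t : ℝ} (ht : t ∈ Set.Icc 0 T) :
    ∫ r in (0 : ℝ)..t, ‖(Set.Ioo 0 T).indicator f r‖ ^ 2 ≤ ∫ r in Set.Ioo 0 T, ‖f r‖ ^ 2 := by
  have h1 : Integrable (fun r => ‖f r‖ ^ 2) (timeMeasure T) := hf.integrable_norm_pow two_ne_zero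
  rw [intervalIntegral_eq_indicator ht]
  refine integral_mono_of_nonneg (Eventually.of_forall fun r => ?_) h1 ?_
  · exact Set.indicator_nonneg (fun r _ => sq_nonneg _) r
  · filter_upwards [ae_restrict_mem measurableSet_Ioo] with r hr
    refine (Set.indicator_le_self' (fun r _ => sq_nonneg _) r).trans ?_
    rw [Set.indicator_of_mem hr]

theorem indicator_ae_eq_zero_of_timeMeasure {E : Type*} [Zero E] {f : ℝ → E}
    (hf : f =ᵐ[timeMeasure T] 0) : (Set.Ioo 0 T).indicator f =ᵐ[volume] 0 := by
  filter_upwards [(ae_restrict_iff' measurableSet_Ioo).1 hf] with r hr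
  by_cases h : r ∈ Set.Ioo 0 T
  · rw [Set.indicator_of_mem h, hr h]
  · rw [Set.indicator_of_notMem h, Pi.zero_apply]

/-- Any finite set of multi-indices lies in a box of the kind used for the energy: the union of the
supports and the largest degree give s and N. -/
theorem sum_le_of_sum_finsuppAntidiag_le {f : MultiIndex → ℝ} (hf : ∀ α, 0 ≤ f α) {M : ℝ}
    (h : ∀ (s : Finset (ℕ × ℕ)) N,
      ∑ n ∈ Finset.range (N + 2), ∑ α ∈ s.finsuppAntidiag n, f α ≤ M)
    (S : Finset MultiIndex) : ∑ α ∈ S, f α ≤ M := by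
  classical
  refine le_trans ?_ (h (S.biUnion Finsupp.support) (S.sup Finsupp.degree))
  have h1 : ∀ α ∈ S, α.degree ∈ Finset.range (S.sup Finsupp.degree + 2) := fun α hα => by
    have := Finset.le_sup (f := Finsupp.degree) hα
    exact Finset.mem_range.2 (by omega)
  rw [← Finset.sum_fiberwise_of_maps_to h1]
  refine Finset.sum_le_sum fun n _ => Finset.sum_le_sum_of_subset_of_nonneg (fun α hα => ?_)
    fun α _ _ => hf α
  have h2 := Finset.mem_filter.1 hα
  have h3 : α.support ⊆ S.biUnion Finsupp.support := Finset.subset_biUnion_of_mem _ h2.1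
  refine Finset.mem_finsuppAntidiag.2 ⟨?_, h3⟩
  rw [← h2.2, Finsupp.degree]
  exact (Finset.sum_subset h3 fun p _ hp => Finsupp.notMem_support_iff.1 hp).symm

theorem isSquareIntegrable_of_sum_le {u : MultiIndex → Set.Icc 0 T → H} {M : ℝ}
    (h : ∀ (S : Finset MultiIndex) t, ∑ α ∈ S, ‖u α t‖ ^ 2 ≤ M) : IsSquareIntegrable u := by
  refine lt_of_le_of_lt (iSup_le fun t => ?_) (ENNReal.ofReal_lt_top (r := M))
  rw [ENNReal.tsum_eq_iSup_sum]
  refine iSup_le fun S => ?_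
  refine le_trans (le_of_eq ?_) (ENNReal.ofReal_le_ofReal (h S t))
  rw [ENNReal.ofReal_sum_of_nonneg fun α _ => sq_nonneg _]
  refine Finset.sum_congr rfl fun α _ => ?_
  rw [ENNReal.ofReal_pow (norm_nonneg _), ofReal_norm]

end Assembly

end ColoredChaos

namespace ColoredChaos

/-! ### Existence, uniqueness and square integrability of the chaos solution -/

variable {Ω : Type*} [MeasurableSpace Ω] {P : Measure Ω}
  {X H : Type*} [NormedAddCommGroup X] [InnerProductSpace ℝ X]
  [NormedAddCommGroup H] [InnerProductSpace ℝ H]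
  {ι : X →L[ℝ] H} {T : ℝ} {A : X →L[ℝ] StrongDual ℝ X} {δA CA : ℝ}
  {K : ℕ → L2T T →L[ℝ] L2T T} {h : ℕ → L2T T} {B : ℕ → H →L[ℝ] H} {u₀ : H}
  {F : ℝ → StrongDual ℝ X} {G : ℕ → ℝ → H} {ξ : MultiIndex → Ω → ℝ}

theorem inputBound_ofNoise_le (hδA : 0 < δA)
    (hA : ∀ v : X, 2 * A v v + δA * ‖v‖ ^ 2 ≤ CA * ‖ι v‖ ^ 2) (hh : Orthonormal ℝ h)
    (hF : MemLp F 2 (timeMeasure T)) (hG : ∀ ℓ, MemLp (G ℓ) 2 (timeMeasure T))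
    (hI : Summable fun ℓ => ‖K ℓ‖ ^ 2 * ∫ t in Set.Ioo 0 T, ‖G ℓ t‖ ^ 2)
    (hCB : Summable fun ℓ => ‖K ℓ‖ ^ 2 * ‖B ℓ‖ ^ 2) (Λ : Finset ℕ) {t : ℝ}
    (ht : t ∈ Set.Icc 0 T) :
    (ParabolicData.ofNoise ι A hδA hA K hh B u₀ hF hG hCB).inputBound Λ t
      ≤ inputSize δA K u₀ F G := by
  have h1 := integral_norm_indicator_sq_le hF ht
  have h2 : ∑ ℓ ∈ Λ, ‖K ℓ‖ ^ 2 * ∫ r in (0 : ℝ)..t, ‖(Set.Ioo 0 T).indicator (G ℓ) r‖ ^ 2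
      ≤ ∑' ℓ, ‖K ℓ‖ ^ 2 * ∫ t in Set.Ioo 0 T, ‖G ℓ t‖ ^ 2 := by
    refine le_trans (Finset.sum_le_sum fun ℓ _ => mul_le_mul_of_nonneg_left
      (integral_norm_indicator_sq_le (hG ℓ) ht) (sq_nonneg _)) ?_
    exact hI.sum_le_tsum Λ fun ℓ _ =>
      mul_nonneg (sq_nonneg _) (integral_nonneg fun t => sq_nonneg _)
  have h3 : 0 ≤ ∫ t in Set.Ioo 0 T, ‖F t‖ ^ 2 := integral_nonneg fun t => sq_nonneg _
  have h4 : δA⁻¹ * (∫ r in (0 : ℝ)..t, ‖(Set.Ioo 0 T).indicator F r‖ ^ 2)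
      ≤ 2 / δA * ∫ t in Set.Ioo 0 T, ‖F t‖ ^ 2 := by
    have h5 : δA⁻¹ ≤ 2 / δA := by
      rw [inv_eq_one_div]
      gcongr
      norm_num
    exact (mul_le_mul_of_nonneg_left h1 (inv_nonneg.2 hδA.le)).trans
      (mul_le_mul_of_nonneg_right h5 h3)
  exact add_le_add (add_le_add le_rfl h4) h2

/-- A solution of the normalized system gives a chaos solution. -/
theorem isChaosSolution_of_solution (hδA : 0 < δA)
    (hA : ∀ v : X, 2 * A v v + δA * ‖v‖ ^ 2 ≤ CA * ‖ι v‖ ^ 2) (hh : Orthonormal ℝ h)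
    (hF : MemLp F 2 (timeMeasure T)) (hG : ∀ ℓ, MemLp (G ℓ) 2 (timeMeasure T))
    (hCB : Summable fun ℓ => ‖K ℓ‖ ^ 2 * ‖B ℓ‖ ^ 2)
    (hξ : ∀ α, ∫ ω, ξ α ω ∂P = if α = 0 then 1 else 0)
    {w : MultiIndex → ℝ → X} {u : MultiIndex → ℝ → H}
    (hw : ∀ α, MemLp (w α) 2 (timeMeasure T))
    (hu : ∀ α, ∀ t ∈ Set.Icc 0 T, toDual ι (u α t)
      = (if α = 0 then toDual ι u₀ else 0) + ∫ r in (0 : ℝ)..t,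
        (ParabolicData.ofNoise ι A hδA hA K hh B u₀ hF hG hCB).driftX w α r)
    (hwu : ∀ α, ∀ᵐ r ∂(timeMeasure T), toDual ι (u α r) = toDual ι (ι (w α r))) :
    IsChaosSolution P ξ h K ι A (fun ℓ => toDual ι ∘L B ℓ ∘L ι) (fun _ => toDual ι u₀)
      (fun _ => F) (fun ℓ _ s => toDual ι (G ℓ s))
      (fun α t => toDual ι (√(multiFactorial α) • u α t)) := by
  refine ⟨fun α r => √(multiFactorial α) • w α r, fun α => (hw α).const_smul _, fun α => ?_,
    fun α t => ?_⟩
  · filter_upwards [hwu α] with r hr hr2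
    rw [map_smul, hr, map_smul, map_smul]
  · have e0 : ∀ (α : MultiIndex) (x : StrongDual ℝ X),
        ∫ ω, ξ α ω • x ∂P = if α = 0 then x else 0 := fun α x => by
      rw [integral_smul_const, hξ]
      split_ifs
      · rw [one_smul]
      · rw [zero_smul]
    have e1 : ∀ (α : MultiIndex) (x : StrongDual ℝ X),
        √(multiFactorial α) • (if α = 0 then x else 0) = if α = 0 then x else 0 := fun α x => by
      split_ifs with h0
      · rw [h0, multiFactorial_zero, Real.sqrt_one, one_smul]
      · rw [smul_zero]
    beta_reduce
    rw [map_smul, hu α t t.2, ParabolicData.integral_driftX _ hw α t.2, smul_add, smul_add, e1]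
    simp only [e0]
    rw [← add_assoc]
    refine congrArg₂ (· + ·) (congrArg₂ (· + ·) rfl ?_) ?_
    · rw [← intervalIntegral.integral_smul]
      refine intervalIntegral_congr_timeMeasure t.2 ?_
      filter_upwards [ae_restrict_mem measurableSet_Ioo] with r hr
      change √(multiFactorial α) • (A (w α r) + if α = 0 then (Set.Ioo 0 T).indicator F r else 0) = _
      rw [smul_add, e1, Set.indicator_of_mem hr, map_smul]
    · rw [Finset.smul_sum]
      refine Finset.sum_congr rfl fun p hp => ?_
      -- This splitting restores the factor √α_p of the S-system and normalizes the coefficient with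
      -- index α - ε_p.
      have e2 : √(multiFactorial α)
          = √(α p : ℝ) * √(multiFactorial (α - Finsupp.single p 1)) := by
        rw [multiFactorial_sub_single hp, Real.sqrt_mul (Nat.cast_nonneg _)]
      rw [e2, mul_smul, ← intervalIntegral.integral_smul]
      congr 1
      refine intervalIntegral_congr_timeMeasure t.2 ?_
      filter_upwards [ae_restrict_mem measurableSet_Ioo, noiseFun_ae_eq K h p] with r hr hr2
      change √(multiFactorial (α - Finsupp.single p 1)) • noiseFun K h p r •
        (toDual ι (B p.2 (ι (w (α - Finsupp.single p 1) r)))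
          + if α - Finsupp.single p 1 = 0 then toDual ι ((Set.Ioo 0 T).indicator (G p.2) r) else 0)
        = _
      rw [smul_comm, smul_add, e1, Set.indicator_of_mem hr, hr2, map_smul]
      rfl

/-- Separates analysis from probability: of the ξ_α only square integrability, orthonormality and
the means are used, and the noises enter through the operators K ℓ alone. -/
theorem chaosSolution_of_orthonormal [CompleteSpace X] [CompleteSpace H] (hι : IsNormalTriple ι) (hT : 0 < T) (hδA : 0 < δA)
    (hA : ∀ v : X, 2 * A v v + δA * ‖v‖ ^ 2 ≤ CA * ‖ι v‖ ^ 2) (hh : Orthonormal ℝ h)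
    (hmem : ∀ α, MemLp (ξ α) 2 P)
    (horth : ∀ α β, ∫ ω, ξ α ω * ξ β ω ∂P = if α = β then 1 else 0)
    (hξ : ∀ α, ∫ ω, ξ α ω ∂P = if α = 0 then 1 else 0)
    (hF : MemLp F 2 (timeMeasure T)) (hG : ∀ ℓ, MemLp (G ℓ) 2 (timeMeasure T))
    (hI : Summable fun ℓ => ‖K ℓ‖ ^ 2 * ∫ t in Set.Ioo 0 T, ‖G ℓ t‖ ^ 2)
    (hCB : Summable fun ℓ => ‖K ℓ‖ ^ 2 * ‖B ℓ‖ ^ 2) :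
    ∃ u : MultiIndex → Set.Icc 0 T → H,
      IsChaosSolution P ξ h K ι A (fun ℓ => toDual ι ∘L B ℓ ∘L ι)
        (fun _ => toDual ι u₀) (fun _ => F) (fun ℓ _ s => toDual ι (G ℓ s))
        (fun α t => toDual ι (u α t)) ∧
      (∀ v : MultiIndex → Set.Icc 0 T → StrongDual ℝ X,
        IsChaosSolution P ξ h K ι A (fun ℓ => toDual ι ∘L B ℓ ∘L ι)
          (fun _ => toDual ι u₀) (fun _ => F) (fun ℓ _ s => toDual ι (G ℓ s)) v →
        v = fun α t => toDual ι (u α t)) ∧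
      IsSquareIntegrable u ∧
      ∃ U : Set.Icc 0 T → Ω → H, (∀ t, IsChaosSum P ξ (fun α => u α t) (U t)) ∧
        ∃ Co : ℝ, 1 ≤ Co ∧ Co ≤ 3 ∧
          (F =ᵐ[timeMeasure T] 0 → (∀ ℓ, G ℓ =ᵐ[timeMeasure T] 0) → Co = 1) ∧
          (0 ≤ CA → ∀ t, ∫ ω, ‖U t ω‖ ^ 2 ∂P ≤
            Co * Real.exp ((CA + operatorSize K B) * T) * inputSize δA K u₀ F G) := by
  classical
  set E := ParabolicData.ofNoise ι A hδA hA K hh B u₀ hF hG hCB with hE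
  have hIle := fun Λ t ht => inputBound_ofNoise_le (ι := ι) (u₀ := u₀) hδA hA hh hF hG hI hCB Λ
    (t := t) ht
  obtain ⟨w, u, hw, hu, hwu, hbound, hbound0⟩ := E.exists_solution hT.le hIle
  have hsol : IsChaosSolution P ξ h K ι A (fun ℓ => toDual ι ∘L B ℓ ∘L ι) (fun _ => toDual ι u₀)
      (fun _ => F) (fun ℓ _ s => toDual ι (G ℓ s))
      (fun α t => toDual ι (√(multiFactorial α) • u α t)) :=
    isChaosSolution_of_solution hδA hA hh hF hG hCB hξ hw hu hwu
  let Co : ℝ := if F =ᵐ[timeMeasure T] 0 ∧ ∀ ℓ, G ℓ =ᵐ[timeMeasure T] 0 then 1 else 3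
  have hnorm : ∀ α t, ‖√(multiFactorial α) • u α t‖ ^ 2 = multiFactorial α * ‖u α t‖ ^ 2 :=
    fun α t => by
      rw [norm_smul, mul_pow, Real.norm_of_nonneg (Real.sqrt_nonneg _),
        Real.sq_sqrt (multiFactorial_pos α).le]
  have hI0 := inputSize_nonneg hδA K u₀ F G
  have hexp : ∀ t ∈ Set.Icc 0 T, Real.exp ((E.cA + E.cB) * t) ≤ Real.exp ((E.cA + E.cB) * T) :=
    fun t ht => by
      have h1 := E.cA_nonneg
      have h2 := E.cB_nonneg
      have h3 := ht.2
      gcongr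
  have hM : ∀ (S : Finset MultiIndex) (t : Set.Icc 0 T),
      ∑ α ∈ S, ‖√(multiFactorial α) • u α t‖ ^ 2
        ≤ Co * Real.exp ((E.cA + E.cB) * T) * inputSize δA K u₀ F G := by
    intro S t
    refine sum_le_of_sum_finsuppAntidiag_le (fun α => sq_nonneg _) (fun s N => ?_) S
    simp only [hnorm]
    have h1 := hexp t t.2
    by_cases h0 : F =ᵐ[timeMeasure T] 0 ∧ ∀ ℓ, G ℓ =ᵐ[timeMeasure T] 0
    · rw [show Co = 1 from if_pos h0, one_mul]
      refine (hbound0 (indicator_ae_eq_zero_of_timeMeasure h0.1)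
        (fun ℓ => indicator_ae_eq_zero_of_timeMeasure (h0.2 ℓ)) s N t t.2).trans ?_
      exact mul_le_mul h1 (norm_sq_le_inputSize hδA K u₀ F G) (sq_nonneg _) (Real.exp_pos _).le
    · rw [show Co = 3 from if_neg h0]
      refine (hbound s N t t.2).trans (mul_le_mul (by gcongr) (hIle _ _ t.2)
        (E.inputBound_nonneg _ t.2.1) (by positivity))
  choose U hU hUle using fun t : Set.Icc 0 T =>
    exists_isChaosSum hmem horth (a := fun α => √(multiFactorial α) • u α t) fun S => hM S t
  refine ⟨fun α t => √(multiFactorial α) • u α t, hsol, fun v hv => ?_,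
    isSquareIntegrable_of_sum_le hM, U, hU, Co, ?_, ?_, fun h1 h2 => if_pos ⟨h1, h2⟩,
    fun hCA t => ?_⟩
  · refine hv.unique hι (le_max_right CA 0) (fun x => ?_) (fun α => ?_) hsol
    · have h1 := E.parabolic x
      have h2 : 0 ≤ δA * ‖x‖ ^ 2 := by positivity
      change 2 * A x x + δA * ‖x‖ ^ 2 ≤ max CA 0 * ‖ι x‖ ^ 2 at h1
      linarith
    · simp only [integral_smul_const]
      exact (hF.integrable one_le_two).smul (∫ ω, ξ α ω ∂P)
  · simp only [Co]
    split_ifs <;> norm_num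
  · simp only [Co]
    split_ifs <;> norm_num
  · have h1 := hUle t
    have h2 : E.cA = CA := max_eq_left hCA
    rw [h2] at h1
    exact h1

end ColoredChaos

/-! ### The theorem for colored noises with Brownian representations. -/

open MeasureTheory ProbabilityTheory Filter Topology
open scoped NNReal ENNReal

theorem mainTheorem1
    {Ω : Type*} [MeasurableSpace Ω] (P : Measure Ω) [IsProbabilityMeasure P]
    {X H : Type*} [NormedAddCommGroup X] [InnerProductSpace ℝ X] [CompleteSpace X]
    [NormedAddCommGroup H] [InnerProductSpace ℝ H] [CompleteSpace H]
    (ι : X →L[ℝ] H) (hι : ColoredChaos.IsNormalTriple ι)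
    (T : ℝ) (hT : 0 < T)
    -- the strongly parabolic operator
    (A : X →L[ℝ] StrongDual ℝ X) (δA CA : ℝ) (hδA : 0 < δA)
    (hA : ∀ v : X, 2 * A v v + δA * ‖v‖ ^ 2 ≤ CA * ‖ι v‖ ^ 2)
    -- the independent colored noises and their representations
    (N : ℕ → ColoredChaos.L2T T → Ω → ℝ)
    (R K : ℕ → ColoredChaos.L2T T →L[ℝ] ColoredChaos.L2T T)
    (hN : ∀ ℓ, ColoredChaos.IsColoredNoise P (N ℓ) (R ℓ))
    (hNindep : iIndepFun (fun ℓ ω f => N ℓ f ω) P)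
    (W : ℕ → ℝ≥0 → Ω → ℝ)
    (hW : ∀ ℓ, ColoredChaos.IsRepresentation P (N ℓ) (R ℓ) (K ℓ) (W ℓ))
    (hWindep : iIndepFun (fun ℓ ω t => W ℓ t ω) P)
    (h : HilbertBasis ℕ ℝ (ColoredChaos.L2T T))
    -- the bounded operators on `H` and the deterministic inputs
    (B : ℕ → H →L[ℝ] H)
    (u₀ : H) (F : ℝ → StrongDual ℝ X) (G : ℕ → ℝ → H)
    (hF : MemLp F 2 (ColoredChaos.timeMeasure T))
    (hG : ∀ ℓ, MemLp (G ℓ) 2 (ColoredChaos.timeMeasure T))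
    (hI : Summable fun ℓ => ‖K ℓ‖ ^ 2 * ∫ t in Set.Ioo 0 T, ‖G ℓ t‖ ^ 2)
    (hCB : Summable fun ℓ => ‖K ℓ‖ ^ 2 * ‖B ℓ‖ ^ 2) :
    ∃ u : ColoredChaos.MultiIndex → Set.Icc 0 T → H,
      -- existence
      ColoredChaos.IsChaosSolution P (ColoredChaos.xi P h W) h K ι A
        (fun ℓ => ColoredChaos.toDual ι ∘L B ℓ ∘L ι)
        (fun _ => ColoredChaos.toDual ι u₀) (fun _ => F)
        (fun ℓ _ s => ColoredChaos.toDual ι (G ℓ s))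
        (fun α t => ColoredChaos.toDual ι (u α t)) ∧
      -- uniqueness
      (∀ v : ColoredChaos.MultiIndex → Set.Icc 0 T → StrongDual ℝ X,
        ColoredChaos.IsChaosSolution P (ColoredChaos.xi P h W) h K ι A
          (fun ℓ => ColoredChaos.toDual ι ∘L B ℓ ∘L ι)
          (fun _ => ColoredChaos.toDual ι u₀) (fun _ => F)
          (fun ℓ _ s => ColoredChaos.toDual ι (G ℓ s)) v →
        v = fun α t => ColoredChaos.toDual ι (u α t)) ∧
      -- square integrability
      ColoredChaos.IsSquareIntegrable u ∧
      ∃ U : Set.Icc 0 T → Ω → H,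
        (∀ t, ColoredChaos.IsChaosSum P (ColoredChaos.xi P h W) (fun α => u α t) (U t)) ∧
        -- the mean square bound
        ∃ Co : ℝ, 1 ≤ Co ∧ Co ≤ 3 ∧
          (F =ᵐ[ColoredChaos.timeMeasure T] 0 →
            (∀ ℓ, G ℓ =ᵐ[ColoredChaos.timeMeasure T] 0) → Co = 1) ∧
          (0 ≤ CA → ∀ t, ∫ ω, ‖U t ω‖ ^ 2 ∂P ≤
            Co * Real.exp ((CA + ColoredChaos.operatorSize K B) * T)
              * ColoredChaos.inputSize δA K u₀ F G) := by
  have hW' : ∀ ℓ, IsPreBrownianReal (W ℓ) P := fun ℓ => (hW ℓ).brownian.toIsPreBrownianReal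
  exact ColoredChaos.chaosSolution_of_orthonormal hι hT hδA hA h.orthonormal
    (ColoredChaos.memLp_xi hW' hWindep h.orthonormal)
    (ColoredChaos.integral_xi_mul_xi hW' hWindep h.orthonormal)
    (ColoredChaos.integral_xi hW' hWindep h.orthonormal) hF hG hI hCB
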